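/- Let $\Bbbk$ be a field and let $A=\bigoplus_{j\ge 0}A_j$ be a Koszul $\Bbbk$-algebra, i.e. $A$ is graded and connected ($A_0=\Bbbk$) and $\operatorname{Ext}^{i,j}_A(\Bbbk,\Bbbk)=0$ for $i\ne j$, where $i$ is the homological and $j$ the internal degree. Put $V=A_1$ and $\otimes=\otimes_{\Bbbk}$, let $R\subseteq V\otimes V$ be the kernel of the multiplication $V\otimes V\to A_2$, let $K'_0=\Bbbk$, $K'_1=V$ and $K'_i=\bigcap_{j+l=i-2}V^{\otimes j}\otimes R\otimes V^{\otimes l}$ for $i\ge 2$. Let $P$ be the shifted Koszul bimodule resolution of $A$: $P_{1-i}=A\otimes K'_i\otimes A$ for $i\ge 0$ and $P_j=0$ for $j>1$. Define bimodule maps $\delta_n:P\to P^{\otimes_A n}$ of degree $1$ by linearly extending $$\delta_1(1\otimes v_1\cdots v_i\otimes 1)=v_1\otimes v_2\cdots v_i\otimes 1+(-1)^i\,1\otimes v_1\cdots v_{i-1}\otimes v_i\quad(i\ge1),\qquad \delta_1|_{P_1}=0,$$ $$\delta_2(1\otimes v_1\cdots v_i\otimes 1)=\sum_{s=0}^{i}(-1)^s(1\otimes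 v_1\cdots v_s\otimes 1)\otimes_A(1\otimes v_{s+1}\cdots v_i\otimes 1),$$ and $\delta_n=0$ for $n\ne 1,2$. Tensor products of maps follow the Koszul sign rule $(f\otimes_A g)(x\otimes_A y)=(-1)^{|g||x|}f(x)\otimes_A g(y)$. Then: (a) $(P,\delta)$ is an $A_\infty$-coalgebra in graded $A$-bimodules, i.e. $\sum_{r+s+t=N}(1^{\otimes_A r}\otimes_A\delta_s\otimes_A1^{\otimes_A t})\,\delta_{N-s+1}=0$ for all $N\ge0$. (b) The multiplication maps $\pi_p:V^{\otimes p}\to A$ have image $A_p$ for all $p\ge 0$. (c) Let $n\ge 0$ and let $\alpha_0:P_{1-n}\to A$ be a Hochschild $n$-cocycle, i.e. a bimodule map (extended by $0$ to $P$) with $\alpha_0\delta_1=0$. Let $(x_t)_t$ be any basis of $K'_n$, and choose any elements $y_t=\sum_p y_{t,p}\in\bigoplus_{p\ge 0}V^{\otimes p}$ with $\sum_p\pi_p(y_{t,p})=\alpha_0(1\otimes x_t\otimes 1)$ (such $y_t$ exist by (b); if $\alpha_0$ maps $K'_n$ to $A_p$, one may take $y_t\in V^{\otimes p}$). For $k\ge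 1$ define $\alpha_k$ on $P_{-i}$ for $i\le n-1$ by $\alpha_k|_{P_{-i}}=0$ if $i<n-1$, and on $P_{1-n}$ by $$\alpha_k(1\otimes x_t\otimes 1)=(-1)^k\sum_{p\ge k}\ \sum_{i_0+\cdots+i_k=p-k}\bigl(\pi_{i_0}\otimes_A\tau\otimes_A\pi_{i_1}\otimes_A\tau\otimes_A\cdots\otimes_A\tau\otimes_A\pi_{i_k}\bigr)(y_{t,p})\in P^{\otimes_A k},$$ where $\tau:V\to P_0=A\otimes V\otimes A$, $v\mapsto 1\otimes v\otimes 1$. Then the maps $\alpha_k$ ($k\ge1$) can be extended to bimodule maps $\alpha_k:P\to P^{\otimes_A k}$ of degree $n-1$ such that $\alpha=\sum_{k\ge 0}\alpha_k$ is an $A_\infty$-coderivation of degree $n-1$ on $(P,\delta)$: for all $N\ge 0$, $$\sum_{r+s+t=N}(1^{\otimes_A r}\otimes_A\delta_s\otimes_A1^{\otimes_A t})\,\alpha_{N-s+1}=(-1)^{n-1}\sum_{r+s+t=N}(1^{\otimes_A r}\otimes_A\alpha_s\otimes_A1^{\otimes_A t})\,\delta_{N-s+1}.$$ -/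

import Mathlib

set_option linter.unusedSectionVars false

namespace AInfinity

open scoped TensorProduct DirectSum
open MulOpposite

/-- The enveloping algebra `A ⊗ Aᵒᵖ`; an `A`-bimodule is a left module over it, with
`a • c • b = (a ⊗ op b) • c`. -/
abbrev Env (k A : Type*) [Field k] [Ring A] [Algebra k A] : Type _ := A ⊗[k] Aᵐᵒᵖ

section FreeAlgebra

variable (k A C : Type*) [Field k] [Ring A] [Algebra k A] [AddCommGroup C] [Module k C]
  [Module (Env k A) C]

/-- The regular bimodule `A`. -/
noncomputable instance instModuleEnvSelf : Module (Env k A) A := instModuleTensorProductMop k A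

theorem env_smul_self (a : A) (b : Aᵐᵒᵖ) (x : A) :
    ((a ⊗ₜ[k] b : Env k A) • x) = a * x * b.unop :=
  (AlgHom.mulLeftRight_apply k A a b x)

/-- The relations which turn the tensor `k`-algebra on `A ⊕ C` into the tensor algebra
`T_A(C)` of the `A`-bimodule `C`. -/
inductive TRel : TensorAlgebra k (A × C) → TensorAlgebra k (A × C) → Prop
  | one : TRel (TensorAlgebra.ι k (1, 0)) 1
  | mul (a b : A) : TRel (TensorAlgebra.ι k (a * b, 0))
      (TensorAlgebra.ι k (a, 0) * TensorAlgebra.ι k (b, 0))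
  | left (a : A) (c : C) : TRel (TensorAlgebra.ι k (0, (a ⊗ₜ[k] 1 : Env k A) • c))
      (TensorAlgebra.ι k (a, 0) * TensorAlgebra.ι k (0, c))
  | right (c : C) (b : A) : TRel (TensorAlgebra.ι k (0, (1 ⊗ₜ[k] op b : Env k A) • c))
      (TensorAlgebra.ι k (0, c) * TensorAlgebra.ι k (b, 0))

/-- The tensor algebra `T(C) = ⨁ₙ C^{⊗_A n}` of the `A`-bimodule `C`, i.e. the free algebra in
`A`-bimodules on `C`. -/
def T : Type _ := RingQuot (TRel k A C)

noncomputable instance : Ring (T k A C) := inferInstanceAs (Ring (RingQuot (TRel k A C)))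
noncomputable instance : Algebra k (T k A C) :=
  inferInstanceAs (Algebra k (RingQuot (TRel k A C)))

namespace T

noncomputable def mk : TensorAlgebra k (A × C) →ₐ[k] T k A C := RingQuot.mkAlgHom k (TRel k A C)

variable {k A C} in
theorem mk_rel {x y : TensorAlgebra k (A × C)} (h : TRel k A C x y) : mk k A C x = mk k A C y :=
  RingQuot.mkAlgHom_rel k h

/-- The inclusion `A = C^{⊗_A 0} → T(C)`. -/
noncomputable def inl : A →ₐ[k] T k A C :=
  AlgHom.ofLinearMap ((mk k A C).toLinearMap ∘ₗ TensorAlgebra.ι k ∘ₗ LinearMap.inl k A C)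
    (by simpa using mk_rel (TRel.one (k := k) (A := A) (C := C)))
    (fun a b => by simpa using mk_rel (TRel.mul (k := k) (C := C) a b))

/-- `T(C)` is an `A`-bimodule via `(a ⊗ op b) • t = a * t * b`. -/
noncomputable instance : Module (Env k A) (T k A C) :=
  Module.compHom (T k A C)
    (((AlgHom.mulLeftRight k (T k A C)).comp
      (Algebra.TensorProduct.map (inl k A C) (inl k A C).op) :
        Env k A →ₐ[k] Module.End k (T k A C)) : Env k A →+* Module.End k (T k A C))

theorem env_smul (a : A) (b : Aᵐᵒᵖ) (x : T k A C) :
    ((a ⊗ₜ[k] b : Env k A) • x) = inl k A C a * x * inl k A C b.unop :=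
  (AlgHom.mulLeftRight_apply k (T k A C) _ _ x)

instance : IsScalarTower k (Env k A) (T k A C) where
  smul_assoc r e x := by
    change ((AlgHom.mulLeftRight k (T k A C)).comp
      (Algebra.TensorProduct.map (inl k A C) (inl k A C).op) (r • e)) x = _
    rw [map_smul]
    rfl

/-- The inclusion `C = C^{⊗_A 1} → T(C)`. -/
noncomputable def ι [IsScalarTower k (Env k A) C] : C →ₗ[Env k A] T k A C where
  toFun c := mk k A C (TensorAlgebra.ι k (0, c))
  map_add' c c' := by
    rw [← map_add, ← map_add]; simp
  map_smul' e c := by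
    induction e using TensorProduct.induction_on with
    | zero =>
      have h0 : (0 : Env k A) • c = 0 := zero_smul (Env k A) c
      have h1 : (0 : Env k A) • mk k A C (TensorAlgebra.ι k (0, c)) = 0 :=
        zero_smul (Env k A) (mk k A C (TensorAlgebra.ι k (0, c)))
      rw [RingHom.id_apply, h1, h0]
      exact (by simp : ((mk k A C).toLinearMap ∘ₗ TensorAlgebra.ι k) (0 : A × C) = 0)
    | add x y hx hy =>
      simp only [add_smul, RingHom.id_apply] at *
      rw [← hx, ← hy, ← map_add, ← map_add]; simp
    | tmul a b =>
      have h : ((a ⊗ₜ[k] b : Env k A) • c)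
          = (a ⊗ₜ[k] 1 : Env k A) • (1 ⊗ₜ[k] op b.unop : Env k A) • c := by
        rw [← mul_smul]; simp
      rw [RingHom.id_apply, h, env_smul, mk_rel (TRel.left _ _), map_mul,
        mk_rel (TRel.right _ _), map_mul, ← mul_assoc]
      rfl

variable {k A C}
variable [IsScalarTower k (Env k A) C]

/-- The universal property of `T(C)`. -/
noncomputable def lift {B : Type*} [Ring B] [Algebra k B] (f : A →ₐ[k] B) (g : C →ₗ[k] B)
    (hl : ∀ a c, g ((a ⊗ₜ[k] 1 : Env k A) • c) = f a * g c)
    (hr : ∀ c b, g ((1 ⊗ₜ[k] op b : Env k A) • c) = g c * f b) : T k A C →ₐ[k] B :=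
  RingQuot.liftAlgHom k ⟨TensorAlgebra.lift k (f.toLinearMap.coprod g), fun x y h => by
    cases h <;> simp [hl, hr]⟩

@[simp] theorem lift_inl {B : Type*} [Ring B] [Algebra k B] (f : A →ₐ[k] B) (g : C →ₗ[k] B)
    (hl : ∀ a c, g ((a ⊗ₜ[k] 1 : Env k A) • c) = f a * g c)
    (hr : ∀ c b, g ((1 ⊗ₜ[k] op b : Env k A) • c) = g c * f b) (a : A) :
    lift f g hl hr (inl k A C a) = f a := by
  exact (RingQuot.liftAlgHom_mkAlgHom_apply k _ _ (TensorAlgebra.ι k (a, 0))).trans (by simp)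

@[simp] theorem lift_ι {B : Type*} [Ring B] [Algebra k B] (f : A →ₐ[k] B) (g : C →ₗ[k] B)
    (hl : ∀ a c, g ((a ⊗ₜ[k] 1 : Env k A) • c) = f a * g c)
    (hr : ∀ c b, g ((1 ⊗ₜ[k] op b : Env k A) • c) = g c * f b) (c : C) :
    lift f g hl hr (ι k A C c) = g c := by
  exact (RingQuot.liftAlgHom_mkAlgHom_apply k _ _ (TensorAlgebra.ι k (0, c))).trans (by simp)

theorem induction {p : T k A C → Prop} (h_inl : ∀ a, p (inl k A C a)) (h_ι : ∀ c, p (ι k A C c))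
    (h_add : ∀ x y, p x → p y → p (x + y)) (h_mul : ∀ x y, p x → p y → p (x * y))
    (x : T k A C) : p x := by
  obtain ⟨x, rfl⟩ := RingQuot.mkAlgHom_surjective k (TRel k A C) x
  change p (mk k A C x)
  induction x using TensorAlgebra.induction with
  | algebraMap r =>
    rw [AlgHom.commutes, ← (inl k A C).commutes]
    exact h_inl _
  | ι z =>
    have hz : z = (z.1, 0) + (0, z.2) := by simp
    rw [hz, map_add, map_add]
    exact h_add _ _ (h_inl z.1) (h_ι z.2)
  | mul x y hx hy => rw [map_mul]; exact h_mul _ _ hx hy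
  | add x y hx hy => rw [map_add]; exact h_add _ _ hx hy

end T

end FreeAlgebra

section Graded

variable {k A C : Type*} [Field k] [Ring A] [Algebra k A] [AddCommGroup C] [Module k C]
  [Module (Env k A) C] [IsScalarTower k (Env k A) C]
  (𝒞 : ℤ → Submodule (Env k A) C)

/-- The degree `m` part of `C^{⊗_A n}`, inside `T(C)`: it is spanned by the products
`a * c₁ * ⋯ * cₙ` with `cᵢ` homogeneous of degrees adding up to `m`; in particular
`C^{⊗_A 0} = A` sits in degree `0`. -/
noncomputable def tensorPow : ℕ → ℤ → Submodule k (T k A C)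
  | 0, m => if m = 0 then LinearMap.range (T.inl k A C).toLinearMap else ⊥
  | n + 1, m => ⨆ i : ℤ, tensorPow n (m - i) *
      Submodule.map ((T.ι k A C).restrictScalars k) ((𝒞 i).restrictScalars k)

variable [DirectSum.Decomposition 𝒞]

/-- `c ↦ (-1)^{l i} c` for `c` of degree `i`. -/
noncomputable def koszulSign (l : ℤ) : C →ₗ[Env k A] C :=
  DirectSum.toModule (Env k A) ℤ C (fun i => ((l * i).negOnePow : ℤ) • (𝒞 i).subtype) ∘ₗ
    (DirectSum.decomposeLinearEquiv 𝒞).toLinearMap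

theorem koszulSign_of_mem (l : ℤ) {i : ℤ} {c : C} (hc : c ∈ 𝒞 i) :
    koszulSign 𝒞 l c = ((l * i).negOnePow : ℤ) • c := by
  have h : DirectSum.decomposeLinearEquiv 𝒞 c
      = DirectSum.lof (Env k A) ℤ (fun i => 𝒞 i) i ⟨c, hc⟩ := DirectSum.decompose_of_mem 𝒞 hc
  simp only [koszulSign, LinearMap.comp_apply, LinearEquiv.coe_coe, h, DirectSum.toModule_lof]
  rfl

/-- The algebra map `x ↦ !![(-1)^{l |x|} x, D x; 0, x]`, where `D` is the derivation of
degree `l` of `T(C)` extending `f`. -/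
noncomputable def derivationMatrix (l : ℤ) (f : C →ₗ[Env k A] T k A C) :
    T k A C →ₐ[k] Matrix (Fin 2) (Fin 2) (T k A C) :=
  T.lift ((Matrix.scalarAlgHom (Fin 2) k).comp (T.inl k A C))
    { toFun := fun c => !![T.ι k A C (koszulSign 𝒞 l c), f c; 0, T.ι k A C c]
      map_add' := fun c c' => by ext i j; fin_cases i <;> fin_cases j <;> simp
      map_smul' := fun r c => by
        have hs : ∀ (g : C →ₗ[Env k A] T k A C), g (r • c) = r • g c := fun g =>
          (g.restrictScalars k).map_smul r c
        have h := hs (T.ι k A C ∘ₗ koszulSign 𝒞 l)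
        ext i j; fin_cases i <;> fin_cases j <;> simp_all }
    (fun a c => by
      ext i j; fin_cases i <;> fin_cases j <;> simp [T.env_smul, Matrix.mul_apply])
    (fun c b => by
      ext i j; fin_cases i <;> fin_cases j <;> simp [T.env_smul, Matrix.mul_apply])

/-- The derivation of degree `l` of `T(C)` that vanishes on `A` and extends `f : C → T(C)`.
On `C^{⊗_A m}` it is `∑_{r+1+t=m} 1^{⊗ r} ⊗ f ⊗ 1^{⊗ t}`, with the Koszul sign rule. -/
noncomputable def derivation (l : ℤ) (f : C →ₗ[Env k A] T k A C) : T k A C →ₗ[k] T k A C where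
  toFun x := derivationMatrix 𝒞 l f x 0 1
  map_add' x y := by simp
  map_smul' r x := by simp

theorem derivation_inl (l : ℤ) (f : C →ₗ[Env k A] T k A C) (a : A) :
    derivation 𝒞 l f (T.inl k A C a) = 0 := by
  simp [derivation, derivationMatrix]

theorem derivation_ι (l : ℤ) (f : C →ₗ[Env k A] T k A C) (c : C) :
    derivation 𝒞 l f (T.ι k A C c) = f c := by
  simp [derivation, derivationMatrix]

theorem derivationMatrix_one (l : ℤ) (f : C →ₗ[Env k A] T k A C) (x : T k A C) :
    derivationMatrix 𝒞 l f x 1 0 = 0 ∧ derivationMatrix 𝒞 l f x 1 1 = x := by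
  induction x using T.induction with
  | h_inl a => simp [derivationMatrix]
  | h_ι c => simp [derivationMatrix]
  | h_add x y hx hy => simp [hx, hy]
  | h_mul x y hx hy => simp [Matrix.mul_apply, Fin.sum_univ_two, hx, hy]

theorem derivationMatrix_of_mem (l : ℤ) (f : C →ₗ[Env k A] T k A C) (n : ℕ) :
    ∀ (m : ℤ) (x : T k A C), x ∈ tensorPow 𝒞 n m →
      derivationMatrix 𝒞 l f x 0 0 = ((l * m).negOnePow : ℤ) • x := by
  induction n with
  | zero =>
    intro m x hx
    by_cases hm : m = 0
    · rw [tensorPow, if_pos hm] at hx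
      obtain ⟨a, rfl⟩ := hx
      simp [derivationMatrix, hm]
    · rw [tensorPow, if_neg hm, Submodule.mem_bot] at hx
      simp [hx]
  | succ n ih =>
    intro m x hx
    rw [tensorPow] at hx
    induction hx using Submodule.iSup_induction' with
    | zero => simp
    | add x y _ _ hx hy => simp only [map_add, Matrix.add_apply, hx, hy, smul_add]
    | mem i x hx =>
      induction hx using Submodule.mul_induction_on' with
      | mem_mul_mem x hx y hy =>
        obtain ⟨c, hc, rfl⟩ := hy
        have h0 : derivationMatrix 𝒞 l f (T.ι k A C c) 0 0
            = ((l * i).negOnePow : ℤ) • T.ι k A C c := by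
          simp only [derivationMatrix, T.lift_ι]
          simp [koszulSign_of_mem 𝒞 l hc]
        have h1 := (derivationMatrix_one 𝒞 l f (T.ι k A C c)).1
        have hs : l * m = l * (m - i) + l * i := by ring
        simp only [LinearMap.coe_restrictScalars, map_mul, Matrix.mul_apply, Fin.sum_univ_two,
          ih _ _ hx, h0, h1, mul_zero, add_zero]
        rw [smul_mul_smul_comm, hs, Int.negOnePow_add, Units.val_mul]
      | add x _ y _ hx hy => simp only [map_add, Matrix.add_apply, hx, hy, smul_add]

/-- The Leibniz rule with the Koszul sign. -/
theorem derivation_mul (l : ℤ) (f : C →ₗ[Env k A] T k A C) {m : ℤ} {n : ℕ} {x : T k A C}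
    (hx : x ∈ tensorPow 𝒞 n m) (y : T k A C) :
    derivation 𝒞 l f (x * y)
      = derivation 𝒞 l f x * y + ((l * m).negOnePow : ℤ) • (x * derivation 𝒞 l f y) := by
  have h0 := derivationMatrix_of_mem 𝒞 l f n m x hx
  have h1 := (derivationMatrix_one 𝒞 l f y).2
  change derivationMatrix 𝒞 l f (x * y) 0 1 = derivationMatrix 𝒞 l f x 0 1 * y
    + ((l * m).negOnePow : ℤ) • (x * derivationMatrix 𝒞 l f y 0 1)
  rw [map_mul, Matrix.mul_apply, Fin.sum_univ_two, h0, h1, smul_mul_assoc, add_comm]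

/-- An `A_∞`-coalgebra structure on the graded bimodule `C = ⨁ᵢ 𝒞 i`: bimodule maps
`δₙ : C → C^{⊗_A n}` of degree `1` with `δ₀ = 0` and
`∑_{r+s+t=N} (1^{⊗ r} ⊗ δₛ ⊗ 1^{⊗ t}) δ_{N-s+1} = 0` for all `N`. -/
structure IsCoalgebra (δ : ℕ → C →ₗ[Env k A] T k A C) : Prop where
  degree : ∀ (n : ℕ) (i : ℤ), ∀ c ∈ 𝒞 i, δ n c ∈ tensorPow 𝒞 n (i + 1)
  zero : δ 0 = 0
  eq : ∀ (N : ℕ) (c : C),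
    ∑ s ∈ Finset.range (N + 1), derivation 𝒞 1 (δ s) (δ (N - s + 1) c) = 0

/-- An `A_∞`-coderivation of degree `l` with respect to `δ`: bimodule maps
`fₙ : C → C^{⊗_A n}` of degree `l` with
`∑_{r+s+t=N} (1^{⊗ r} ⊗ δₛ ⊗ 1^{⊗ t}) f_{N-s+1}
  = (-1)^l ∑_{r+s+t=N} (1^{⊗ r} ⊗ fₛ ⊗ 1^{⊗ t}) δ_{N-s+1}` for all `N`. -/
structure IsCoderivation (δ : ℕ → C →ₗ[Env k A] T k A C) (l : ℤ)
    (f : ℕ → C →ₗ[Env k A] T k A C) : Prop where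
  degree : ∀ (n : ℕ) (i : ℤ), ∀ c ∈ 𝒞 i, f n c ∈ tensorPow 𝒞 n (i + l)
  eq : ∀ (N : ℕ) (c : C),
    ∑ s ∈ Finset.range (N + 1), derivation 𝒞 1 (δ s) (f (N - s + 1) c)
      = (l.negOnePow : ℤ) • ∑ s ∈ Finset.range (N + 1), derivation 𝒞 l (f s) (δ (N - s + 1) c)

end Graded
end AInfinity

namespace Koszul

open scoped TensorProduct DirectSum
open MulOpposite AInfinity

section Slices

variable {k M N : Type*} [Field k] [AddCommGroup M] [Module k M] [AddCommGroup N] [Module k N]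

theorem mem_range_rTensor_of_slices (X : Submodule k M) (z : M ⊗[k] N)
    (h : ∀ φ : N →ₗ[k] k, TensorProduct.rid k M (φ.lTensor M z) ∈ X) :
    z ∈ LinearMap.range (X.subtype.rTensor N) := by
  classical
  let b := Module.Basis.ofVectorSpace k N
  rw [← (TensorProduct.equivFinsuppOfBasisRight (M := M) b).symm_apply_apply z,
    TensorProduct.equivFinsuppOfBasisRight_symm_apply]
  refine Submodule.sum_mem _ fun i _ => ?_
  have hi := h (b.coord i)
  rw [← TensorProduct.equivFinsuppOfBasisRight_apply] at hi
  exact ⟨(⟨_, hi⟩ : X) ⊗ₜ b i, rfl⟩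

theorem mem_range_lTensor_of_slices (Y : Submodule k N) (z : M ⊗[k] N)
    (h : ∀ φ : M →ₗ[k] k, TensorProduct.lid k N (φ.rTensor N z) ∈ Y) :
    z ∈ LinearMap.range (Y.subtype.lTensor M) := by
  classical
  let b := Module.Basis.ofVectorSpace k M
  rw [← (TensorProduct.equivFinsuppOfBasisLeft (N := N) b).symm_apply_apply z,
    TensorProduct.equivFinsuppOfBasisLeft_symm_apply]
  refine Submodule.sum_mem _ fun i _ => ?_
  have hi := h (b.coord i)
  rw [← TensorProduct.equivFinsuppOfBasisLeft_apply] at hi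
  exact ⟨b i ⊗ₜ (⟨_, hi⟩ : Y), rfl⟩

theorem mem_range_mapIncl_of_slices (X : Submodule k M) (Y : Submodule k N) (z : M ⊗[k] N)
    (hX : ∀ φ : N →ₗ[k] k, TensorProduct.rid k M (φ.lTensor M z) ∈ X)
    (hY : ∀ φ : M →ₗ[k] k, TensorProduct.lid k N (φ.rTensor N z) ∈ Y) :
    z ∈ LinearMap.range (TensorProduct.mapIncl X Y) := by
  obtain ⟨z, rfl⟩ := mem_range_rTensor_of_slices X z hX
  obtain ⟨z, rfl⟩ := mem_range_lTensor_of_slices Y z (fun φ => by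
    obtain ⟨ψ, rfl⟩ := LinearMap.exists_extend φ
    have := hY ψ
    rwa [← LinearMap.comp_apply, ← LinearMap.rTensor_comp] at this)
  refine ⟨z, ?_⟩
  rw [← LinearMap.comp_apply, LinearMap.rTensor_comp_lTensor]

variable {S : Type*} [Ring S] [Algebra k S]

theorem slice_mem_left {X P Q : Submodule k S} (H : P.LinearDisjoint Q) (hX : X ≤ P)
    (z : P ⊗[k] Q) (hz : Submodule.mulMap P Q z ∈ X * Q) (φ : Q →ₗ[k] k) :
    (TensorProduct.rid k P (φ.lTensor P z) : S) ∈ X := by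
  rw [← Submodule.mulMap_range] at hz
  obtain ⟨y, hy⟩ := hz
  have key : Submodule.mulMap X Q = Submodule.mulMap P Q ∘ₗ (Submodule.inclusion hX).rTensor Q :=
    TensorProduct.ext' fun _ _ => rfl
  rw [key] at hy
  rw [← H.injective hy]
  clear hy
  induction y with
  | zero => simp
  | add x y hx hy => simp only [map_add, Submodule.coe_add]; exact X.add_mem hx hy
  | tmul x q => simpa using X.smul_mem _ x.2

theorem slice_mem_right {Y P Q : Submodule k S} (H : P.LinearDisjoint Q) (hY : Y ≤ Q)
    (z : P ⊗[k] Q) (hz : Submodule.mulMap P Q z ∈ P * Y) (φ : P →ₗ[k] k) :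
    (TensorProduct.lid k Q (φ.rTensor Q z) : S) ∈ Y := by
  rw [← Submodule.mulMap_range] at hz
  obtain ⟨y, hy⟩ := hz
  have key : Submodule.mulMap P Y = Submodule.mulMap P Q ∘ₗ (Submodule.inclusion hY).lTensor P :=
    TensorProduct.ext' fun _ _ => rfl
  rw [key] at hy
  rw [← H.injective hy]
  clear hy
  induction y with
  | zero => simp
  | add x y hx hy => simp only [map_add, Submodule.coe_add]; exact Y.add_mem hx hy
  | tmul p y => simpa using Y.smul_mem _ y.2

end Slices

section TensorAlgebraPowers

variable (k V : Type*) [Field k] [AddCommGroup V] [Module k V]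

/-- The summand `V^{⊗ n}` of the tensor algebra of `V`. -/
noncomputable abbrev tpow (n : ℕ) : Submodule k (TensorAlgebra k V) :=
  LinearMap.range (TensorAlgebra.ι k : V →ₗ[k] TensorAlgebra k V) ^ n

theorem tpow_le_range (n : ℕ) :
    tpow k V n ≤ LinearMap.range (TensorPower.toTensorAlgebra (R := k) (M := V) (n := n)) := by
  induction n with
  | zero =>
    rw [tpow, pow_zero, Submodule.one_le]
    exact ⟨_, TensorPower.toTensorAlgebra_gOne⟩
  | succ n ih =>
    rw [tpow, pow_succ, Submodule.mul_le]
    rintro x hx _ ⟨v, rfl⟩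
    obtain ⟨a, rfl⟩ := ih hx
    refine ⟨GradedMonoid.GMul.mul (A := fun n => ⨂[k]^n V) a
      (PiTensorProduct.tprod k (fun _ : Fin 1 => v)), ?_⟩
    rw [TensorPower.toTensorAlgebra_gMul, TensorPower.toTensorAlgebra_tprod]
    simp

theorem toTensorAlgebra_injective (n : ℕ) :
    Function.Injective (TensorPower.toTensorAlgebra (R := k) (M := V) (n := n)) := by
  intro x y h
  have h' : ∀ x : ⨂[k]^n V, TensorAlgebra.equivDirectSum.symm (DirectSum.of (fun n => ⨂[k]^n V) n x)
      = TensorPower.toTensorAlgebra x := fun x => by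
    change TensorAlgebra.ofDirectSum (DirectSum.of (fun n => ⨂[k]^n V) n x) = _
    exact DirectSum.toAddMonoid_of (β := fun n => ⨂[k]^n V) _ n x
  rw [← h', ← h'] at h
  exact DirectSum.of_injective (β := fun n => ⨂[k]^n V) n (TensorAlgebra.equivDirectSum.symm.injective h)

theorem tpow_linearDisjoint (i j : ℕ) : (tpow k V i).LinearDisjoint (tpow k V j) := by
  refine Submodule.LinearDisjoint.of_le_of_flat_right (R := k)
    (M := LinearMap.range (TensorPower.toTensorAlgebra (R := k) (M := V) (n := i)))
    (N := LinearMap.range (TensorPower.toTensorAlgebra (R := k) (M := V) (n := j)))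
    ?_ (tpow_le_range k V i) (tpow_le_range k V j)
  refine ⟨?_⟩
  refine (injective_iff_map_eq_zero _).2 fun z hz => ?_
  let f := (TensorPower.toTensorAlgebra (R := k) (M := V) (n := i))
  let g := (TensorPower.toTensorAlgebra (R := k) (M := V) (n := j))
  obtain ⟨z, rfl⟩ := TensorProduct.map_surjective f.surjective_rangeRestrict
    g.surjective_rangeRestrict z
  have key : Submodule.mulMap (LinearMap.range f) (LinearMap.range g) ∘ₗ
      TensorProduct.map f.rangeRestrict g.rangeRestrict
      = TensorPower.toTensorAlgebra ∘ₗ (TensorPower.mulEquiv (R := k) (M := V)).toLinearMap := by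
    refine TensorProduct.ext' fun a b => ?_
    exact (TensorPower.toTensorAlgebra_gMul a b).symm
  have h0 : TensorPower.toTensorAlgebra (TensorPower.mulEquiv z) = 0 :=
    (LinearMap.congr_fun key z).symm.trans hz
  rw [← map_zero TensorPower.toTensorAlgebra] at h0
  have := toTensorAlgebra_injective k V _ h0
  rw [(LinearEquiv.map_eq_zero_iff _).1 this, map_zero]

end TensorAlgebraPowers

section KoszulAlgebra

variable {k A : Type*} [Field k] [Ring A] [Algebra k A] (𝒜 : ℕ → Submodule k A)

section Ext

variable [GradedAlgebra 𝒜]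

/-- The ideal `A₊ = ⨁_{j > 0} A_j`. -/
def Aplus : Submodule k A := LinearMap.ker (GradedAlgebra.proj 𝒜 0)

theorem mul_mem_Aplus {a b : A} (ha : a ∈ Aplus 𝒜) : a * b ∈ Aplus 𝒜 := by
  rw [Aplus, LinearMap.mem_ker] at *
  rw [GradedAlgebra.proj_apply] at *
  have := (GradedRing.projZeroRingHom 𝒜).map_mul a b
  simp only [GradedRing.projZeroRingHom_apply] at this
  rw [this, ha, zero_mul]

/-- Cochains of the bigraded (reduced) cobar complex `Hom(A₊^{⊗ i}, k)_j`: multilinear functions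
of `i` arguments in `A₊` which vanish on homogeneous arguments of total degree `≠ j`. -/
def IsCochain (i j : ℕ) (φ : MultilinearMap k (fun _ : Fin i => Aplus 𝒜) k) : Prop :=
  ∀ (a : Fin i → Aplus 𝒜) (m : Fin i → ℕ), (∀ s, (a s : A) ∈ 𝒜 (m s)) → ∑ s, m s ≠ j → φ a = 0

/-- `(a₁, …, a_{i+1}) ↦ (a₁, …, a_s a_{s+1}, …, a_{i+1})`, with `s` counted from `0` in the code. -/
def merge {i : ℕ} (s : Fin i) (a : Fin (i + 1) → Aplus 𝒜) : Fin i → Aplus 𝒜 := fun t =>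
  if t < s then a t.castSucc
  else if t = s then ⟨a s.castSucc * a s.succ, mul_mem_Aplus 𝒜 (a s.castSucc).2⟩
  else a t.succ

/-- The differential `(dφ)(a₁, …, a_{i+1}) = ∑ₛ (-1)^s φ(a₁, …, a_s a_{s+1}, …, a_{i+1})`. -/
def cobarD {i : ℕ} (φ : MultilinearMap k (fun _ : Fin i => Aplus 𝒜) k)
    (a : Fin (i + 1) → Aplus 𝒜) : k :=
  ∑ s : Fin i, (-1) ^ ((s : ℕ) + 1) * φ (merge 𝒜 s a)

/-- `Ext^{i,j}_A(k, k) = 0`, where `Ext` is computed by the bar resolution of `k` and `j` is the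
internal degree: every cocycle of bidegree `(i, j)` is a coboundary. -/
def ExtVanishes : ℕ → ℕ → Prop
  | 0, j => ∀ φ : MultilinearMap k (fun _ : Fin 0 => Aplus 𝒜) k, IsCochain 𝒜 0 j φ →
      (∀ a, cobarD 𝒜 φ a = 0) → φ = 0
  | i + 1, j => ∀ φ : MultilinearMap k (fun _ : Fin (i + 1) => Aplus 𝒜) k,
      IsCochain 𝒜 (i + 1) j φ → (∀ a, cobarD 𝒜 φ a = 0) →
      ∃ ψ : MultilinearMap k (fun _ : Fin i => Aplus 𝒜) k,
        IsCochain 𝒜 i j ψ ∧ ∀ a, φ a = cobarD 𝒜 ψ a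

/-- `A = ⨁_{j ≥ 0} A_j` is a Koszul algebra: it is connected (`A₀ = k`) and
`Ext^{i,j}_A(k, k) = 0` for `i ≠ j`. -/
structure IsKoszul : Prop where
  nontrivial : Nontrivial A
  connected : 𝒜 0 = 1
  ext_eq_zero : ∀ i j, i ≠ j → ExtVanishes 𝒜 i j

end Ext

/-- The canonical map `T_k(V) → A`, where `V = A₁`. -/
noncomputable def toA : TensorAlgebra k (𝒜 1) →ₐ[k] A := TensorAlgebra.lift k (𝒜 1).subtype

/-- The quadratic relations `R ⊆ V ⊗ V`. -/
noncomputable def R : Submodule k (TensorAlgebra k (𝒜 1)) :=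
  LinearMap.ker (toA 𝒜).toLinearMap ⊓ tpow k (𝒜 1) 2

/-- `K'_i = ⋂_{j+l=i-2} V^{⊗ j} ⊗ R ⊗ V^{⊗ l} ⊆ V^{⊗ i}`; so `K'_0 = k`, `K'_1 = V`, `K'_2 = R`. -/
noncomputable def KPrime (i : ℕ) : Submodule k (TensorAlgebra k (𝒜 1)) :=
  tpow k (𝒜 1) i ⊓
    ⨅ (j : ℕ) (l : ℕ) (_ : j + 2 + l = i), tpow k (𝒜 1) j * R 𝒜 * tpow k (𝒜 1) l

theorem R_le : R 𝒜 ≤ tpow k (𝒜 1) 2 := inf_le_right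

theorem KPrime_linearDisjoint (i j : ℕ) : (KPrime 𝒜 i).LinearDisjoint (KPrime 𝒜 j) :=
  Submodule.LinearDisjoint.of_le_of_flat_right (tpow_linearDisjoint k (𝒜 1) i j)
    inf_le_left inf_le_left

/-- Every element of `K'_{i+j}` lies in `K'_i ⊗ K'_j`. -/
theorem KPrime_le_range {i j n : ℕ} (h : i + j = n) :
    KPrime 𝒜 n ≤ LinearMap.range (Submodule.mulMap (KPrime 𝒜 i) (KPrime 𝒜 j)) := by
  subst h
  intro w hw
  have H := tpow_linearDisjoint k (𝒜 1) i j
  have hw1 : w ∈ tpow k (𝒜 1) i * tpow k (𝒜 1) j := by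
    rw [← pow_add]; exact hw.1
  have hw2 : ∀ a l, a + 2 + l = i + j → w ∈ tpow k (𝒜 1) a * R 𝒜 * tpow k (𝒜 1) l := by
    intro a l hal
    have := (Submodule.mem_inf.1 hw).2
    simp only [Submodule.mem_iInf] at this
    exact this a l hal
  rw [← Submodule.mulMap_range] at hw1
  obtain ⟨z, rfl⟩ := hw1
  have hz := mem_range_mapIncl_of_slices ((KPrime 𝒜 i).submoduleOf (tpow k (𝒜 1) i))
    ((KPrime 𝒜 j).submoduleOf (tpow k (𝒜 1) j)) z ?_ ?_
  · obtain ⟨y, rfl⟩ := hz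
    have hp : ∀ i : ℕ, ∀ x ∈ (KPrime 𝒜 i).submoduleOf (tpow k (𝒜 1) i),
        (tpow k (𝒜 1) i).subtype x ∈ KPrime 𝒜 i := fun i x hx => hx
    have key : Submodule.mulMap (KPrime 𝒜 i) (KPrime 𝒜 j) ∘ₗ
        TensorProduct.map (LinearMap.restrict _ (hp i)) (LinearMap.restrict _ (hp j))
        = Submodule.mulMap (tpow k (𝒜 1) i) (tpow k (𝒜 1) j) ∘ₗ TensorProduct.mapIncl _ _ :=
      TensorProduct.ext' fun _ _ => rfl
    exact ⟨_, LinearMap.congr_fun key y⟩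
  · intro φ
    refine ⟨Subtype.property _, ?_⟩
    rw [SetLike.mem_coe]
    simp only [Submodule.mem_iInf]
    intro a l hal
    refine slice_mem_left H ?_ z ?_ φ
    · rw [← hal, tpow, tpow, tpow, pow_add, pow_add]
      exact mul_le_mul' (mul_le_mul' le_rfl (R_le 𝒜)) le_rfl
    · have := hw2 a (l + j) (by omega)
      rwa [tpow, tpow, pow_add, ← mul_assoc] at this
  · intro φ
    refine ⟨Subtype.property _, ?_⟩
    rw [SetLike.mem_coe]
    simp only [Submodule.mem_iInf]
    intro a l hal
    refine slice_mem_right H ?_ z ?_ φ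
    · rw [← hal, tpow, tpow, tpow, pow_add, pow_add]
      exact mul_le_mul' (mul_le_mul' le_rfl (R_le 𝒜)) le_rfl
    · have := hw2 (i + a) l (by omega)
      rwa [tpow, tpow, pow_add, mul_assoc, mul_assoc, ← mul_assoc (_ ^ a)] at this

/-- The component `K'_n → K'_i ⊗ K'_j` (`i + j = n`) of the deconcatenation coproduct
`v₁ ⋯ vₙ ↦ v₁ ⋯ vᵢ ⊗ v_{i+1} ⋯ vₙ`. -/
noncomputable def decon {i j n : ℕ} (h : i + j = n) : KPrime 𝒜 n →ₗ[k] KPrime 𝒜 i ⊗[k] KPrime 𝒜 j :=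
  (LinearEquiv.ofInjective _ (KPrime_linearDisjoint 𝒜 i j).injective).symm.toLinearMap ∘ₗ
    Submodule.inclusion (KPrime_le_range 𝒜 h)

theorem mulMap_decon {i j n : ℕ} (h : i + j = n) (w : KPrime 𝒜 n) :
    Submodule.mulMap (KPrime 𝒜 i) (KPrime 𝒜 j) (decon 𝒜 h w) = w := by
  have := LinearEquiv.apply_symm_apply
    (LinearEquiv.ofInjective _ (KPrime_linearDisjoint 𝒜 i j).injective)
    (Submodule.inclusion (KPrime_le_range 𝒜 h) w)
  exact congrArg Subtype.val this

/-- The Koszul resolution `P = ⨁ᵢ A ⊗ K'_i ⊗ A`, as `A^e ⊗ ⨁ᵢ K'_i`. -/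
def P : Type _ := Env k A ⊗[k] (⨁ i : ℕ, KPrime 𝒜 i)

noncomputable instance : AddCommGroup (P 𝒜) :=
  inferInstanceAs (AddCommGroup (Env k A ⊗[k] (⨁ i : ℕ, KPrime 𝒜 i)))
noncomputable instance : Module k (P 𝒜) :=
  inferInstanceAs (Module k (Env k A ⊗[k] (⨁ i : ℕ, KPrime 𝒜 i)))
noncomputable instance : Module (Env k A) (P 𝒜) :=
  inferInstanceAs (Module (Env k A) (Env k A ⊗[k] (⨁ i : ℕ, KPrime 𝒜 i)))
instance : IsScalarTower k (Env k A) (P 𝒜) :=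
  inferInstanceAs (IsScalarTower k (Env k A) (Env k A ⊗[k] (⨁ i : ℕ, KPrime 𝒜 i)))

noncomputable def equivP : (Env k A ⊗[k] (⨁ i : ℕ, KPrime 𝒜 i)) ≃ₗ[Env k A] P 𝒜 :=
  LinearEquiv.refl _ _

/-- The generators `1 ⊗ w ⊗ 1` of `P`, for `w ∈ K'_i`. -/
noncomputable def gen (i : ℕ) : KPrime 𝒜 i →ₗ[k] P 𝒜 :=
  (equivP 𝒜).toLinearMap.restrictScalars k ∘ₗ
    TensorProduct.mk k (Env k A) (⨁ i : ℕ, KPrime 𝒜 i) 1 ∘ₗ DirectSum.lof k ℕ (fun i => KPrime 𝒜 i) i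

section Lift

variable {N : Type*} [AddCommMonoid N] [Module k N] [Module (Env k A) N]
  [IsScalarTower k (Env k A) N]

/-- The bimodule map on `P` with prescribed values on the generators. -/
noncomputable def liftP (g : ∀ i, KPrime 𝒜 i →ₗ[k] N) : P 𝒜 →ₗ[Env k A] N :=
  TensorProduct.AlgebraTensorModule.lift
    (LinearMap.toSpanSingleton (Env k A) ((⨁ i : ℕ, KPrime 𝒜 i) →ₗ[k] N)
      (DirectSum.toModule k ℕ N g)) ∘ₗ (equivP 𝒜).symm.toLinearMap

theorem liftP_gen (g : ∀ i, KPrime 𝒜 i →ₗ[k] N) (i : ℕ) (w : KPrime 𝒜 i) :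
    liftP 𝒜 g (gen 𝒜 i w) = g i w := by
  simp [liftP, gen]

variable {𝒜} in
theorem hom_ext {f g : P 𝒜 →ₗ[Env k A] N} (h : ∀ i w, f (gen 𝒜 i w) = g (gen 𝒜 i w)) :
    f = g := by
  suffices H : f ∘ₗ (equivP 𝒜).toLinearMap = g ∘ₗ (equivP 𝒜).toLinearMap by
    refine LinearMap.ext fun x => ?_
    have := LinearMap.congr_fun H ((equivP 𝒜).symm x)
    simpa using this
  refine TensorProduct.AlgebraTensorModule.curry_injective (LinearMap.ext_ring ?_)
  refine DirectSum.linearMap_ext _ fun i => LinearMap.ext fun w => ?_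
  exact h i w

end Lift

/-- The shifted cohomological grading: `P_{1-i} = A ⊗ K'_i ⊗ A`. -/
noncomputable def grP (j : ℤ) : Submodule (Env k A) (P 𝒜) :=
  Submodule.span (Env k A) {x | ∃ (i : ℕ) (w : KPrime 𝒜 i), 1 - (i : ℤ) = j ∧ x = gen 𝒜 i w}

theorem gen_mem (i : ℕ) (w : KPrime 𝒜 i) : gen 𝒜 i w ∈ grP 𝒜 (1 - (i : ℤ)) :=
  Submodule.subset_span ⟨i, w, rfl, rfl⟩

/-- The projections of `P` onto its graded pieces. -/
noncomputable def decomposeP : P 𝒜 →ₗ[Env k A] ⨁ j : ℤ, grP 𝒜 j :=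
  liftP 𝒜 fun i =>
    { toFun := fun w => DirectSum.lof (Env k A) ℤ (fun j => grP 𝒜 j) (1 - (i : ℤ))
        ⟨gen 𝒜 i w, gen_mem 𝒜 i w⟩
      map_add' := fun w w' => by
        rw [← map_add]
        exact congrArg _ (Subtype.ext (map_add _ _ _))
      map_smul' := fun r w => by
        rw [RingHom.id_apply, ← LinearMap.map_smul_of_tower]
        exact congrArg _ (Subtype.ext (map_smul _ _ _)) }

theorem decomposeP_of_mem {j : ℤ} {x : P 𝒜} (hx : x ∈ grP 𝒜 j) :
    decomposeP 𝒜 x = DirectSum.lof (Env k A) ℤ (fun j => grP 𝒜 j) j ⟨x, hx⟩ := by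
  induction hx using Submodule.span_induction with
  | mem x h =>
    obtain ⟨i, w, rfl, rfl⟩ := h
    exact liftP_gen 𝒜 _ i w
  | zero => rw [map_zero]; exact (map_zero _).symm
  | add x y hx hy h1 h2 => rw [map_add, h1, h2, ← map_add]; rfl
  | smul e x hx h => rw [map_smul, h, ← map_smul]; rfl

noncomputable instance : DirectSum.Decomposition (grP 𝒜) :=
  DirectSum.Decomposition.ofLinearMap (grP 𝒜) (decomposeP 𝒜)
    (hom_ext fun i w => by
      rw [LinearMap.comp_apply, decomposeP_of_mem 𝒜 (gen_mem 𝒜 i w),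
        DirectSum.coeLinearMap_lof]
      rfl)
    (DirectSum.linearMap_ext _ fun j => LinearMap.ext fun x => by
      rw [LinearMap.comp_apply, LinearMap.comp_apply, DirectSum.coeLinearMap_lof]
      exact decomposeP_of_mem 𝒜 x.2)

/-- The image of `v ∈ K'_1 = V` in `A`. -/
noncomputable def val : KPrime 𝒜 1 →ₗ[k] A := (toA 𝒜).toLinearMap ∘ₗ (KPrime 𝒜 1).subtype

/-- `v ⊗ u ↦ v ⊗ u ⊗ 1`, for `v ∈ K'_1 = V` and `u ∈ K'_i`. -/
noncomputable def leftMul (i : ℕ) : KPrime 𝒜 1 ⊗[k] KPrime 𝒜 i →ₗ[k] P 𝒜 :=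
  TensorProduct.lift (LinearMap.mk₂ k (fun v u => (val 𝒜 v ⊗ₜ[k] (1 : Aᵐᵒᵖ) : Env k A) • gen 𝒜 i u)
    (fun v v' u => by rw [map_add, TensorProduct.add_tmul, add_smul])
    (fun r v u => by rw [map_smul, ← TensorProduct.smul_tmul', smul_assoc])
    (fun v u u' => by rw [map_add, smul_add])
    (fun r v u => by rw [map_smul, smul_comm]))

/-- `u ⊗ v ↦ 1 ⊗ u ⊗ v`, for `u ∈ K'_i` and `v ∈ K'_1 = V`. -/
noncomputable def rightMul (i : ℕ) : KPrime 𝒜 i ⊗[k] KPrime 𝒜 1 →ₗ[k] P 𝒜 :=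
  TensorProduct.lift (LinearMap.mk₂ k
    (fun u v => ((1 : A) ⊗ₜ[k] op (val 𝒜 v) : Env k A) • gen 𝒜 i u)
    (fun u u' v => by rw [map_add, smul_add])
    (fun r u v => by rw [map_smul, smul_comm])
    (fun u v v' => by rw [map_add, op_add, TensorProduct.tmul_add, add_smul])
    (fun r u v => by rw [map_smul, op_smul, TensorProduct.tmul_smul, smul_assoc]))

/-- The differential of the Koszul resolution,
`1 ⊗ v₁ ⋯ vᵢ ⊗ 1 ↦ v₁ ⊗ v₂ ⋯ vᵢ ⊗ 1 + (-1)^i 1 ⊗ v₁ ⋯ v_{i-1} ⊗ vᵢ`. -/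
noncomputable def d : P 𝒜 →ₗ[Env k A] P 𝒜 :=
  liftP 𝒜 fun
    | 0 => 0
    | i + 1 => leftMul 𝒜 i ∘ₗ decon 𝒜 (add_comm 1 i) +
        (-1 : k) ^ (i + 1) • (rightMul 𝒜 i ∘ₗ decon 𝒜 rfl)

/-- `w ⊗ w' ↦ (1 ⊗ w ⊗ 1) ⊗_A (1 ⊗ w' ⊗ 1) ∈ P ⊗_A P`. -/
noncomputable def genMul (i j : ℕ) : KPrime 𝒜 i ⊗[k] KPrime 𝒜 j →ₗ[k] T k A (P 𝒜) :=
  LinearMap.mul' k (T k A (P 𝒜)) ∘ₗ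
    TensorProduct.map ((T.ι k A (P 𝒜)).restrictScalars k ∘ₗ gen 𝒜 i)
      ((T.ι k A (P 𝒜)).restrictScalars k ∘ₗ gen 𝒜 j)

/-- `1 ⊗ v₁ ⋯ vₙ ⊗ 1 ↦ ∑ᵢ (-1)^i (1 ⊗ v₁ ⋯ vᵢ ⊗ 1) ⊗_A (1 ⊗ v_{i+1} ⋯ vₙ ⊗ 1)`. -/
noncomputable def diag : P 𝒜 →ₗ[Env k A] T k A (P 𝒜) :=
  liftP 𝒜 fun n => ∑ i : Fin (n + 1), (-1 : k) ^ (i : ℕ) •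
    (genMul 𝒜 i (n - i) ∘ₗ decon 𝒜 (Nat.add_sub_cancel' (Nat.le_of_lt_succ i.2)))

/-- The `A_∞`-coalgebra structure of `P`: `δ₁ = d`, `δ₂` is the signed deconcatenation and
`δₙ = 0` otherwise. -/
noncomputable def δ : ℕ → P 𝒜 →ₗ[Env k A] T k A (P 𝒜)
  | 1 => T.ι k A (P 𝒜) ∘ₗ d 𝒜
  | 2 => diag 𝒜
  | _ => 0

/-- The multiplication `π_p : V^{⊗ p} → A`. -/
noncomputable def π (p : ℕ) : (⨂[k]^p (𝒜 1)) →ₗ[k] A :=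
  PiTensorProduct.lift
    ((MultilinearMap.mkPiAlgebraFin k p A).compLinearMap fun _ => (𝒜 1).subtype)

theorem ι_mem (v : 𝒜 1) : TensorAlgebra.ι k v ∈ KPrime 𝒜 1 := by
  refine ⟨by simp [tpow], ?_⟩
  simp only [SetLike.mem_coe, Submodule.mem_iInf]
  intro j l h
  omega

/-- The embedding `τ : V → K_1 = A ⊗ V ⊗ A ⊆ P`, `v ↦ 1 ⊗ v ⊗ 1`. -/
noncomputable def τ : 𝒜 1 →ₗ[k] P 𝒜 :=
  gen 𝒜 1 ∘ₗ LinearMap.codRestrict (KPrime 𝒜 1) (TensorAlgebra.ι k) (ι_mem 𝒜)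

/-- The map `∑_{i₀+⋯+i_m=p-m} π_{i₀} ⊗ τ ⊗ π_{i₁} ⊗ τ ⊗ ⋯ ⊗ τ ⊗ π_{i_m}` from `V^{⊗ p}` to
`P^{⊗_A m}`: the summands correspond to the sets `S` of `m` positions at which `τ` is applied,
the other letters being multiplied in `A`. -/
noncomputable def split (p m : ℕ) : (⨂[k]^p (𝒜 1)) →ₗ[k] T k A (P 𝒜) :=
  ∑ S ∈ Finset.powersetCard m (Finset.univ : Finset (Fin p)),
    PiTensorProduct.lift ((MultilinearMap.mkPiAlgebraFin k p (T k A (P 𝒜))).compLinearMap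
      fun j => if j ∈ S then (T.ι k A (P 𝒜)).restrictScalars k ∘ₗ τ 𝒜
        else (T.inl k A (P 𝒜)).toLinearMap ∘ₗ (𝒜 1).subtype)

/-- The multiplication `T_k(V) = ⨁ₚ V^{⊗ p} → A`. -/
noncomputable def πSum : (⨁ p : ℕ, ⨂[k]^p (𝒜 1)) →ₗ[k] A :=
  DirectSum.toModule k ℕ A (π 𝒜)

/-- The sum over `p` of the maps `split 𝒜 p m`. -/
noncomputable def splitSum (m : ℕ) : (⨁ p : ℕ, ⨂[k]^p (𝒜 1)) →ₗ[k] T k A (P 𝒜) :=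
  DirectSum.toModule k ℕ (T k A (P 𝒜)) fun p => split 𝒜 p m

/-- A Hochschild `n`-cocycle on `P`: a bimodule map `P → A` supported on `P_{1-n}` whose composite
with the differential vanishes. -/
structure IsCocycle (n : ℕ) (α₀ : P 𝒜 →ₗ[Env k A] A) : Prop where
  support : ∀ j : ℤ, j ≠ 1 - (n : ℤ) → ∀ z ∈ grP 𝒜 j, α₀ z = 0
  comp_d : α₀ ∘ₗ d 𝒜 = 0

end KoszulAlgebra

end Koszul

open scoped TensorProduct DirectSum

set_option linter.unusedSectionVars false


/-! Work in the tensor algebra `T k A (P 𝒜)`. A bimodule map from `P` to it extends uniquely to a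
derivation over `A`, with Koszul signs. Let D₁ and D₂ extend δ₁ and δ₂. Then (a) says that D₁² = 0,
D₁D₂ + D₂D₁ = 0 and D₂² = 0, and (c) asks for a derivation, with prescribed leading values, whose
graded commutator with D₁ + D₂ vanishes. All of this may be tested on generators.

For (a), maps from the coalgebra ⨁ K'_i to the tensor algebra form an associative convolution
algebra. Let Γ be the family of generators, ν the letters sent to `A`, and a bar the sign (-1)^i.
Then D₁Γ = νΓ - Γ̄ν and D₂Γ = Γ̄Γ, while νν = 0 because products of relations vanish. The three
identities are short computations with these symbols.

The Koszul hypothesis enters through the bar complex T(A₊), graded by excess, that is, total degree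
minus length; its differential raises the excess by one. Dualising the vanishing of Ext off the
diagonal makes this complex exact in positive excess (`cobar_exact`). For (b), a single letter of
degree at least 2 is a cycle of positive excess, hence a boundary, so it is a sum of products of
elements of A₊ (`le_pow`).

The same exactness makes the Koszul complex a resolution (`exists_d_eq`). It sits inside the bar
resolution A ⊗ T(A₊) ⊗ A, which is contractible. A primitive found there can be corrected, from the
highest excess downwards, until it has excess 0. It is then a cycle of the reduced differential, and
such cycles of excess 0 are exactly ⨁ K'_i (`exists_sumKPrime`), so it lies in the Koszul complex.

For (c), use obstruction theory. Given α_N, the next component must satisfy D₁α_{N+1} - (-1)^{n-1}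
α_{N+1}d = `obstruction`, whose right-hand side is a cocycle by the Jacobi identity for derivations
(`obstruction_cocycle`). On K'_n the prescribed value solves this equation by a telescoping
computation (`dT_split_tprod`). On K'_{n+1}, K'_{n+2}, … one solves successively, since cycles of
P^{⊗_A N} of degree less than N are boundaries (`exists_primitive`). That holds because exactness
makes P → A a homotopy equivalence of complexes of right modules (`exists_homotopy`), which can be
applied to one tensor factor at a time. -/

namespace AInfinity

open scoped TensorProduct DirectSum
open MulOpposite

/-! ### Bigrading and derivations of the tensor algebra of a graded bimodule -/

section GradedTensorAlgebra

variable {k A C : Type*} [Field k] [Ring A] [Algebra k A] [AddCommGroup C] [Module k C]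
  [Module (Env k A) C] [IsScalarTower k (Env k A) C]

theorem inl_mul_ι (a : A) (c : C) :
    T.inl k A C a * T.ι k A C c = T.ι k A C ((a ⊗ₜ[k] 1 : Env k A) • c) := by
  rw [map_smul, T.env_smul]; simp

theorem ι_mul_inl (c : C) (b : A) :
    T.ι k A C c * T.inl k A C b = T.ι k A C ((1 ⊗ₜ[k] op b : Env k A) • c) := by
  rw [map_smul, T.env_smul]; simp

variable (𝒞 : ℤ → Submodule (Env k A) C)

theorem inl_mem_tensorPow (a : A) : T.inl k A C a ∈ tensorPow 𝒞 0 0 := by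
  rw [tensorPow, if_pos rfl]; exact ⟨a, rfl⟩

variable {𝒞}

theorem mul_ι_mem_tensorPow {n : ℕ} {m i : ℤ} {x : T k A C} {c : C}
    (hx : x ∈ tensorPow 𝒞 n m) (hc : c ∈ 𝒞 i) :
    x * T.ι k A C c ∈ tensorPow 𝒞 (n + 1) (m + i) := by
  rw [tensorPow]
  refine Submodule.mem_iSup_of_mem i (Submodule.mul_mem_mul ?_ ⟨c, hc, rfl⟩)
  rwa [add_sub_cancel_right]

theorem ι_mem_tensorPow {i : ℤ} {c : C} (hc : c ∈ 𝒞 i) : T.ι k A C c ∈ tensorPow 𝒞 1 i := by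
  have := mul_ι_mem_tensorPow (inl_mem_tensorPow 𝒞 (1 : A)) hc
  simpa using this

/-- Induction on elements of `C^{⊗_A (n+1)}`. -/
theorem tensorPow_succ_induction {n : ℕ} {m : ℤ} {p : T k A C → Prop} (h0 : p 0)
    (hadd : ∀ x y, p x → p y → p (x + y))
    (h : ∀ i x c, x ∈ tensorPow 𝒞 n (m - i) → c ∈ 𝒞 i → p (x * T.ι k A C c))
    {x : T k A C} (hx : x ∈ tensorPow 𝒞 (n + 1) m) : p x := by
  rw [tensorPow] at hx
  induction hx using Submodule.iSup_induction' with
  | zero => exact h0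
  | add x y _ _ hx hy => exact hadd _ _ hx hy
  | mem i x hx =>
    induction hx using Submodule.mul_induction_on' with
    | mem_mul_mem x hx y hy =>
      obtain ⟨c, hc, rfl⟩ := hy
      exact h i x c hx hc
    | add x _ y _ hx hy => exact hadd _ _ hx hy

theorem mul_inl_mem_tensorPow {n : ℕ} {m : ℤ} {x : T k A C} (hx : x ∈ tensorPow 𝒞 n m) (b : A) :
    x * T.inl k A C b ∈ tensorPow 𝒞 n m := by
  cases n with
  | zero =>
    rw [tensorPow] at hx ⊢
    split_ifs at hx ⊢ with h
    · obtain ⟨a, rfl⟩ := hx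
      exact ⟨a * b, by simp⟩
    · rw [Submodule.mem_bot] at hx
      simp [hx]
  | succ n =>
    refine tensorPow_succ_induction (𝒞 := 𝒞) (p := fun x => x * T.inl k A C b ∈ _) (by simp)
      (fun x y hx hy => by rw [add_mul]; exact add_mem hx hy) (fun i x c hx hc => ?_) hx
    rw [mul_assoc, ι_mul_inl]
    have := mul_ι_mem_tensorPow hx ((𝒞 i).smul_mem (1 ⊗ₜ[k] op b : Env k A) hc)
    rwa [sub_add_cancel] at this

theorem mul_mem_tensorPow {n : ℕ} {m : ℤ} {x : T k A C} (hx : x ∈ tensorPow 𝒞 n m) {n' : ℕ} :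
    ∀ {m' : ℤ} {y : T k A C}, y ∈ tensorPow 𝒞 n' m' → x * y ∈ tensorPow 𝒞 (n + n') (m + m') := by
  induction n' with
  | zero =>
    intro m' y hy
    rw [tensorPow] at hy
    split_ifs at hy with h
    · obtain ⟨b, rfl⟩ := hy
      rw [h, add_zero, add_zero]
      exact mul_inl_mem_tensorPow hx b
    · rw [Submodule.mem_bot] at hy
      simp [hy]
  | succ n' ih =>
    intro m' y hy
    refine tensorPow_succ_induction (𝒞 := 𝒞) (p := fun y => x * y ∈ _) (by simp)
      (fun y z hy hz => by rw [mul_add]; exact add_mem hy hz) (fun i y c hy hc => ?_) hy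
    have := mul_ι_mem_tensorPow (ih hy) hc
    rwa [mul_assoc, add_assoc m, sub_add_cancel] at this

theorem mul_mem_tensorPow' {n n' N : ℕ} {m m' M : ℤ} {x y : T k A C} (hx : x ∈ tensorPow 𝒞 n m)
    (hy : y ∈ tensorPow 𝒞 n' m') (hN : n + n' = N) (hM : m + m' = M) :
    x * y ∈ tensorPow 𝒞 N M :=
  hN ▸ hM ▸ mul_mem_tensorPow hx hy

theorem smul_mem_tensorPow {n : ℕ} {m : ℤ} {x : T k A C} (hx : x ∈ tensorPow 𝒞 n m)
    (e : Env k A) : e • x ∈ tensorPow 𝒞 n m := by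
  induction e using TensorProduct.induction_on with
  | zero =>
    have h0 : (0 : Env k A) • x = 0 := zero_smul (Env k A) x
    rw [h0]
    exact zero_mem _
  | add e e' h h' => rw [add_smul]; exact add_mem h h'
  | tmul a b =>
    rw [T.env_smul]
    exact mul_inl_mem_tensorPow
      (mul_mem_tensorPow' (inl_mem_tensorPow 𝒞 a) hx (zero_add n) (zero_add m)) _

/-- Elements of `C^{⊗_A (n+1)}` are sums of products `c * x` with `c ∈ C`, `x ∈ C^{⊗_A n}`. -/
theorem tensorPow_succ_induction_left {n : ℕ} : ∀ {m : ℤ} {p : T k A C → Prop}, p 0 →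
    (∀ x y, p x → p y → p (x + y)) →
    (∀ i x c, x ∈ tensorPow 𝒞 n (m - i) → c ∈ 𝒞 i → p (T.ι k A C c * x)) →
    ∀ {x : T k A C}, x ∈ tensorPow 𝒞 (n + 1) m → p x := by
  induction n with
  | zero =>
    intro m p h0 hadd h x hx
    refine tensorPow_succ_induction h0 hadd (fun i x c hx hc => ?_) hx
    rw [tensorPow] at hx
    split_ifs at hx with hm
    · obtain ⟨a, rfl⟩ := hx
      have := h i 1 ((a ⊗ₜ[k] 1 : Env k A) • c)
        (by rw [hm, ← map_one (T.inl k A C)]; exact inl_mem_tensorPow 𝒞 (1 : A))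
        ((𝒞 i).smul_mem _ hc)
      rwa [mul_one, ← inl_mul_ι] at this
    · rw [Submodule.mem_bot] at hx
      simpa [hx] using h0
  | succ n ih =>
    intro m p h0 hadd h x hx
    refine tensorPow_succ_induction h0 hadd (fun i x c hx hc => ?_) hx
    refine ih (p := fun x => p (x * T.ι k A C c)) (by simpa using h0)
      (fun x y hx hy => by rw [add_mul]; exact hadd _ _ hx hy) (fun j y c' hy hc' => ?_) hx
    rw [mul_assoc]
    refine h j _ c' ?_ hc'
    have := mul_ι_mem_tensorPow hy hc
    rwa [show m - i - j + i = m - j by ring] at this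

variable [DirectSum.Decomposition 𝒞]

theorem ι_mem_iSup_tensorPow (c : C) :
    T.ι k A C c ∈ ⨆ (n : ℕ) (m : ℤ), tensorPow 𝒞 n m := by
  classical
  rw [← DirectSum.sum_support_decompose 𝒞 c, map_sum]
  exact Submodule.sum_mem _ fun i _ => Submodule.mem_iSup_of_mem 1
    (Submodule.mem_iSup_of_mem i (ι_mem_tensorPow (Subtype.property _)))

variable (𝒞) in
-- The sum contains `A` and `C` and is closed under products. Hence linear identities, above all
-- those involving signs, need only be checked on homogeneous elements.
theorem iSup_tensorPow : ⨆ (n : ℕ) (m : ℤ), tensorPow 𝒞 n m = ⊤ := by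
  refine eq_top_iff.2 fun x _ => ?_
  induction x using T.induction with
  | h_inl a =>
    have := Submodule.mem_iSup_of_mem (p := fun m => tensorPow 𝒞 0 m) 0 (inl_mem_tensorPow 𝒞 a)
    exact Submodule.mem_iSup_of_mem (p := fun n => ⨆ m : ℤ, tensorPow 𝒞 n m) 0 this
  | h_ι c => exact ι_mem_iSup_tensorPow c
  | h_add x y hx hy => exact add_mem (hx trivial) (hy trivial)
  | h_mul x y hx hy =>
    refine (Submodule.mul_le.2 ?_ : _ * _ ≤ ⨆ (n : ℕ) (m : ℤ), tensorPow 𝒞 n m)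
      (Submodule.mul_mem_mul (hx trivial) (hy trivial))
    intro x hx y hy
    refine Submodule.iSup_induction _ (motive := fun x => x * y ∈ _) hx (fun n x hx => ?_)
      (by simp) (fun x x' h h' => by rw [add_mul]; exact add_mem h h')
    refine Submodule.iSup_induction _ (motive := fun x => x * y ∈ _) hx (fun m x hx => ?_)
      (by simp) (fun x x' h h' => by rw [add_mul]; exact add_mem h h')
    refine Submodule.iSup_induction _ (motive := fun y => x * y ∈ _) hy (fun n' y hy => ?_)
      (by simp) (fun x x' h h' => by rw [mul_add]; exact add_mem h h')
    refine Submodule.iSup_induction _ (motive := fun y => x * y ∈ _) hy (fun m' y hy => ?_)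
      (by simp) (fun x x' h h' => by rw [mul_add]; exact add_mem h h')
    exact Submodule.mem_iSup_of_mem (n + n')
      (Submodule.mem_iSup_of_mem (m + m') (mul_mem_tensorPow hx hy))

variable (𝒞) in
theorem linearMap_ext_tensorPow {M : Type*} [AddCommGroup M] [Module k M] {f g : T k A C →ₗ[k] M}
    (h : ∀ n m, ∀ x ∈ tensorPow 𝒞 n m, f x = g x) : f = g := by
  refine LinearMap.ext fun x => ?_
  have hx : x ∈ ⨆ (n : ℕ) (m : ℤ), tensorPow 𝒞 n m := by rw [iSup_tensorPow 𝒞]; trivial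
  have : ⨆ (n : ℕ) (m : ℤ), tensorPow 𝒞 n m ≤ LinearMap.eqLocus f g :=
    iSup_le fun n => iSup_le fun m => fun x hx => h n m x hx
  exact this hx

variable (𝒞) in
/-- The algebra automorphism `x ↦ (-1)^{l |x|} x` of `T(C)`. -/
noncomputable def sgn (l : ℤ) : T k A C →ₐ[k] T k A C :=
  T.lift (T.inl k A C) ((T.ι k A C ∘ₗ koszulSign 𝒞 l).restrictScalars k)
    (fun a c => by simp [T.env_smul]) (fun c b => by simp [T.env_smul])

theorem sgn_inl (l : ℤ) (a : A) : sgn 𝒞 l (T.inl k A C a) = T.inl k A C a := by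
  simp [sgn]

/-- The diagonal entry is an algebra map agreeing with the sign automorphism on generators. Knowing
this on all of T(C) gives a Leibniz rule without homogeneity hypotheses, so that inductions may run
over arbitrary products. -/
theorem derivationMatrix_zero_zero (l : ℤ) (f : C →ₗ[Env k A] T k A C) (x : T k A C) :
    derivationMatrix 𝒞 l f x 0 0 = sgn 𝒞 l x := by
  induction x using T.induction with
  | h_inl a => simp [derivationMatrix, sgn]
  | h_ι c => simp [derivationMatrix, sgn]
  | h_add x y hx hy => simp [hx, hy]
  | h_mul x y hx hy =>
    simp [Matrix.mul_apply, Fin.sum_univ_two, hx, hy, (derivationMatrix_one 𝒞 l f y).1]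

theorem sgn_of_mem (l : ℤ) {n : ℕ} {m : ℤ} {x : T k A C} (hx : x ∈ tensorPow 𝒞 n m) :
    sgn 𝒞 l x = ((l * m).negOnePow : ℤ) • x := by
  rw [← derivationMatrix_zero_zero l 0, derivationMatrix_of_mem 𝒞 l 0 n m x hx]

theorem sgn_ι_of_mem (l : ℤ) {i : ℤ} {c : C} (hc : c ∈ 𝒞 i) :
    sgn 𝒞 l (T.ι k A C c) = ((l * i).negOnePow : ℤ) • T.ι k A C c :=
  sgn_of_mem l (ι_mem_tensorPow hc)

theorem sgn_sgn (l m : ℤ) (x : T k A C) : sgn 𝒞 l (sgn 𝒞 m x) = sgn 𝒞 (l + m) x := by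
  have : (sgn 𝒞 l).toLinearMap ∘ₗ (sgn 𝒞 m).toLinearMap = (sgn 𝒞 (l + m)).toLinearMap := by
    refine linearMap_ext_tensorPow 𝒞 fun n i x hx => ?_
    simp only [LinearMap.comp_apply, AlgHom.toLinearMap_apply, sgn_of_mem m hx, map_zsmul,
      sgn_of_mem l hx, sgn_of_mem (l + m) hx, smul_smul, add_mul, Int.negOnePow_add, Units.val_mul]
    rw [mul_comm]
  exact LinearMap.congr_fun this x

/-- A derivation of degree `l` of `T(C)` over `A`. -/
structure IsDerivation (𝒞 : ℤ → Submodule (Env k A) C) [DirectSum.Decomposition 𝒞]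
    (l : ℤ) (D : T k A C →ₗ[k] T k A C) : Prop where
  inl : ∀ a, D (T.inl k A C a) = 0
  mul : ∀ x y, D (x * y) = D x * y + sgn 𝒞 l x * D y

theorem isDerivation_derivation (l : ℤ) (f : C →ₗ[Env k A] T k A C) :
    IsDerivation 𝒞 l (derivation 𝒞 l f) where
  inl := derivation_inl 𝒞 l f
  mul x y := by
    change derivationMatrix 𝒞 l f (x * y) 0 1 = derivationMatrix 𝒞 l f x 0 1 * y
      + _ * derivationMatrix 𝒞 l f y 0 1
    rw [map_mul, Matrix.mul_apply, Fin.sum_univ_two, derivationMatrix_zero_zero,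
      (derivationMatrix_one 𝒞 l f y).2, add_comm]

theorem IsDerivation.ext {l : ℤ} {D D' : T k A C →ₗ[k] T k A C} (hD : IsDerivation 𝒞 l D)
    (hD' : IsDerivation 𝒞 l D') (h : ∀ c, D (T.ι k A C c) = D' (T.ι k A C c)) : D = D' := by
  refine LinearMap.ext fun x => ?_
  induction x using T.induction with
  | h_inl a => rw [hD.inl, hD'.inl]
  | h_ι c => exact h c
  | h_add x y hx hy => rw [map_add, map_add, hx, hy]
  | h_mul x y hx hy => rw [hD.mul, hD'.mul, hx, hy]

/-- The graded commutator of two derivations is a derivation. -/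
theorem IsDerivation.commutator {l l' : ℤ} {D D' : T k A C →ₗ[k] T k A C}
    (hD : IsDerivation 𝒞 l D) (hD' : IsDerivation 𝒞 l' D')
    (hs : ∀ x, D' (sgn 𝒞 l x) = ((l * l').negOnePow : ℤ) • sgn 𝒞 l (D' x))
    (hs' : ∀ x, D (sgn 𝒞 l' x) = ((l * l').negOnePow : ℤ) • sgn 𝒞 l' (D x)) :
    IsDerivation 𝒞 (l + l') (D ∘ₗ D' - ((l * l').negOnePow : ℤ) • (D' ∘ₗ D)) where
  inl a := by simp [hD.inl, hD'.inl]
  mul x y := by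
    simp only [LinearMap.sub_apply, LinearMap.comp_apply, LinearMap.smul_apply, hD.mul, hD'.mul,
      map_add, hs, hs', sgn_sgn, add_comm l' l, smul_add, smul_mul_assoc, sub_mul, mul_sub,
      mul_smul_comm]
    have h1 : ∀ z : T k A C, ((l * l').negOnePow : ℤ) • ((l * l').negOnePow : ℤ) • z = z := by
      intro z
      rw [smul_smul, ← Units.val_mul, ← Int.negOnePow_add, Int.negOnePow_even _ ⟨_, rfl⟩]
      simp
    rw [h1]
    abel

/-- A `k`-linear operator on `T(C)` is homogeneous of degree `l`. -/
def IsHomogeneous (𝒞 : ℤ → Submodule (Env k A) C) (l : ℤ) (D : T k A C →ₗ[k] T k A C) : Prop :=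
  ∀ n m, ∀ x ∈ tensorPow 𝒞 n m, ∃ n', D x ∈ tensorPow 𝒞 n' (m + l)

theorem IsHomogeneous.sgn_comm {l : ℤ} {D : T k A C →ₗ[k] T k A C} (hD : IsHomogeneous 𝒞 l D)
    (m : ℤ) (x : T k A C) : D (sgn 𝒞 m x) = ((m * l).negOnePow : ℤ) • sgn 𝒞 m (D x) := by
  have : D ∘ₗ (sgn 𝒞 m).toLinearMap = ((m * l).negOnePow : ℤ) • ((sgn 𝒞 m).toLinearMap ∘ₗ D) := by
    refine linearMap_ext_tensorPow 𝒞 fun n i x hx => ?_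
    obtain ⟨n', h⟩ := hD n i x hx
    simp only [LinearMap.comp_apply, AlgHom.toLinearMap_apply, sgn_of_mem m hx, map_zsmul,
      LinearMap.smul_apply, sgn_of_mem m h, smul_smul]
    rw [mul_add, Int.negOnePow_add, ← Units.val_mul, mul_comm (Int.negOnePow _), mul_assoc,
      ← Int.negOnePow_add (m * l), Int.negOnePow_even _ ⟨_, rfl⟩, mul_one]
  exact LinearMap.congr_fun this x

/-- One of the n + 1 factors is traded for r factors, which leaves n + r. With no factor at all the
derivation vanishes, and this case has to be excluded from the count. -/
theorem derivation_mem_tensorPow {l : ℤ} {r : ℕ} {f : C →ₗ[Env k A] T k A C}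
    (hf : ∀ i, ∀ c ∈ 𝒞 i, f c ∈ tensorPow 𝒞 r (i + l)) {n : ℕ} :
    ∀ {m : ℤ} {x : T k A C}, x ∈ tensorPow 𝒞 (n + 1) m →
      derivation 𝒞 l f x ∈ tensorPow 𝒞 (n + r) (m + l) := by
  induction n with
  | zero =>
    intro m x hx
    refine tensorPow_succ_induction (𝒞 := 𝒞) (p := fun x => derivation 𝒞 l f x ∈ _) (by simp)
      (fun x y hx hy => by rw [map_add]; exact add_mem hx hy) (fun i x c hx hc => ?_) hx
    rw [tensorPow] at hx
    split_ifs at hx with h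
    · obtain ⟨a, rfl⟩ := hx
      rw [AlgHom.toLinearMap_apply, inl_mul_ι, derivation_ι, map_smul]
      have := smul_mem_tensorPow (hf i c hc) (a ⊗ₜ[k] 1)
      rwa [zero_add, show m = i by omega]
    · rw [Submodule.mem_bot] at hx
      simp [hx]
  | succ n ih =>
    intro m x hx
    refine tensorPow_succ_induction (𝒞 := 𝒞) (p := fun x => derivation 𝒞 l f x ∈ _) (by simp)
      (fun x y hx hy => by rw [map_add]; exact add_mem hx hy) (fun i x c hx hc => ?_) hx
    rw [derivation_mul 𝒞 l f hx, derivation_ι]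
    refine add_mem (mul_mem_tensorPow' (ih hx) (ι_mem_tensorPow hc) (by ring) (by ring)) ?_
    exact zsmul_mem (mul_mem_tensorPow' hx (hf i c hc) rfl (by ring)) _

theorem isHomogeneous_derivation {l : ℤ} {r : ℕ} {f : C →ₗ[Env k A] T k A C}
    (hf : ∀ i, ∀ c ∈ 𝒞 i, f c ∈ tensorPow 𝒞 r (i + l)) :
    IsHomogeneous 𝒞 l (derivation 𝒞 l f) := by
  intro n m x hx
  cases n with
  | zero =>
    refine ⟨0, ?_⟩
    rw [tensorPow] at hx
    split_ifs at hx with h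
    · obtain ⟨a, rfl⟩ := hx
      rw [AlgHom.toLinearMap_apply, derivation_inl]
      exact zero_mem _
    · rw [Submodule.mem_bot] at hx
      rw [hx, map_zero]
      exact zero_mem _
  | succ n => exact ⟨_, derivation_mem_tensorPow hf hx⟩

/-- The commutator of derivations with values `f`, `g` on generators. -/
theorem derivation_commutator {l l' : ℤ} {r r' : ℕ} {f g : C →ₗ[Env k A] T k A C}
    (hf : ∀ i, ∀ c ∈ 𝒞 i, f c ∈ tensorPow 𝒞 r (i + l))
    (hg : ∀ i, ∀ c ∈ 𝒞 i, g c ∈ tensorPow 𝒞 r' (i + l')) (h : C →ₗ[Env k A] T k A C)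
    (hh : ∀ c, derivation 𝒞 l f (g c) - ((l * l').negOnePow : ℤ) • derivation 𝒞 l' g (f c) = h c)
    (x : T k A C) :
    derivation 𝒞 l f (derivation 𝒞 l' g x)
        - ((l * l').negOnePow : ℤ) • derivation 𝒞 l' g (derivation 𝒞 l f x)
      = derivation 𝒞 (l + l') h x := by
  have hc := (isDerivation_derivation (𝒞 := 𝒞) l f).commutator (isDerivation_derivation l' g)
    ((isHomogeneous_derivation hg).sgn_comm l)
    (fun x => by rw [(isHomogeneous_derivation hf).sgn_comm l', mul_comm])
  refine LinearMap.congr_fun (hc.ext (isDerivation_derivation (l + l') h) fun c => ?_) x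
  simp only [LinearMap.sub_apply, LinearMap.comp_apply, LinearMap.smul_apply, derivation_ι, hh]

end GradedTensorAlgebra

/-! ### Operators acting on the first tensor factor only -/

section Contraction

variable {k A C : Type*} [Field k] [Ring A] [Algebra k A] [AddCommGroup C] [Module k C]
  [Module (Env k A) C] [IsScalarTower k (Env k A) C]

/-- The action of `T(C)` on `T(C) × Hom(A, T(C))` with
`c • (x, φ) = (c x, a ↦ h (a c) x)` for `c ∈ C`. -/
noncomputable def contractionAction (h : C →ₗ[k] T k A C)
    (hh : ∀ c b, h ((1 ⊗ₜ[k] op b : Env k A) • c) = h c * T.inl k A C b) :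
    T k A C →ₐ[k] Module.End k (T k A C × (A →ₗ[k] T k A C)) :=
  T.lift
    (AlgHom.ofLinearMap
      -- Since `h` is not assumed left linear, scalars standing on the left must be remembered until
      -- a generator arrives. The second component is a function of such a scalar, on which b acts
      -- by (bφ)(a) = φ(ab).
      { toFun := fun b => LinearMap.prodMap (LinearMap.mulLeft k (T.inl k A C b))
          (LinearMap.lcomp k _ (LinearMap.mulRight k b))
        map_add' := fun b b' => by
          refine LinearMap.ext fun x => Prod.ext ?_ (LinearMap.ext fun a => ?_)
          · simp [add_mul]
          · simp [mul_add]
        map_smul' := fun r b => by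
          refine LinearMap.ext fun x => Prod.ext ?_ (LinearMap.ext fun a => ?_)
          · simp
          · simp }
      (by
        refine LinearMap.ext fun x => Prod.ext ?_ (LinearMap.ext fun a => ?_)
        · simp
        · simp)
      (fun b b' => by
        refine LinearMap.ext fun x => Prod.ext ?_ (LinearMap.ext fun a => ?_)
        · simp
        · simp [mul_assoc]))
    { toFun := fun c => LinearMap.prod (LinearMap.mulLeft k (T.ι k A C c))
          (LinearMap.flip
            { toFun := fun a => LinearMap.mulLeft k (h ((a ⊗ₜ[k] 1 : Env k A) • c))
              map_add' := fun a a' => by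
                refine LinearMap.ext fun x => ?_
                simp [TensorProduct.add_tmul, add_smul, add_mul]
              map_smul' := fun r a => by
                refine LinearMap.ext fun x => ?_
                simp [← TensorProduct.smul_tmul'] }) ∘ₗ LinearMap.fst k _ _
      map_add' := fun c c' => by
        refine LinearMap.ext fun x => Prod.ext ?_ (LinearMap.ext fun a => ?_)
        · simp [add_mul]
        · simp [add_mul]
      map_smul' := fun r c => by
        have hs : T.ι k A C (r • c) = r • T.ι k A C c :=
          ((T.ι k A C).restrictScalars k).map_smul r c
        refine LinearMap.ext fun x => Prod.ext ?_ (LinearMap.ext fun a => ?_)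
        · simp [hs]
        · simp [smul_comm _ r c] }
    (fun b c => by
      refine LinearMap.ext fun x => Prod.ext ?_ (LinearMap.ext fun a => ?_)
      · simp [← mul_assoc, T.env_smul]
      · simp [smul_smul])
    (fun c b => by
      refine LinearMap.ext fun x => Prod.ext ?_ (LinearMap.ext fun a => ?_)
      · simp [← mul_assoc, T.env_smul]
      -- Right linearity of `h` is what makes the action compatible with the relation between (cb)x
      -- and c(bx).
      · have := hh ((a ⊗ₜ[k] 1 : Env k A) • c) b
        rw [smul_smul] at this
        simp [smul_smul, ← mul_assoc, ← this])

/-- The operator `c x ↦ h(c) x` on `T(C)`, for `h` a map of right `A`-modules. -/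
noncomputable def contraction (h : C →ₗ[k] T k A C)
    (hh : ∀ c b, h ((1 ⊗ₜ[k] op b : Env k A) • c) = h c * T.inl k A C b) :
    T k A C →ₗ[k] T k A C where
  toFun x := (contractionAction h hh x (1, 0)).2 1
  map_add' x y := by simp
  map_smul' r x := by simp

variable (h : C →ₗ[k] T k A C)
  (hh : ∀ c b, h ((1 ⊗ₜ[k] op b : Env k A) • c) = h c * T.inl k A C b)

theorem contractionAction_fst (x : T k A C) :
    ∀ y, (contractionAction h hh x y).1 = x * y.1 := by
  induction x using T.induction with
  | h_inl a => simp [contractionAction]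
  | h_ι c => simp [contractionAction]
  | h_add x y hx hy => simp [hx, hy, add_mul]
  | h_mul x y hx hy => simp [hx, hy, mul_assoc]

theorem contraction_ι_mul (c : C) (x : T k A C) :
    contraction h hh (T.ι k A C c * x) = h c * x := by
  have : ∀ y, (contractionAction h hh (T.ι k A C c) y).2 1 = h c * y.1 := fun y => by
    simp [contractionAction, ← Algebra.TensorProduct.one_def]
  simp only [contraction, LinearMap.coe_mk, AddHom.coe_mk, map_mul, Module.End.mul_apply, this,
    contractionAction_fst, mul_one]

end Contraction
end AInfinity


namespace AInfinity

open scoped TensorProduct DirectSum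
open MulOpposite

/-! ### Squares and anticommutators of odd derivations -/

section OddDerivations

variable {k A C : Type*} [Field k] [Ring A] [Algebra k A] [AddCommGroup C] [Module k C]
  [Module (Env k A) C] [IsScalarTower k (Env k A) C]
  {𝒞 : ℤ → Submodule (Env k A) C} [DirectSum.Decomposition 𝒞]

/-- An odd derivation squares to zero as soon as it does so on generators. -/
theorem derivation_one_sq {r : ℕ} {f : C →ₗ[Env k A] T k A C}
    (hf : ∀ i, ∀ c ∈ 𝒞 i, f c ∈ tensorPow 𝒞 r (i + 1))
    (h : ∀ c, derivation 𝒞 1 f (f c) = 0) (x : T k A C) :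
    derivation 𝒞 1 f (derivation 𝒞 1 f x) = 0 := by
  have hD := isDerivation_derivation (𝒞 := 𝒞) 1 f
  have hs := (isHomogeneous_derivation hf).sgn_comm 1
  induction x using T.induction with
  | h_inl a => rw [hD.inl, map_zero]
  | h_ι c => rw [derivation_ι, h]
  | h_add x y hx hy => rw [map_add, map_add, hx, hy, add_zero]
  -- The cross terms sgn(Dx)·Dy and D(sgn x)·Dy cancel. The graded commutator of D with itself is
  -- 2D², which would give nothing in characteristic 2.
  | h_mul x y hx hy => simp [hD.mul, hs, hx, hy]

/-- Two odd derivations anticommute as soon as they do so on generators. -/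
theorem derivation_one_anticomm {r r' : ℕ} {f g : C →ₗ[Env k A] T k A C}
    (hf : ∀ i, ∀ c ∈ 𝒞 i, f c ∈ tensorPow 𝒞 r (i + 1))
    (hg : ∀ i, ∀ c ∈ 𝒞 i, g c ∈ tensorPow 𝒞 r' (i + 1))
    (h : ∀ c, derivation 𝒞 1 f (g c) + derivation 𝒞 1 g (f c) = 0) (x : T k A C) :
    derivation 𝒞 1 f (derivation 𝒞 1 g x) + derivation 𝒞 1 g (derivation 𝒞 1 f x) = 0 := by
  have hs := (isHomogeneous_derivation hf).sgn_comm 1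
  have hs' := (isHomogeneous_derivation hg).sgn_comm 1
  have hf := isDerivation_derivation (𝒞 := 𝒞) 1 f
  have hg := isDerivation_derivation (𝒞 := 𝒞) 1 g
  induction x using T.induction with
  | h_inl a => simp [hf.inl, hg.inl]
  | h_ι c => simp only [derivation_ι, h]
  | h_add x y hx hy =>
    simp only [map_add]
    rw [add_add_add_comm, hx, hy, add_zero]
  | h_mul x y hx hy =>
    have hx' := eq_neg_of_add_eq_zero_left hx
    have hy' := eq_neg_of_add_eq_zero_left hy
    simp only [hf.mul, hg.mul, hs, hs', hx', hy', map_add, mul_one, Int.negOnePow_one,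
      Units.val_neg, Units.val_one, neg_smul, one_smul, neg_mul, mul_neg]
    abel

end OddDerivations

end AInfinity

namespace Koszul

open scoped TensorProduct DirectSum
open MulOpposite AInfinity

/-! ### Deconcatenation on the Koszul coalgebra and the convolution algebra -/

section Convolution

variable {k A : Type*} [Field k] [Ring A] [Algebra k A] (𝒜 : ℕ → Submodule k A)

/-- Multiplication K'_i ⊗ K'_j → T(V) is injective, so a coproduct is recognised by its product. -/
theorem decon_eq {i j n : ℕ} (h : i + j = n) {w : KPrime 𝒜 n} {z : KPrime 𝒜 i ⊗[k] KPrime 𝒜 j}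
    (hz : Submodule.mulMap (KPrime 𝒜 i) (KPrime 𝒜 j) z = w) : decon 𝒜 h w = z :=
  (KPrime_linearDisjoint 𝒜 i j).injective ((mulMap_decon 𝒜 h w).trans hz.symm)

theorem KPrime_le_tpow (i : ℕ) : KPrime 𝒜 i ≤ tpow k (𝒜 1) i := inf_le_left

/-- The triple product `K'_a ⊗ K'_b ⊗ K'_c → T(V)`. -/
noncomputable def mulMap₃ (a b c : ℕ) :
    KPrime 𝒜 a ⊗[k] (KPrime 𝒜 b ⊗[k] KPrime 𝒜 c) →ₗ[k] TensorAlgebra k (𝒜 1) :=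
  Submodule.mulMap (KPrime 𝒜 a) (KPrime 𝒜 b * KPrime 𝒜 c) ∘ₗ
    (Submodule.mulMap' (KPrime 𝒜 b) (KPrime 𝒜 c)).lTensor (KPrime 𝒜 a)

theorem mulMap₃_injective (a b c : ℕ) : Function.Injective (mulMap₃ 𝒜 a b c) := by
  have h1 : (KPrime 𝒜 a).LinearDisjoint (KPrime 𝒜 b * KPrime 𝒜 c) :=
    Submodule.LinearDisjoint.of_le_of_flat_right (tpow_linearDisjoint k (𝒜 1) a (b + c))
      (KPrime_le_tpow 𝒜 a) (by
        rw [tpow, pow_add]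
        exact mul_le_mul' (KPrime_le_tpow 𝒜 b) (KPrime_le_tpow 𝒜 c))
  have h2 : Function.Injective (Submodule.mulMap' (KPrime 𝒜 b) (KPrime 𝒜 c)) := fun x y h =>
    (KPrime_linearDisjoint 𝒜 b c).injective (congrArg Subtype.val h)
  exact h1.injective.comp (Module.Flat.lTensor_preserves_injective_linearMap _ h2)

/-- Both sides multiply out to w in T(V), and the triple product is injective. -/
theorem decon_coassoc {a b c m m' n : ℕ} (h1 : a + b = m) (h2 : m + c = n) (h3 : b + c = m')
    (h4 : a + m' = n) (w : KPrime 𝒜 n) :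
    TensorProduct.assoc k _ _ _ ((decon 𝒜 h1).rTensor (KPrime 𝒜 c) (decon 𝒜 h2 w))
      = (decon 𝒜 h3).lTensor (KPrime 𝒜 a) (decon 𝒜 h4 w) := by
  apply mulMap₃_injective 𝒜 a b c
  have e1 : mulMap₃ 𝒜 a b c ∘ₗ (TensorProduct.assoc k _ _ _).toLinearMap ∘ₗ
      (decon 𝒜 h1).rTensor (KPrime 𝒜 c) = Submodule.mulMap _ _ := by
    refine TensorProduct.ext' fun u v => ?_
    have : ∀ y : KPrime 𝒜 a ⊗[k] KPrime 𝒜 b,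
        mulMap₃ 𝒜 a b c (TensorProduct.assoc k _ _ _ (y ⊗ₜ v))
          = Submodule.mulMap _ _ y * (v : TensorAlgebra k (𝒜 1)) := fun y => by
      induction y with
      | zero => simp
      | add y y' h h' => simp only [TensorProduct.add_tmul, map_add, h, h', add_mul]
      | tmul x y => simp [mulMap₃, mul_assoc]
    simp [this, mulMap_decon]
  have e2 : mulMap₃ 𝒜 a b c ∘ₗ (decon 𝒜 h3).lTensor (KPrime 𝒜 a) = Submodule.mulMap _ _ := by
    refine TensorProduct.ext' fun u v => ?_
    have : ((Submodule.mulMap' (KPrime 𝒜 b) (KPrime 𝒜 c) (decon 𝒜 h3 v) : _) :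
        TensorAlgebra k (𝒜 1)) = v := mulMap_decon 𝒜 h3 v
    simp [mulMap₃, this]
  have k1 := (LinearMap.congr_fun e1 (decon 𝒜 h2 w)).trans (mulMap_decon 𝒜 h2 w)
  have k2 := (LinearMap.congr_fun e2 (decon 𝒜 h4 w)).trans (mulMap_decon 𝒜 h4 w)
  exact k1.trans k2.symm

variable {𝒜}
variable {B : Type*} [Ring B] [Algebra k B]

/-- The composite `K'_n → K'_i ⊗ K'_j → B ⊗ B → B`, zero if `i + j ≠ n`. -/
noncomputable def convAt (i j n : ℕ) (f : KPrime 𝒜 i →ₗ[k] B) (g : KPrime 𝒜 j →ₗ[k] B) :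
    KPrime 𝒜 n →ₗ[k] B :=
  if h : i + j = n then LinearMap.mul' k B ∘ₗ TensorProduct.map f g ∘ₗ decon 𝒜 h else 0

theorem convAt_assoc {a b c m m' n : ℕ} (h1 : a + b = m) (h2 : m + c = n) (h3 : b + c = m')
    (h4 : a + m' = n) (f : KPrime 𝒜 a →ₗ[k] B) (g : KPrime 𝒜 b →ₗ[k] B)
    (e : KPrime 𝒜 c →ₗ[k] B) :
    convAt m c n (convAt a b m f g) e = convAt a m' n f (convAt b c m' g e) := by
  refine LinearMap.ext fun w => ?_
  simp only [convAt, dif_pos h1, dif_pos h2, dif_pos h3, dif_pos h4, LinearMap.comp_apply]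
  have key := congrArg (LinearMap.mul' k B ∘ₗ
    TensorProduct.map f (LinearMap.mul' k B ∘ₗ TensorProduct.map g e))
    (decon_coassoc 𝒜 h1 h2 h3 h4 w)
  have e1 : (LinearMap.mul' k B ∘ₗ
      TensorProduct.map f (LinearMap.mul' k B ∘ₗ TensorProduct.map g e)) ∘ₗ
      (TensorProduct.assoc k _ _ _).toLinearMap ∘ₗ (decon 𝒜 h1).rTensor (KPrime 𝒜 c)
      = LinearMap.mul' k B ∘ₗ
        TensorProduct.map (LinearMap.mul' k B ∘ₗ TensorProduct.map f g ∘ₗ decon 𝒜 h1) e := by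
    refine TensorProduct.ext' fun u v => ?_
    have : ∀ y : KPrime 𝒜 a ⊗[k] KPrime 𝒜 b, (LinearMap.mul' k B ∘ₗ
      TensorProduct.map f (LinearMap.mul' k B ∘ₗ TensorProduct.map g e))
        (TensorProduct.assoc k _ _ _ (y ⊗ₜ v))
          = LinearMap.mul' k B (TensorProduct.map f g y) * e v := fun y => by
      induction y with
      | zero => simp
      | add y y' h h' => simp only [TensorProduct.add_tmul, map_add, h, h', add_mul]
      | tmul x y => simp [mul_assoc]
    simpa using this (decon 𝒜 h1 u)
  have e2 : (LinearMap.mul' k B ∘ₗ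
      TensorProduct.map f (LinearMap.mul' k B ∘ₗ TensorProduct.map g e)) ∘ₗ
      (decon 𝒜 h3).lTensor (KPrime 𝒜 a)
      = LinearMap.mul' k B ∘ₗ
        TensorProduct.map f (LinearMap.mul' k B ∘ₗ TensorProduct.map g e ∘ₗ decon 𝒜 h3) := by
    refine TensorProduct.ext' fun u v => by simp
  have k1 := LinearMap.congr_fun e1 (decon 𝒜 h2 w)
  have k2 := LinearMap.congr_fun e2 (decon 𝒜 h4 w)
  exact (k1.symm.trans key).trans k2

/-- The convolution product of families of maps `K'_i → B`. -/
noncomputable def conv (F G : ∀ i, KPrime 𝒜 i →ₗ[k] B) : ∀ i, KPrime 𝒜 i →ₗ[k] B := fun n =>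
  ∑ p ∈ Finset.HasAntidiagonal.antidiagonal n, convAt p.1 p.2 n (F p.1) (G p.2)

theorem convAt_add_left (i j n : ℕ) (f f' : KPrime 𝒜 i →ₗ[k] B) (g : KPrime 𝒜 j →ₗ[k] B) :
    convAt i j n (f + f') g = convAt i j n f g + convAt i j n f' g := by
  unfold convAt
  split_ifs
  · rw [TensorProduct.map_add_left, LinearMap.add_comp, LinearMap.comp_add]
  · simp

theorem convAt_add_right (i j n : ℕ) (f : KPrime 𝒜 i →ₗ[k] B) (g g' : KPrime 𝒜 j →ₗ[k] B) :
    convAt i j n f (g + g') = convAt i j n f g + convAt i j n f g' := by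
  unfold convAt
  split_ifs
  · rw [TensorProduct.map_add_right, LinearMap.add_comp, LinearMap.comp_add]
  · simp

theorem convAt_smul_left (i j n : ℕ) (r : k) (f : KPrime 𝒜 i →ₗ[k] B) (g : KPrime 𝒜 j →ₗ[k] B) :
    convAt i j n (r • f) g = r • convAt i j n f g := by
  unfold convAt
  split_ifs
  · rw [TensorProduct.map_smul_left, LinearMap.smul_comp, LinearMap.comp_smul]
  · simp

theorem convAt_smul_right (i j n : ℕ) (r : k) (f : KPrime 𝒜 i →ₗ[k] B)
    (g : KPrime 𝒜 j →ₗ[k] B) :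
    convAt i j n f (r • g) = r • convAt i j n f g := by
  unfold convAt
  split_ifs
  · rw [TensorProduct.map_smul_right, LinearMap.smul_comp, LinearMap.comp_smul]
  · simp

theorem convAt_zero_left (i j n : ℕ) (g : KPrime 𝒜 j →ₗ[k] B) :
    convAt i j n (0 : KPrime 𝒜 i →ₗ[k] B) g = 0 := by
  simpa using convAt_smul_left i j n (0 : k) (0 : KPrime 𝒜 i →ₗ[k] B) g

theorem convAt_zero_right (i j n : ℕ) (f : KPrime 𝒜 i →ₗ[k] B) :
    convAt i j n f (0 : KPrime 𝒜 j →ₗ[k] B) = 0 := by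
  simpa using convAt_smul_right i j n (0 : k) f (0 : KPrime 𝒜 j →ₗ[k] B)

theorem convAt_sum_left {I : Type*} (s : Finset I) (i j n : ℕ) (f : I → KPrime 𝒜 i →ₗ[k] B)
    (g : KPrime 𝒜 j →ₗ[k] B) :
    convAt i j n (∑ x ∈ s, f x) g = ∑ x ∈ s, convAt i j n (f x) g := by
  classical
  induction s using Finset.induction_on with
  | empty => simp [convAt_zero_left]
  | insert x s hx ih => rw [Finset.sum_insert hx, Finset.sum_insert hx, convAt_add_left, ih]

theorem convAt_sum_right {I : Type*} (s : Finset I) (i j n : ℕ) (f : KPrime 𝒜 i →ₗ[k] B)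
    (g : I → KPrime 𝒜 j →ₗ[k] B) :
    convAt i j n f (∑ x ∈ s, g x) = ∑ x ∈ s, convAt i j n f (g x) := by
  classical
  induction s using Finset.induction_on with
  | empty => simp [convAt_zero_right]
  | insert x s hx ih => rw [Finset.sum_insert hx, Finset.sum_insert hx, convAt_add_right, ih]

variable (F F' G G' H : ∀ i, KPrime 𝒜 i →ₗ[k] B)

theorem conv_assoc : conv (conv F G) H = conv F (conv G H) := by
  funext n
  simp only [conv, convAt_sum_left, convAt_sum_right]
  rw [Finset.sum_sigma', Finset.sum_sigma']
  refine Finset.sum_bij' (fun p _ => ⟨(p.2.1, p.2.2 + p.1.2), (p.2.2, p.1.2)⟩)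
    (fun p _ => ⟨(p.1.1 + p.2.1, p.2.2), (p.1.1, p.2.1)⟩) ?_ ?_ ?_ ?_ ?_
  · rintro ⟨⟨m, c⟩, ⟨a, b⟩⟩ h
    simp only [Finset.mem_sigma, Finset.HasAntidiagonal.mem_antidiagonal] at h ⊢
    exact ⟨by omega, trivial⟩
  · rintro ⟨⟨a, m⟩, ⟨b, c⟩⟩ h
    simp only [Finset.mem_sigma, Finset.HasAntidiagonal.mem_antidiagonal] at h ⊢
    exact ⟨by omega, trivial⟩
  · rintro ⟨⟨m, c⟩, ⟨a, b⟩⟩ h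
    simp only [Finset.mem_sigma, Finset.HasAntidiagonal.mem_antidiagonal] at h
    obtain ⟨_, rfl⟩ := h
    rfl
  · rintro ⟨⟨a, m⟩, ⟨b, c⟩⟩ h
    simp only [Finset.mem_sigma, Finset.HasAntidiagonal.mem_antidiagonal] at h
    obtain ⟨_, rfl⟩ := h
    rfl
  · rintro ⟨⟨m, c⟩, ⟨a, b⟩⟩ h
    simp only [Finset.mem_sigma, Finset.HasAntidiagonal.mem_antidiagonal] at h
    exact convAt_assoc h.2 h.1 rfl (by omega) _ _ _

theorem conv_add_left : conv (F + F') G = conv F G + conv F' G := by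
  funext n
  simp only [conv, Pi.add_apply, convAt_add_left, Finset.sum_add_distrib]

theorem conv_add_right : conv F (G + G') = conv F G + conv F G' := by
  funext n
  simp only [conv, Pi.add_apply, convAt_add_right, Finset.sum_add_distrib]

theorem conv_smul_left (r : k) : conv (r • F) G = r • conv F G := by
  funext n
  simp only [conv, Pi.smul_apply, convAt_smul_left, Finset.smul_sum]

theorem conv_smul_right (r : k) : conv F (r • G) = r • conv F G := by
  funext n
  simp only [conv, Pi.smul_apply, convAt_smul_right, Finset.smul_sum]

theorem neg_one_smul_family : (-1 : k) • F = -F := by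
  funext i
  refine LinearMap.ext fun w => ?_
  simp

theorem conv_neg_left : conv (-F) G = -conv F G := by
  rw [← neg_one_smul_family, conv_smul_left, neg_one_smul_family]

theorem conv_neg_right : conv F (-G) = -conv F G := by
  rw [← neg_one_smul_family, conv_smul_right, neg_one_smul_family]

theorem conv_sub_left : conv (F - F') G = conv F G - conv F' G := by
  rw [sub_eq_add_neg, conv_add_left, conv_neg_left, sub_eq_add_neg]

theorem conv_sub_right : conv F (G - G') = conv F G - conv F G' := by
  rw [sub_eq_add_neg, conv_add_right, conv_neg_right, sub_eq_add_neg]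

/-- The sign change `F_i ↦ (-1)^i F_i`. -/
noncomputable def bar : ∀ i, KPrime 𝒜 i →ₗ[k] B := fun i => (-1 : k) ^ i • F i

theorem bar_bar : bar (bar F) = F := by
  funext i
  rw [bar, bar, smul_smul, ← mul_pow]
  simp

theorem bar_conv : bar (conv F G) = conv (bar F) (bar G) := by
  funext n
  rw [bar, conv, conv, Finset.smul_sum]
  refine Finset.sum_congr rfl fun p hp => ?_
  rw [Finset.HasAntidiagonal.mem_antidiagonal] at hp
  rw [bar, bar, convAt_smul_left, convAt_smul_right, smul_smul, ← hp, pow_add]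

theorem bar_sub : bar (F - G) = bar F - bar G := by
  funext n
  simp [bar, smul_sub]

/-- Composition of a family with a linear map. -/
noncomputable def comp (D : B →ₗ[k] B) : ∀ i, KPrime 𝒜 i →ₗ[k] B := fun i => D ∘ₗ F i

theorem comp_bar (D : B →ₗ[k] B) : comp (bar F) D = bar (comp F D) := by
  funext i
  simp [comp, bar, LinearMap.comp_smul]

theorem comp_sub (D : B →ₗ[k] B) : comp (F - G) D = comp F D - comp G D := by
  funext i
  simp [comp, LinearMap.comp_sub]

/-- The Leibniz rule passes from the target algebra to the convolution algebra. After this, signs in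
T(P) become operations on families. -/
theorem comp_conv {D s : B →ₗ[k] B} (hD : ∀ x y, D (x * y) = D x * y + s x * D y) :
    comp (conv F G) D = conv (comp F D) G + conv (comp F s) (comp G D) := by
  funext n
  simp only [comp, conv, Pi.add_apply, ← Finset.sum_add_distrib]
  refine LinearMap.ext fun w => ?_
  rw [LinearMap.comp_apply, LinearMap.sum_apply, LinearMap.sum_apply, map_sum]
  refine Finset.sum_congr rfl fun p hp => ?_
  rw [Finset.HasAntidiagonal.mem_antidiagonal] at hp
  simp only [convAt, dif_pos hp]
  have : D ∘ₗ LinearMap.mul' k B ∘ₗ TensorProduct.map (F p.1) (G p.2)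
      = LinearMap.mul' k B ∘ₗ TensorProduct.map (D ∘ₗ F p.1) (G p.2)
        + LinearMap.mul' k B ∘ₗ TensorProduct.map (s ∘ₗ F p.1) (D ∘ₗ G p.2) :=
    TensorProduct.ext' fun u v => by simp [hD]
  exact LinearMap.congr_fun this _

end Convolution

/-! ### The structure maps of P as identities between convolution products -/

section Coalgebra

variable {k A : Type*} [Field k] [Ring A] [Algebra k A] (𝒜 : ℕ → Submodule k A)

/-- The generators `1 ⊗ w ⊗ 1` of `P`, inside `T(P)`. -/
noncomputable def Γ : ∀ i, KPrime 𝒜 i →ₗ[k] T k A (P 𝒜) := fun i =>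
  (T.ι k A (P 𝒜)).restrictScalars k ∘ₗ gen 𝒜 i

/-- The inclusion of `K'_1 = V` into `A ⊆ T(P)`, extended by zero. -/
noncomputable def ν : ∀ i, KPrime 𝒜 i →ₗ[k] T k A (P 𝒜)
  | 1 => (T.inl k A (P 𝒜)).toLinearMap ∘ₗ val 𝒜
  | _ => 0

theorem ν_of_ne {i : ℕ} (h : i ≠ 1) : ν 𝒜 i = 0 := by
  match i, h with
  | 0, _ => rfl
  | (i + 2), _ => rfl

theorem bar_ν : bar (ν 𝒜) = -ν 𝒜 := by
  funext i
  by_cases h : i = 1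
  · subst h
    exact (congrArg (· • ν 𝒜 1) (pow_one (-1 : k))).trans
      (congrFun (neg_one_smul_family (ν 𝒜)) 1)
  · simp [bar, ν_of_ne 𝒜 h]

theorem ι_leftMul (i : ℕ) (z : KPrime 𝒜 1 ⊗[k] KPrime 𝒜 i) :
    T.ι k A (P 𝒜) (leftMul 𝒜 i z) = LinearMap.mul' k _ (TensorProduct.map (ν 𝒜 1) (Γ 𝒜 i) z) := by
  induction z with
  | zero => simp
  | add x y hx hy => simp only [map_add, hx, hy]
  | tmul v u => simp [leftMul, ν, Γ, T.env_smul]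

theorem ι_rightMul (i : ℕ) (z : KPrime 𝒜 i ⊗[k] KPrime 𝒜 1) :
    T.ι k A (P 𝒜) (rightMul 𝒜 i z)
      = LinearMap.mul' k _ (TensorProduct.map (Γ 𝒜 i) (ν 𝒜 1) z) := by
  induction z with
  | zero => simp
  | add x y hx hy => simp only [map_add, hx, hy]
  | tmul v u => simp [rightMul, ν, Γ, T.env_smul]

theorem conv_ν_left (F : ∀ i, KPrime 𝒜 i →ₗ[k] T k A (P 𝒜)) (i : ℕ) :
    conv (ν 𝒜) F (i + 1) = convAt 1 i (i + 1) (ν 𝒜 1) (F i) := by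
  refine Finset.sum_eq_single (1, i) (fun p hp h => ?_) (fun h => ?_)
  · have : p.1 ≠ 1 := fun h1 => h (Prod.ext h1 (by
      rw [Finset.HasAntidiagonal.mem_antidiagonal] at hp; simp only; omega))
    rw [ν_of_ne 𝒜 this, convAt_zero_left]
  · exact absurd (Finset.HasAntidiagonal.mem_antidiagonal.2 (add_comm _ _)) h

theorem conv_ν_right (F : ∀ i, KPrime 𝒜 i →ₗ[k] T k A (P 𝒜)) (i : ℕ) :
    conv F (ν 𝒜) (i + 1) = convAt i 1 (i + 1) (F i) (ν 𝒜 1) := by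
  refine Finset.sum_eq_single (i, 1) (fun p hp h => ?_) (fun h => ?_)
  · have : p.2 ≠ 1 := fun h1 => h (Prod.ext (by
      rw [Finset.HasAntidiagonal.mem_antidiagonal] at hp; simp only; omega) h1)
    rw [ν_of_ne 𝒜 this, convAt_zero_right]
  · exact absurd (Finset.HasAntidiagonal.mem_antidiagonal.2 (by rfl)) h

theorem conv_ν_left_zero (F : ∀ i, KPrime 𝒜 i →ₗ[k] T k A (P 𝒜)) : conv (ν 𝒜) F 0 = 0 := by
  simp [conv, ν_of_ne, convAt_zero_left]

theorem conv_ν_right_zero (F : ∀ i, KPrime 𝒜 i →ₗ[k] T k A (P 𝒜)) : conv F (ν 𝒜) 0 = 0 := by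
  simp [conv, ν_of_ne, convAt_zero_right]

theorem d_gen_zero (w : KPrime 𝒜 0) : d 𝒜 (gen 𝒜 0 w) = 0 := liftP_gen 𝒜 _ 0 w

theorem d_gen_succ (i : ℕ) (w : KPrime 𝒜 (i + 1)) :
    d 𝒜 (gen 𝒜 (i + 1) w) = leftMul 𝒜 i (decon 𝒜 (add_comm 1 i) w)
      + (-1 : k) ^ (i + 1) • rightMul 𝒜 i (decon 𝒜 rfl w) := liftP_gen 𝒜 _ (i + 1) w

/-- Only index 1 contributes to a convolution with ν. The sign (-1)^{i+1} of the right-hand term of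
d becomes the minus sign together with (-1)^i from `bar`, evaluated on the remaining i letters. -/
theorem ι_d_gen (i : ℕ) (w : KPrime 𝒜 i) :
    T.ι k A (P 𝒜) (d 𝒜 (gen 𝒜 i w)) = (conv (ν 𝒜) (Γ 𝒜) - conv (bar (Γ 𝒜)) (ν 𝒜)) i w := by
  cases i with
  | zero =>
    rw [d_gen_zero, Pi.sub_apply, conv_ν_left_zero, conv_ν_right_zero]
    simp
  | succ i =>
    have hs : ∀ (r : k) x, T.ι k A (P 𝒜) (r • x) = r • T.ι k A (P 𝒜) x := fun r x =>
      ((T.ι k A (P 𝒜)).restrictScalars k).map_smul r x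
    rw [d_gen_succ, Pi.sub_apply, conv_ν_left, conv_ν_right, map_add, hs, ι_leftMul, ι_rightMul,
      bar, convAt_smul_left, convAt, convAt, dif_pos (add_comm 1 i), dif_pos rfl]
    simp [pow_succ, sub_eq_add_neg]

theorem diag_gen (n : ℕ) (w : KPrime 𝒜 n) :
    diag 𝒜 (gen 𝒜 n w) = conv (bar (Γ 𝒜)) (Γ 𝒜) n w := by
  rw [diag, liftP_gen, conv, Finset.Nat.sum_antidiagonal_eq_sum_range_succ
    (fun i j => convAt i j n (bar (Γ 𝒜) i) (Γ 𝒜 j)), Finset.sum_range, LinearMap.sum_apply,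
    LinearMap.sum_apply]
  refine Finset.sum_congr rfl fun i _ => ?_
  rw [bar, convAt_smul_left, convAt, dif_pos (Nat.add_sub_cancel' (Nat.le_of_lt_succ i.2))]
  rfl

variable [GradedAlgebra 𝒜]

theorem sgn_comp_Γ (l : ℤ) (i : ℕ) (w : KPrime 𝒜 i) :
    sgn (grP 𝒜) l (Γ 𝒜 i w) = ((l * (1 - i)).negOnePow : ℤ) • Γ 𝒜 i w :=
  sgn_ι_of_mem l (gen_mem 𝒜 i w)

/-- A generator from K'_i has degree 1 - i because of the shift, and this accounts for the extra
minus sign. -/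
theorem comp_Γ_sgn : comp (Γ 𝒜) (sgn (grP 𝒜) 1).toLinearMap = -bar (Γ 𝒜) := by
  funext i
  refine LinearMap.ext fun w => ?_
  refine (sgn_comp_Γ 𝒜 1 i w).trans ?_
  rw [one_mul, Int.negOnePow_sub, Int.negOnePow_one, Pi.neg_apply, bar]
  rcases Nat.even_or_odd i with h | h
  · simp [h.neg_one_pow, Int.negOnePow_even _ ((Int.even_coe_nat i).2 h)]
  · simp [h.neg_one_pow, Int.negOnePow_odd _ ((Int.odd_coe_nat i).2 h)]

theorem comp_ν {D : T k A (P 𝒜) →ₗ[k] T k A (P 𝒜)} {l : ℤ} (hD : IsDerivation (grP 𝒜) l D) :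
    comp (ν 𝒜) D = 0 := by
  funext i
  by_cases h : i = 1
  · subst h
    exact LinearMap.ext fun w => hD.inl _
  · simp [comp, ν_of_ne 𝒜 h]

theorem comp_ν_sgn (l : ℤ) : comp (ν 𝒜) (sgn (grP 𝒜) l).toLinearMap = ν 𝒜 := by
  funext i
  by_cases h : i = 1
  · subst h
    exact LinearMap.ext fun w => sgn_inl _ _
  · simp [comp, ν_of_ne 𝒜 h]

/-- Products of the letters of a relation vanish in `A`. -/
theorem conv_ν_ν : conv (ν 𝒜) (ν 𝒜) = 0 := by
  funext n
  rcases n with _ | i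
  · exact conv_ν_left_zero 𝒜 _
  rw [conv_ν_left]
  by_cases hi : i = 1
  · subst hi
    refine LinearMap.ext fun w => ?_
    rw [convAt, dif_pos rfl]
    have key : LinearMap.mul' k _ ∘ₗ TensorProduct.map (ν 𝒜 1) (ν 𝒜 1)
        = (T.inl k A (P 𝒜)).toLinearMap ∘ₗ (toA 𝒜).toLinearMap ∘ₗ
          Submodule.mulMap (KPrime 𝒜 1) (KPrime 𝒜 1) :=
      TensorProduct.ext' fun u v => by simp [ν, val]
    have h1 := LinearMap.congr_fun key (decon 𝒜 (rfl : 1 + 1 = 2) w)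
    -- For length 2 the intersection defining K'_2 has the single term j = l = 0.
    have hw : (w : TensorAlgebra k (𝒜 1)) ∈ R 𝒜 := by
      have := (Submodule.mem_inf.1 w.2).2
      simp only [Submodule.mem_iInf] at this
      simpa [tpow] using this 0 0 rfl
    have hw' : toA 𝒜 (w : TensorAlgebra k (𝒜 1)) = 0 := hw.1
    simp only [LinearMap.comp_apply, mulMap_decon, AlgHom.toLinearMap_apply] at h1 ⊢
    erw [h1]
    rw [hw', map_zero]
    rfl
  · rw [ν_of_ne 𝒜 hi, convAt_zero_right]
    rfl

/-- The differential of `T(P)`. -/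
noncomputable abbrev dT : T k A (P 𝒜) →ₗ[k] T k A (P 𝒜) := derivation (grP 𝒜) 1 (δ 𝒜 1)

/-- The derivation of `T(P)` extending the coproduct `δ₂`. -/
noncomputable abbrev diagT : T k A (P 𝒜) →ₗ[k] T k A (P 𝒜) := derivation (grP 𝒜) 1 (δ 𝒜 2)

theorem comp_Γ_dT : comp (Γ 𝒜) (dT 𝒜) = conv (ν 𝒜) (Γ 𝒜) - conv (bar (Γ 𝒜)) (ν 𝒜) := by
  funext i
  refine LinearMap.ext fun w => ?_
  rw [← ι_d_gen]
  exact derivation_ι _ _ _ _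

theorem comp_Γ_diagT : comp (Γ 𝒜) (diagT 𝒜) = conv (bar (Γ 𝒜)) (Γ 𝒜) := by
  funext i
  refine LinearMap.ext fun w => ?_
  rw [← diag_gen]
  exact derivation_ι _ _ _ _

theorem comp_dT (F G : ∀ i, KPrime 𝒜 i →ₗ[k] T k A (P 𝒜)) :
    comp (conv F G) (dT 𝒜) = conv (comp F (dT 𝒜)) G
      + conv (comp F (sgn (grP 𝒜) 1).toLinearMap) (comp G (dT 𝒜)) :=
  comp_conv F G (isDerivation_derivation _ _).mul

theorem comp_diagT (F G : ∀ i, KPrime 𝒜 i →ₗ[k] T k A (P 𝒜)) :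
    comp (conv F G) (diagT 𝒜) = conv (comp F (diagT 𝒜)) G
      + conv (comp F (sgn (grP 𝒜) 1).toLinearMap) (comp G (diagT 𝒜)) :=
  comp_conv F G (isDerivation_derivation _ _).mul

theorem comp_ν_dT : comp (ν 𝒜) (dT 𝒜) = 0 := comp_ν 𝒜 (isDerivation_derivation _ _)

theorem comp_ν_diagT : comp (ν 𝒜) (diagT 𝒜) = 0 := comp_ν 𝒜 (isDerivation_derivation _ _)

theorem conv_zero_left (F : ∀ i, KPrime 𝒜 i →ₗ[k] T k A (P 𝒜)) :
    conv (0 : ∀ i, KPrime 𝒜 i →ₗ[k] T k A (P 𝒜)) F = 0 := by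
  simpa using conv_smul_left (0 : ∀ i, KPrime 𝒜 i →ₗ[k] T k A (P 𝒜)) F (0 : k)

theorem conv_zero_right (F : ∀ i, KPrime 𝒜 i →ₗ[k] T k A (P 𝒜)) :
    conv F (0 : ∀ i, KPrime 𝒜 i →ₗ[k] T k A (P 𝒜)) = 0 := by
  simpa using conv_smul_right F (0 : ∀ i, KPrime 𝒜 i →ₗ[k] T k A (P 𝒜)) (0 : k)

/-- Applying D₁ to νΓ - Γ̄ν produces ννΓ and Γνν, which vanish, and two copies of νΓ̄ν with opposite
signs. -/
theorem comp_Γ_dT_dT : comp (comp (Γ 𝒜) (dT 𝒜)) (dT 𝒜) = 0 := by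
  simp only [comp_Γ_dT, comp_sub, comp_dT, comp_ν_dT, comp_ν_sgn, comp_bar, comp_Γ_sgn,
    conv_zero_left, conv_zero_right, bar_sub, bar_conv, bar_bar, bar_ν, conv_sub_left,
    conv_sub_right, conv_neg_left, conv_neg_right]
  simp only [← conv_assoc, conv_ν_ν, conv_zero_left]
  simp only [conv_assoc, conv_ν_ν, conv_zero_right]
  abel

/-- By coassociativity both Leibniz terms of D₂(Γ̄Γ) are ΓΓ̄Γ, with opposite signs. The signs in δ₂
are what makes them opposite. -/
theorem comp_Γ_diagT_diagT : comp (comp (Γ 𝒜) (diagT 𝒜)) (diagT 𝒜) = 0 := by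
  have : bar (-bar (Γ 𝒜)) = -Γ 𝒜 := by
    funext i
    have := congrFun (bar_bar (Γ 𝒜)) i
    simpa [bar] using this
  simp only [comp_Γ_diagT, comp_diagT, comp_bar, comp_Γ_sgn, bar_conv, bar_bar, this,
    conv_neg_left, conv_assoc]
  abel

/-- In D₁(Γ̄Γ) the two terms ΓνΓ, with the letter in the middle, cancel. What remains is -νΓ̄Γ +
ΓΓ̄ν, the negative of D₂(νΓ - Γ̄ν). -/
theorem comp_Γ_dT_diagT :
    comp (comp (Γ 𝒜) (diagT 𝒜)) (dT 𝒜) + comp (comp (Γ 𝒜) (dT 𝒜)) (diagT 𝒜) = 0 := by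
  have : bar (-bar (Γ 𝒜)) = -Γ 𝒜 := by
    funext i
    have := congrFun (bar_bar (Γ 𝒜)) i
    simpa [bar] using this
  simp only [comp_Γ_dT, comp_Γ_diagT, comp_sub, comp_dT, comp_diagT, comp_ν_diagT, comp_ν_sgn,
    comp_bar, comp_Γ_sgn, this, conv_zero_left, conv_zero_right, bar_sub, bar_conv, bar_bar,
    bar_ν, conv_sub_left, conv_sub_right, conv_neg_left, conv_neg_right, conv_assoc]
  abel

end Coalgebra
end Koszul


namespace Koszul

open scoped TensorProduct DirectSum
open MulOpposite AInfinity

/-! ### P is an A_∞-coalgebra -/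

section CoalgebraStructure

variable {k A : Type*} [Field k] [Ring A] [Algebra k A] (𝒜 : ℕ → Submodule k A)

theorem leftMul_mem (i : ℕ) (z : KPrime 𝒜 1 ⊗[k] KPrime 𝒜 i) :
    leftMul 𝒜 i z ∈ grP 𝒜 (1 - (i : ℤ)) := by
  induction z with
  | zero => rw [map_zero]; exact zero_mem _
  | add x y hx hy => rw [map_add]; exact add_mem hx hy
  | tmul v u => exact Submodule.smul_mem _ _ (gen_mem 𝒜 i u)

theorem rightMul_mem (i : ℕ) (z : KPrime 𝒜 i ⊗[k] KPrime 𝒜 1) :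
    rightMul 𝒜 i z ∈ grP 𝒜 (1 - (i : ℤ)) := by
  induction z with
  | zero => rw [map_zero]; exact zero_mem _
  | add x y hx hy => rw [map_add]; exact add_mem hx hy
  | tmul u v => exact Submodule.smul_mem _ _ (gen_mem 𝒜 i u)

theorem grP_induction {j : ℤ} {p : P 𝒜 → Prop} (h0 : p 0) (hadd : ∀ x y, p x → p y → p (x + y))
    (hsmul : ∀ (e : Env k A) x, p x → p (e • x))
    (hgen : ∀ (i : ℕ) (w : KPrime 𝒜 i), 1 - (i : ℤ) = j → p (gen 𝒜 i w))
    {x : P 𝒜} (hx : x ∈ grP 𝒜 j) : p x := by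
  induction hx using Submodule.span_induction with
  | mem x h =>
    obtain ⟨i, w, hi, rfl⟩ := h
    exact hgen i w hi
  | zero => exact h0
  | add x y _ _ hx hy => exact hadd x y hx hy
  | smul e x _ h => exact hsmul e x h

theorem d_gen_mem (i : ℕ) (w : KPrime 𝒜 i) : d 𝒜 (gen 𝒜 i w) ∈ grP 𝒜 (1 - (i : ℤ) + 1) := by
  cases i with
  | zero => rw [d_gen_zero]; exact zero_mem _
  | succ i =>
    have : 1 - ((i + 1 : ℕ) : ℤ) + 1 = 1 - (i : ℤ) := by push_cast; ring
    rw [d_gen_succ, this, ← smul_one_smul (Env k A) ((-1 : k) ^ (i + 1))]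
    exact add_mem (leftMul_mem 𝒜 i _) (Submodule.smul_mem _ _ (rightMul_mem 𝒜 i _))

theorem d_mem {j : ℤ} {x : P 𝒜} (hx : x ∈ grP 𝒜 j) : d 𝒜 x ∈ grP 𝒜 (j + 1) := by
  refine grP_induction 𝒜 (p := fun x => d 𝒜 x ∈ grP 𝒜 (j + 1)) (by simp)
    (fun x y hx hy => by rw [map_add]; exact add_mem hx hy)
    (fun e x hx => by rw [map_smul]; exact Submodule.smul_mem _ _ hx) (fun i w h => ?_) hx
  rw [← h]
  exact d_gen_mem 𝒜 i w

theorem convAt_mem {B : Type*} [Ring B] [Algebra k B] (S : Submodule k B) {i j n : ℕ}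
    {f : KPrime 𝒜 i →ₗ[k] B} {g : KPrime 𝒜 j →ₗ[k] B} (h : ∀ x y, i + j = n → f x * g y ∈ S)
    (w : KPrime 𝒜 n) : convAt i j n f g w ∈ S := by
  unfold convAt
  split_ifs with hn
  · rw [LinearMap.comp_apply, LinearMap.comp_apply]
    generalize decon 𝒜 hn w = z
    induction z with
    | zero => simp
    | add x y hx hy => rw [map_add, map_add]; exact add_mem hx hy
    | tmul x y => exact h x y hn
  · exact zero_mem S

theorem Γ_mem (i : ℕ) (w : KPrime 𝒜 i) : Γ 𝒜 i w ∈ tensorPow (grP 𝒜) 1 (1 - (i : ℤ)) :=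
  ι_mem_tensorPow (gen_mem 𝒜 i w)

theorem diag_gen_mem (n : ℕ) (w : KPrime 𝒜 n) :
    diag 𝒜 (gen 𝒜 n w) ∈ tensorPow (grP 𝒜) 2 (1 - (n : ℤ) + 1) := by
  rw [diag_gen, conv, LinearMap.sum_apply]
  refine Submodule.sum_mem _ fun p hp => convAt_mem 𝒜 _ (fun x y h => ?_) w
  rw [bar, LinearMap.smul_apply, smul_mul_assoc]
  refine Submodule.smul_mem _ _ (mul_mem_tensorPow' (Γ_mem 𝒜 _ x) (Γ_mem 𝒜 _ y) rfl ?_)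
  omega

theorem δ_mem (n : ℕ) (j : ℤ) (c : P 𝒜) (hc : c ∈ grP 𝒜 j) :
    δ 𝒜 n c ∈ tensorPow (grP 𝒜) n (j + 1) := by
  match n with
  | 0 => exact zero_mem _
  | 1 => exact ι_mem_tensorPow (d_mem 𝒜 hc)
  | 2 =>
    refine grP_induction 𝒜 (p := fun x => diag 𝒜 x ∈ tensorPow (grP 𝒜) 2 (j + 1)) (by simp)
      (fun x y hx hy => by rw [map_add]; exact add_mem hx hy)
      (fun e x hx => by rw [map_smul]; exact smul_mem_tensorPow hx e) (fun i w h => ?_) hc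
    rw [← h]
    exact diag_gen_mem 𝒜 i w
  | (n + 3) => exact zero_mem _

theorem IsDerivation.map_env_smul [GradedAlgebra 𝒜] {l : ℤ} {D : T k A (P 𝒜) →ₗ[k] T k A (P 𝒜)}
    (hD : IsDerivation (grP 𝒜) l D) (e : Env k A) (x : T k A (P 𝒜)) : D (e • x) = e • D x := by
  induction e using TensorProduct.induction_on with
  | zero =>
    have h (x : T k A (P 𝒜)) : (0 : Env k A) • x = 0 := zero_smul (Env k A) x
    rw [h, h, map_zero]
  | add e e' h h' => rw [add_smul, add_smul, map_add, h, h']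
  | tmul a b => rw [T.env_smul, T.env_smul, hD.mul, hD.mul, hD.inl, hD.inl, sgn_inl]; simp

variable [GradedAlgebra 𝒜]

/-- A derivation of `T(P)` over `A`, as a map of bimodules. -/
noncomputable def IsDerivation.toEnvLinear {l : ℤ} {D : T k A (P 𝒜) →ₗ[k] T k A (P 𝒜)}
    (hD : IsDerivation (grP 𝒜) l D) : T k A (P 𝒜) →ₗ[Env k A] T k A (P 𝒜) where
  toFun := D
  map_add' := D.map_add
  map_smul' := IsDerivation.map_env_smul 𝒜 hD

theorem derivation_comp_eq_zero (l : ℤ) (f g : P 𝒜 →ₗ[Env k A] T k A (P 𝒜))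
    (h : ∀ i w, derivation (grP 𝒜) l f (g (gen 𝒜 i w)) = 0) (c : P 𝒜) :
    derivation (grP 𝒜) l f (g c) = 0 := by
  have : IsDerivation.toEnvLinear 𝒜 (isDerivation_derivation l f) ∘ₗ g = 0 :=
    hom_ext fun i w => h i w
  exact LinearMap.congr_fun this c

theorem dT_δ₁ (c : P 𝒜) : dT 𝒜 (δ 𝒜 1 c) = 0 := by
  refine derivation_comp_eq_zero 𝒜 1 _ _ (fun i w => ?_) c
  have := LinearMap.congr_fun (congrFun (comp_Γ_dT_dT 𝒜) i) w
  rw [← derivation_ι (grP 𝒜) 1 (δ 𝒜 1)]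
  exact this

theorem diagT_δ₂ (c : P 𝒜) : diagT 𝒜 (δ 𝒜 2 c) = 0 := by
  refine derivation_comp_eq_zero 𝒜 1 _ _ (fun i w => ?_) c
  have := LinearMap.congr_fun (congrFun (comp_Γ_diagT_diagT 𝒜) i) w
  rw [← derivation_ι (grP 𝒜) 1 (δ 𝒜 2)]
  exact this

theorem dT_δ₂ (c : P 𝒜) : dT 𝒜 (δ 𝒜 2 c) + diagT 𝒜 (δ 𝒜 1 c) = 0 := by
  have : IsDerivation.toEnvLinear 𝒜 (isDerivation_derivation 1 (δ 𝒜 1)) ∘ₗ δ 𝒜 2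
      + IsDerivation.toEnvLinear 𝒜 (isDerivation_derivation 1 (δ 𝒜 2)) ∘ₗ δ 𝒜 1 = 0 := by
    refine hom_ext fun i w => ?_
    have := LinearMap.congr_fun (congrFun (comp_Γ_dT_diagT 𝒜) i) w
    change dT 𝒜 (δ 𝒜 2 (gen 𝒜 i w)) + diagT 𝒜 (δ 𝒜 1 (gen 𝒜 i w)) = 0
    rw [← derivation_ι (grP 𝒜) 1 (δ 𝒜 1) (gen 𝒜 i w),
      ← derivation_ι (grP 𝒜) 1 (δ 𝒜 2) (gen 𝒜 i w)]
    exact this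
  exact LinearMap.congr_fun this c

theorem diagT_diagT (x : T k A (P 𝒜)) : diagT 𝒜 (diagT 𝒜 x) = 0 :=
  derivation_one_sq (δ_mem 𝒜 2) (diagT_δ₂ 𝒜) x

theorem dT_diagT (x : T k A (P 𝒜)) : dT 𝒜 (diagT 𝒜 x) + diagT 𝒜 (dT 𝒜 x) = 0 :=
  derivation_one_anticomm (δ_mem 𝒜 1) (δ_mem 𝒜 2) (dT_δ₂ 𝒜) x

theorem derivation_zero {k A C : Type*} [Field k] [Ring A] [Algebra k A] [AddCommGroup C]
    [Module k C] [Module (Env k A) C] [IsScalarTower k (Env k A) C]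
    (𝒞 : ℤ → Submodule (Env k A) C) [DirectSum.Decomposition 𝒞] (l : ℤ) (x : T k A C) :
    derivation 𝒞 l 0 x = 0 := by
  have h0 : IsDerivation 𝒞 l (0 : T k A C →ₗ[k] T k A C) := ⟨fun _ => rfl, fun x y => by simp⟩
  exact LinearMap.congr_fun ((isDerivation_derivation l 0).ext h0 fun c => derivation_ι 𝒞 l 0 c) x

/-- `C` embeds into `T(C)`: let `T(C)` act on `A × C`. -/
theorem ι_injective {k A C : Type*} [Field k] [Ring A] [Algebra k A] [AddCommGroup C]
    [Module k C] [Module (Env k A) C] [IsScalarTower k (Env k A) C] :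
    Function.Injective (T.ι k A C) := by
  let F : T k A C →ₐ[k] Module.End k (A × C) := T.lift
    (AlgHom.ofLinearMap
      { toFun := fun b => LinearMap.prodMap (LinearMap.mulLeft k b)
          (Module.toModuleEnd k C (b ⊗ₜ[k] 1 : Env k A))
        map_add' := fun b b' => by
          refine LinearMap.ext fun x => Prod.ext ?_ ?_
          · simp [add_mul]
          · simp [TensorProduct.add_tmul, add_smul]
        map_smul' := fun r b => by
          refine LinearMap.ext fun x => Prod.ext ?_ ?_
          · simp
          · simp [← TensorProduct.smul_tmul'] }
      (by
        refine LinearMap.ext fun x => Prod.ext ?_ ?_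
        · simp
        · simp [← Algebra.TensorProduct.one_def])
      (fun b b' => by
        refine LinearMap.ext fun x => Prod.ext ?_ ?_
        · simp
        · simp [smul_smul]))
    { toFun := fun c => LinearMap.prod 0
          { toFun := fun a => ((1 ⊗ₜ[k] op a.1 : Env k A) • c)
            map_add' := fun a a' => by simp [TensorProduct.tmul_add, add_smul]
            map_smul' := fun r a => by simp [TensorProduct.tmul_smul] }
      map_add' := fun c c' => by
        refine LinearMap.ext fun x => Prod.ext ?_ ?_
        · simp
        · simp
      map_smul' := fun r c => by
        refine LinearMap.ext fun x => Prod.ext ?_ ?_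
        · simp
        · simp [smul_comm _ r c] }
    (fun b c => by
      refine LinearMap.ext fun x => Prod.ext ?_ ?_
      · simp
      · simp [smul_smul])
    (fun c b => by
      refine LinearMap.ext fun x => Prod.ext ?_ ?_
      · simp
      · simp [smul_smul])
  have h : ∀ c, F (T.ι k A C c) (1, 0) = (0, c) := fun c => by
    simp [F, ← Algebra.TensorProduct.one_def]
  intro c c' hc
  have := congrArg Prod.snd ((h c).symm.trans ((congrArg (fun x => F x (1, 0)) hc).trans (h c')))
  exact this

/-- The identity is known inside T(P); it descends because P embeds there. -/
theorem d_d (c : P 𝒜) : d 𝒜 (d 𝒜 c) = 0 := by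
  apply ι_injective (k := k) (A := A)
  have := dT_δ₁ 𝒜 c
  rw [map_zero, ← this]
  exact (derivation_ι (grP 𝒜) 1 (δ 𝒜 1) (d 𝒜 c)).symm

theorem δ_of_ne {n : ℕ} (h1 : n ≠ 1) (h2 : n ≠ 2) : δ 𝒜 n = 0 := by
  match n with
  | 0 => rfl
  | 1 => exact absurd rfl h1
  | 2 => exact absurd rfl h2
  | (n + 3) => rfl

/-- The only terms `1 ⊗ δₛ ⊗ 1` with `δₛ ≠ 0` are those with `s = 1, 2`. -/
theorem sum_derivation_δ (N : ℕ) (f : ℕ → T k A (P 𝒜)) :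
    ∑ s ∈ Finset.range (N + 2), derivation (grP 𝒜) 1 (δ 𝒜 s) (f (N + 1 - s + 1))
      = dT 𝒜 (f (N + 1)) + if N = 0 then 0 else diagT 𝒜 (f N) := by
  cases N with
  | zero => simp [Finset.sum_range_succ, δ_of_ne 𝒜 (n := 0), derivation_zero]
  | succ N =>
    rw [Finset.sum_range_succ', Finset.sum_range_succ', Finset.sum_range_succ',
      Finset.sum_eq_zero fun s _ => by rw [δ_of_ne 𝒜 (by omega) (by omega), derivation_zero]]
    simp only [δ_of_ne 𝒜 (n := 0) (by omega) (by omega), derivation_zero, add_zero, zero_add,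
      Nat.succ_ne_zero, if_false, add_tsub_cancel_right, Nat.reduceAdd]
    rw [add_comm, show N + 1 + 1 - 2 + 1 = N + 1 by omega]

theorem isCoalgebra_δ : IsCoalgebra (grP 𝒜) (δ 𝒜) where
  degree := δ_mem 𝒜
  zero := rfl
  eq N c := by
    cases N with
    | zero => simp [δ_of_ne 𝒜 (n := 0), derivation_zero]
    | succ N =>
      rw [sum_derivation_δ 𝒜 N fun n => δ 𝒜 n c]
      match N with
      | 0 => simp [dT_δ₁]
      | 1 => simpa using dT_δ₂ 𝒜 c
      | 2 => simp [δ_of_ne 𝒜 (n := 3), diagT_δ₂]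
      | N + 3 => simp [δ_of_ne 𝒜 (n := N + 3), δ_of_ne 𝒜 (n := N + 4)]

end CoalgebraStructure
end Koszul


/-! ### Letter-by-letter induction and recursion on T(V) ⊗ N -/

namespace Koszul

open scoped TensorProduct DirectSum
open MulOpposite AInfinity

/-- The set of x for which left multiplication by x preserves p is closed under sums and products,
and contains scalars and letters. Apply this to p 1. -/
theorem _root_.TensorAlgebra.cons_induction {k V : Type*} [Field k] [AddCommGroup V] [Module k V]
    {p : TensorAlgebra k V → Prop} (one : p 1) (smul : ∀ (r : k) x, p x → p (r • x))
    (add : ∀ x y, p x → p y → p (x + y)) (cons : ∀ v x, p x → p (TensorAlgebra.ι k v * x))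
    (x : TensorAlgebra k V) : p x := by
  have : ∀ x : TensorAlgebra k V, ∀ y, p y → p (x * y) := fun x => by
    induction x using TensorAlgebra.induction with
    | algebraMap r => intro y hy; rw [← Algebra.smul_def]; exact smul r y hy
    | ι v => exact fun y hy => cons v y hy
    | mul a b ha hb => intro y hy; rw [mul_assoc]; exact ha _ (hb _ hy)
    | add a b ha hb => intro y hy; rw [add_mul]; exact add _ _ (ha y hy) (hb y hy)
  simpa using this x 1 one

section Recursion

variable {k V N W : Type*} [Field k] [AddCommGroup V] [Module k V] [AddCommGroup N] [Module k N]
  [AddCommMonoid W] [Module k W]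

theorem tensorAlgebra_tmul_induction {p : TensorAlgebra k V ⊗[k] N → Prop} (zero : p 0)
    (add : ∀ x y, p x → p y → p (x + y)) (base : ∀ n : N, p (1 ⊗ₜ[k] n))
    (cons : ∀ (v : V) (x : TensorAlgebra k V ⊗[k] N), p x → p (TensorAlgebra.ι k v • x)) (x : TensorAlgebra k V ⊗[k] N) : p x := by
  induction x with
  | zero => exact zero
  | add x y hx hy => exact add x y hx hy
  | tmul x n =>
    have : ∀ n : N, p (x ⊗ₜ n) := by
      refine TensorAlgebra.cons_induction (p := fun x => ∀ n : N, p (x ⊗ₜ n)) base ?_ ?_ ?_ x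
      · intro r x hx n
        rw [TensorProduct.smul_tmul]
        exact hx _
      · intro x y hx hy n
        rw [TensorProduct.add_tmul]
        exact add _ _ (hx n) (hy n)
      · intro v x hx n
        exact cons v _ (hx n)
    exact this n

/-- `v ↦ (x ↦ v x)` on `T(V) ⊗ N`. -/
noncomputable def cons (k V N : Type*) [Field k] [AddCommGroup V] [Module k V] [AddCommGroup N]
    [Module k N] : V →ₗ[k] TensorAlgebra k V ⊗[k] N →ₗ[k] TensorAlgebra k V ⊗[k] N :=
  LinearMap.mk₂ k (fun v x => TensorAlgebra.ι k v • x)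
    (fun v v' x => by rw [map_add, add_smul])
    (fun r v x => by rw [map_smul, smul_assoc])
    (fun v x x' => smul_add _ x x')
    (fun r v x => smul_comm _ r x)

theorem cons_apply (v : V) (x : TensorAlgebra k V ⊗[k] N) :
    cons k V N v x = TensorAlgebra.ι k v • x := rfl

theorem cons_tmul (v : V) (x : TensorAlgebra k V) (n : N) :
    TensorAlgebra.ι k v • (x ⊗ₜ[k] n) = (TensorAlgebra.ι k v * x) ⊗ₜ n := rfl

variable (b : N →ₗ[k] W) (f : V →ₗ[k] TensorAlgebra k V ⊗[k] N →ₗ[k] W)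
  (g : V →ₗ[k] W →ₗ[k] W)

/-- The recursion step `(x, y) ↦ (v x, f v x + g v y)`. -/
noncomputable def recursionStep : V →ₗ[k] Module.End k ((TensorAlgebra k V ⊗[k] N) × W) :=
  LinearMap.mk₂ k (fun v p => (cons k V N v p.1, f v p.1 + g v p.2))
    (fun v v' p => by simp only [map_add, LinearMap.add_apply, Prod.mk_add_mk]; congr 1; abel)
    (fun r v p => by simp only [map_smul, LinearMap.smul_apply, Prod.smul_mk, smul_add])
    (fun v p p' => by simp only [map_add, Prod.fst_add, Prod.snd_add, Prod.mk_add_mk]; congr 1; abel)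
    (fun r v p => by simp only [map_smul, Prod.smul_fst, Prod.smul_snd, Prod.smul_mk, smul_add])

/-- Structural recursion on `T(V) ⊗ N`, together with its argument. -/
noncomputable def recursionAux :
    TensorAlgebra k V ⊗[k] N →ₗ[k] (TensorAlgebra k V ⊗[k] N) × W :=
  TensorProduct.lift (LinearMap.mk₂ k
    (fun (x : TensorAlgebra k V) (n : N) => TensorAlgebra.lift k (recursionStep f g) x (1 ⊗ₜ n, b n))
    (fun x x' n => by rw [map_add, LinearMap.add_apply])
    (fun r x n => by rw [map_smul, LinearMap.smul_apply])
    (fun x n n' => by rw [TensorProduct.tmul_add, map_add, ← Prod.mk_add_mk, map_add])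
    (fun r x n => by rw [TensorProduct.tmul_smul, map_smul, ← Prod.smul_mk, map_smul]))

theorem recursionAux_base (n : N) : recursionAux b f g (1 ⊗ₜ n) = (1 ⊗ₜ n, b n) := by
  simp [recursionAux]

theorem recursionAux_cons (v : V) (x : TensorAlgebra k V ⊗[k] N) :
    recursionAux b f g (TensorAlgebra.ι k v • x) = recursionStep f g v (recursionAux b f g x) := by
  induction x with
  | zero => rw [smul_zero, map_zero, map_zero]
  | add x y hx hy => rw [smul_add, map_add, hx, hy, map_add, map_add]
  | tmul x n =>
    rw [cons_tmul, recursionAux, TensorProduct.lift.tmul, TensorProduct.lift.tmul,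
      LinearMap.mk₂_apply, LinearMap.mk₂_apply, map_mul, TensorAlgebra.lift_ι_apply]
    rfl

theorem recursionAux_fst (x : TensorAlgebra k V ⊗[k] N) : (recursionAux b f g x).1 = x := by
  refine tensorAlgebra_tmul_induction (p := fun x => (recursionAux b f g x).1 = x) ?_ ?_ ?_ ?_ x
  · rw [map_zero]; rfl
  · intro x y hx hy
    rw [map_add, Prod.fst_add, hx, hy]
  · intro n
    rw [recursionAux_base]
  · intro v x hx
    rw [recursionAux_cons, recursionStep, LinearMap.mk₂_apply, hx, cons_apply]

/-- Structural recursion on `T(V) ⊗ N`: the linear map `F` with `F (1 ⊗ n) = b n` and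
`F (v x) = f v x + g v (F x)`. -/
noncomputable def recursion : TensorAlgebra k V ⊗[k] N →ₗ[k] W :=
  LinearMap.snd k (TensorAlgebra k V ⊗[k] N) W ∘ₗ recursionAux b f g

theorem recursion_base (n : N) : recursion b f g (1 ⊗ₜ n) = b n := by
  rw [recursion, LinearMap.comp_apply, recursionAux_base]; rfl

theorem recursion_cons (v : V) (x : TensorAlgebra k V ⊗[k] N) :
    recursion b f g (TensorAlgebra.ι k v • x) = f v x + g v (recursion b f g x) := by
  rw [recursion, LinearMap.comp_apply, recursionAux_cons, recursionStep, LinearMap.mk₂_apply,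
    recursionAux_fst]
  rfl

end Recursion

/-! ### The bar complex with coefficients and the bar resolution -/

section Bar

variable {k A : Type*} [Field k] [Ring A] [Algebra k A] (𝒜 : ℕ → Submodule k A)
  [GradedAlgebra 𝒜]

/-- Multiplication of `A₊`. -/
noncomputable def mulPlus : Aplus 𝒜 →ₗ[k] Aplus 𝒜 →ₗ[k] Aplus 𝒜 :=
  LinearMap.mk₂ k (fun a b => ⟨a * b, mul_mem_Aplus 𝒜 a.2⟩)
    (fun a a' b => Subtype.ext (add_mul (a : A) a' b))
    (fun r a b => Subtype.ext (smul_mul_assoc r (a : A) b))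
    (fun a b b' => Subtype.ext (mul_add (a : A) b b'))
    (fun r a b => Subtype.ext (mul_smul_comm r (a : A) b))

theorem coe_mulPlus (a b : Aplus 𝒜) : (mulPlus 𝒜 a b : A) = a * b := rfl

theorem mulPlus_assoc (a b c : Aplus 𝒜) :
    mulPlus 𝒜 (mulPlus 𝒜 a b) c = mulPlus 𝒜 a (mulPlus 𝒜 b c) :=
  Subtype.ext (mul_assoc (a : A) b c)

variable {N : Type*} [AddCommGroup N] [Module k N] (act : Aplus 𝒜 →ₗ[k] N →ₗ[k] N)

/-- The tensor coalgebra of `A₊` with coefficients in `N`. -/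
abbrev Bar (N : Type*) [AddCommGroup N] [Module k N] : Type _ :=
  TensorAlgebra k (Aplus 𝒜) ⊗[k] N

/-- `(v, x, w) ↦ (w v) x`. -/
noncomputable def barMulStep (N : Type*) [AddCommGroup N] [Module k N] :
    Aplus 𝒜 →ₗ[k] Bar 𝒜 N →ₗ[k] Aplus 𝒜 →ₗ[k] Bar 𝒜 N where
  toFun v := (cons k (Aplus 𝒜) N ∘ₗ (mulPlus 𝒜).flip v).flip
  map_add' v v' := by
    refine LinearMap.ext fun x => LinearMap.ext fun w => ?_
    simp only [LinearMap.add_apply, LinearMap.flip_apply, LinearMap.comp_apply, map_add]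
  map_smul' r v := by
    refine LinearMap.ext fun x => LinearMap.ext fun w => ?_
    simp only [LinearMap.smul_apply, LinearMap.flip_apply, LinearMap.comp_apply, map_smul,
      RingHom.id_apply]

/-- `(v, x) ↦ μ_v x`, multiplication of the first letter by `v`: `μ_v (1 ⊗ n) = 1 ⊗ v n` and
`μ_v (w x) = (v w) x`. -/
noncomputable def barMul : Bar 𝒜 N →ₗ[k] Aplus 𝒜 →ₗ[k] Bar 𝒜 N :=
  recursion
    (LinearMap.mk₂ k (fun n w => (1 : TensorAlgebra k (Aplus 𝒜)) ⊗ₜ[k] act w n)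
      (fun n n' w => by rw [map_add, TensorProduct.tmul_add])
      (fun r n w => by rw [map_smul, TensorProduct.tmul_smul])
      (fun n w w' => by rw [map_add, LinearMap.add_apply, TensorProduct.tmul_add])
      (fun r n w => by rw [map_smul, LinearMap.smul_apply, TensorProduct.tmul_smul]))
    (barMulStep 𝒜 N) 0

theorem barMul_base (n : N) (w : Aplus 𝒜) : barMul 𝒜 act (1 ⊗ₜ n) w = 1 ⊗ₜ act w n := by
  rw [barMul, recursion_base]
  rfl

theorem barMul_cons (v : Aplus 𝒜) (x : Bar 𝒜 N) (w : Aplus 𝒜) :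
    barMul 𝒜 act (TensorAlgebra.ι k v • x) w = TensorAlgebra.ι k (mulPlus 𝒜 w v) • x := by
  rw [barMul, recursion_cons, LinearMap.zero_apply, LinearMap.zero_apply, add_zero]
  rfl

/-- The bar differential on `T(A₊) ⊗ N`: `d (1 ⊗ n) = 0` and `d (v x) = μ_v x - v d x`. -/
noncomputable def barD : Bar 𝒜 N →ₗ[k] Bar 𝒜 N :=
  recursion 0 (barMul 𝒜 act).flip ((-1 : k) • cons k (Aplus 𝒜) N)

theorem barD_base (n : N) : barD 𝒜 act (1 ⊗ₜ n) = 0 := by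
  rw [barD, recursion_base]
  rfl

theorem barD_cons (v : Aplus 𝒜) (x : Bar 𝒜 N) :
    barD 𝒜 act (TensorAlgebra.ι k v • x)
      = barMul 𝒜 act x v - TensorAlgebra.ι k v • barD 𝒜 act x := by
  rw [barD, recursion_cons, LinearMap.smul_apply, LinearMap.smul_apply, cons_apply, neg_one_smul,
    sub_eq_add_neg]
  rfl

theorem barMul_barMul (hact : ∀ a b n, act (mulPlus 𝒜 a b) n = act a (act b n))
    (a b : Aplus 𝒜) (x : Bar 𝒜 N) :
    barMul 𝒜 act (barMul 𝒜 act x b) a = barMul 𝒜 act x (mulPlus 𝒜 a b) := by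
  refine tensorAlgebra_tmul_induction (p := fun x => barMul 𝒜 act (barMul 𝒜 act x b) a
    = barMul 𝒜 act x (mulPlus 𝒜 a b)) ?_ ?_ ?_ ?_ x
  · simp
  · intro x y hx hy
    simp only [map_add, LinearMap.add_apply, hx, hy]
  · intro n
    simp only [barMul_base, hact]
  · intro v x _
    simp only [barMul_cons, mulPlus_assoc]

/-- By associativity, replacing the first letter v by av and differentiating gives μ_{av}x - (av)dx.
Multiplying the first letter of μ_v x - v dx by a gives the same element. -/
theorem barD_barMul (hact : ∀ a b n, act (mulPlus 𝒜 a b) n = act a (act b n))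
    (a : Aplus 𝒜) (x : Bar 𝒜 N) :
    barD 𝒜 act (barMul 𝒜 act x a) = barMul 𝒜 act (barD 𝒜 act x) a := by
  refine tensorAlgebra_tmul_induction (p := fun x => barD 𝒜 act (barMul 𝒜 act x a)
    = barMul 𝒜 act (barD 𝒜 act x) a) ?_ ?_ ?_ ?_ x
  · simp
  · intro x y hx hy
    simp only [map_add, LinearMap.add_apply, hx, hy]
  · intro n
    simp only [barMul_base, barD_base, map_zero, LinearMap.zero_apply]
  · intro v x _
    simp only [barMul_cons, barD_cons, map_sub, LinearMap.sub_apply, barMul_barMul 𝒜 act hact]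

/-- In d(μ_v x - v dx) the term d(μ_v x) = μ_v dx cancels the leading term of d(v dx), and v d²x
vanishes by induction. -/
theorem barD_barD (hact : ∀ a b n, act (mulPlus 𝒜 a b) n = act a (act b n))
    (x : Bar 𝒜 N) : barD 𝒜 act (barD 𝒜 act x) = 0 := by
  refine tensorAlgebra_tmul_induction (p := fun x => barD 𝒜 act (barD 𝒜 act x) = 0) ?_ ?_ ?_ ?_ x
  · simp
  · intro x y hx hy
    simp only [map_add, hx, hy, add_zero]
  · intro n
    simp only [barD_base, map_zero]
  · intro v x hx
    rw [barD_cons, map_sub, barD_cons, hx, barD_barMul 𝒜 act hact, smul_zero, sub_zero, sub_self]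

/-- The first letter, as an element of `A`: `1 ⊗ n ↦ 0` and `v x ↦ v ⊗ x`. -/
noncomputable def barFirst (N : Type*) [AddCommGroup N] [Module k N] :
    Bar 𝒜 N →ₗ[k] A ⊗[k] Bar 𝒜 N :=
  recursion 0 (TensorProduct.mk k A (Bar 𝒜 N) ∘ₗ (Aplus 𝒜).subtype) 0

theorem barFirst_base (n : N) : barFirst 𝒜 N (1 ⊗ₜ n) = 0 := by
  rw [barFirst, recursion_base]
  rfl

theorem barFirst_cons (v : Aplus 𝒜) (x : Bar 𝒜 N) :
    barFirst 𝒜 N (TensorAlgebra.ι k v • x) = (v : A) ⊗ₜ x := by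
  rw [barFirst, recursion_cons, LinearMap.zero_apply, LinearMap.zero_apply, add_zero]
  rfl

theorem barFirst_barMul (v : Aplus 𝒜) (x : Bar 𝒜 N) :
    barFirst 𝒜 N (barMul 𝒜 act x v) = (v : A) • barFirst 𝒜 N x := by
  refine tensorAlgebra_tmul_induction (p := fun x => barFirst 𝒜 N (barMul 𝒜 act x v)
    = (v : A) • barFirst 𝒜 N x) ?_ ?_ ?_ ?_ x
  · simp
  · intro x y hx hy
    simp only [map_add, LinearMap.add_apply, hx, hy, smul_add]
  · intro n
    simp only [barMul_base, barFirst_base, smul_zero]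
  · intro w x _
    simp only [barMul_cons, barFirst_cons, coe_mulPlus, TensorProduct.smul_tmul', smul_eq_mul]

/-- The differential `a ⊗ x ↦ a x₁ ⊗ x' - a ⊗ d x` (`x = x₁ x'`) of the bar resolution. -/
noncomputable def resD : A ⊗[k] Bar 𝒜 N →ₗ[k] A ⊗[k] Bar 𝒜 N :=
  TensorProduct.lift (LinearMap.mk₂ k (fun a x => a • barFirst 𝒜 N x - a ⊗ₜ barD 𝒜 act x)
    (fun a a' x => by rw [add_smul, TensorProduct.add_tmul]; abel)
    (fun r a x => by rw [smul_assoc, ← TensorProduct.smul_tmul', smul_sub])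
    (fun a x x' => by rw [map_add, map_add, smul_add, TensorProduct.tmul_add]; abel)
    (fun r a x => by rw [map_smul, map_smul, TensorProduct.tmul_smul, smul_sub, smul_comm]))

theorem resD_tmul (a : A) (x : Bar 𝒜 N) :
    resD 𝒜 act (a ⊗ₜ x) = a • barFirst 𝒜 N x - a ⊗ₜ barD 𝒜 act x := rfl

theorem resD_smul (a : A) (q : A ⊗[k] Bar 𝒜 N) : resD 𝒜 act (a • q) = a • resD 𝒜 act q := by
  induction q with
  | zero => simp
  | add x y hx hy => simp only [smul_add, map_add, hx, hy]
  | tmul b x =>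
    rw [TensorProduct.smul_tmul', resD_tmul, resD_tmul, smul_sub, TensorProduct.smul_tmul',
      smul_smul, smul_eq_mul]

/-- On a ⊗ vx the terms av·(first letter of x), av ⊗ dx and a ⊗ μ_v dx each occur twice, with
opposite signs. -/
theorem resD_resD (hact : ∀ a b n, act (mulPlus 𝒜 a b) n = act a (act b n))
    (q : A ⊗[k] Bar 𝒜 N) : resD 𝒜 act (resD 𝒜 act q) = 0 := by
  induction q with
  | zero => simp
  | add x y hx hy => simp only [map_add, hx, hy, add_zero]
  | tmul a x =>
    refine tensorAlgebra_tmul_induction (p := fun x => resD 𝒜 act (resD 𝒜 act (a ⊗ₜ x)) = 0)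
      ?_ ?_ ?_ ?_ x
    · simp
    · intro x y hx hy
      simp only [TensorProduct.tmul_add, map_add, hx, hy, add_zero]
    · intro n
      simp only [resD_tmul, barFirst_base, barD_base, smul_zero, TensorProduct.tmul_zero, sub_zero,
        map_zero]
    · intro v x _
      simp only [resD_tmul, map_sub, resD_smul, barFirst_cons, barD_cons, TensorProduct.tmul_sub,
        smul_sub, barFirst_barMul, barD_barMul 𝒜 act hact, barD_barD 𝒜 act hact, smul_zero]
      simp only [TensorProduct.smul_tmul', smul_eq_mul, TensorProduct.tmul_zero]
      abel

/-- The coefficient of the empty word. -/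
noncomputable def barZero (N : Type*) [AddCommGroup N] [Module k N] : Bar 𝒜 N →ₗ[k] N :=
  recursion LinearMap.id 0 0

theorem barZero_base (n : N) : barZero 𝒜 N (1 ⊗ₜ n) = n := by
  rw [barZero, recursion_base]
  rfl

theorem barZero_cons (v : Aplus 𝒜) (x : Bar 𝒜 N) :
    barZero 𝒜 N (TensorAlgebra.ι k v • x) = 0 := by
  rw [barZero, recursion_cons]
  simp

/-- The projection `A → A₊`. -/
noncomputable def toPlus : A →ₗ[k] Aplus 𝒜 :=
  LinearMap.codRestrict _ (LinearMap.id - GradedAlgebra.proj 𝒜 0) fun a => by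
    rw [Aplus, LinearMap.mem_ker]
    simp [GradedAlgebra.proj_apply, DirectSum.decompose_coe]

theorem coe_toPlus (a : A) : (toPlus 𝒜 a : A) = a - GradedAlgebra.proj 𝒜 0 a := rfl

theorem toPlus_coe (v : Aplus 𝒜) : toPlus 𝒜 v = v :=
  Subtype.ext (by rw [coe_toPlus, v.2, sub_zero])

theorem exists_algebraMap_add (h : 𝒜 0 = 1) (a : A) :
    ∃ r : k, a = algebraMap k A r + toPlus 𝒜 a := by
  have h0 : GradedAlgebra.proj 𝒜 0 a ∈ 𝒜 0 := by
    rw [GradedAlgebra.proj_apply]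
    exact Subtype.property _
  rw [h] at h0
  obtain ⟨r, hr⟩ := Submodule.mem_one.1 h0
  exact ⟨r, by rw [hr, coe_toPlus]; abel⟩

/-- The contracting homotopy `a ⊗ x ↦ 1 ⊗ ā x` of the bar resolution. -/
noncomputable def resH (N : Type*) [AddCommGroup N] [Module k N] :
    A ⊗[k] Bar 𝒜 N →ₗ[k] A ⊗[k] Bar 𝒜 N :=
  TensorProduct.mk k A (Bar 𝒜 N) 1 ∘ₗ TensorProduct.lift (cons k (Aplus 𝒜) N ∘ₗ toPlus 𝒜)

theorem resH_tmul (a : A) (x : Bar 𝒜 N) :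
    resH 𝒜 N (a ⊗ₜ x) = 1 ⊗ₜ (TensorAlgebra.ι k (toPlus 𝒜 a) • x) := rfl

/-- Away from the empty word the homotopy is exact. On the empty word, a ⊗ n should be replaced by 1
⊗ an. As N carries only an action of A₊, the scalar part of a and its part in A₊ appear as separate
corrections. -/
theorem resD_resH (h : 𝒜 0 = 1) (a : A) (x : Bar 𝒜 N) :
    resD 𝒜 act (resH 𝒜 N (a ⊗ₜ x)) + resH 𝒜 N (resD 𝒜 act (a ⊗ₜ x))
      = a ⊗ₜ x - algebraMap k A (Classical.choose (exists_algebraMap_add 𝒜 h a))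
          ⊗ₜ (1 ⊗ₜ barZero 𝒜 N x) - 1 ⊗ₜ (1 ⊗ₜ act (toPlus 𝒜 a) (barZero 𝒜 N x)) := by
  have hr := Classical.choose_spec (exists_algebraMap_add 𝒜 h a)
  generalize Classical.choose (exists_algebraMap_add 𝒜 h a) = r at hr ⊢
  refine tensorAlgebra_tmul_induction (p := fun x => resD 𝒜 act (resH 𝒜 N (a ⊗ₜ x))
      + resH 𝒜 N (resD 𝒜 act (a ⊗ₜ x)) = a ⊗ₜ x - algebraMap k A r
          ⊗ₜ (1 ⊗ₜ barZero 𝒜 N x) - 1 ⊗ₜ (1 ⊗ₜ act (toPlus 𝒜 a) (barZero 𝒜 N x))) ?_ ?_ ?_ ?_ x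
  · simp
  · intro x y hx hy
    simp only [TensorProduct.tmul_add, map_add]
    rw [add_add_add_comm, hx, hy]
    abel
  · intro n
    simp only [resH_tmul, resD_tmul, barFirst_base, barFirst_cons, barD_cons, barD_base,
      barMul_base, barZero_base, smul_zero, TensorProduct.tmul_zero, sub_zero, map_zero, add_zero,
      one_smul]
    nth_rewrite 3 [hr]
    rw [TensorProduct.add_tmul]
    abel
  · intro v x _
    -- Prefixing by a loses the scalar part r of a; the product av, which lies in A₊, restores it as
    -- r v.
    have hs : toPlus 𝒜 (a * v) = mulPlus 𝒜 (toPlus 𝒜 a) v + r • v := Subtype.ext (by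
      have h1 : a * v = ((mulPlus 𝒜 (toPlus 𝒜 a) v + r • v : Aplus 𝒜) : A) := by
        nth_rewrite 1 [hr]
        rw [add_mul, Submodule.coe_add, Submodule.coe_smul, coe_mulPlus, Algebra.smul_def]
        abel
      rw [h1, toPlus_coe])
    simp only [resH_tmul, resD_tmul, barFirst_cons, barD_cons, barMul_cons, barZero_cons,
      map_sub, TensorProduct.smul_tmul', smul_eq_mul, hs, map_add, map_smul, one_mul,
      TensorProduct.tmul_sub, add_smul, TensorProduct.tmul_add, map_zero, TensorProduct.tmul_zero,
      sub_zero]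
    have h1 : a ⊗ₜ[k] (TensorAlgebra.ι k v • x) = (1 : A) ⊗ₜ[k] ((r • TensorAlgebra.ι k v) • x)
        + (toPlus 𝒜 a : A) ⊗ₜ[k] (TensorAlgebra.ι k v • x) := by
      nth_rewrite 1 [hr]
      rw [TensorProduct.add_tmul, smul_assoc, Algebra.algebraMap_eq_smul_one,
        ← TensorProduct.smul_tmul' r (1 : A), TensorProduct.tmul_smul r (1 : A)]
    rw [h1, smul_sub, TensorProduct.tmul_sub]
    abel

end Bar
end Koszul


namespace Koszul

open scoped TensorProduct DirectSum
open MulOpposite AInfinity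

/-! ### Excess grading and exactness of the reduced bar complex -/

section ReducedBar

variable {k A : Type*} [Field k] [Ring A] [Algebra k A] (𝒜 : ℕ → Submodule k A)
  [GradedAlgebra 𝒜]

/-- The differential of the reduced bar complex `T(A₊)`. -/
noncomputable def cobar : TensorAlgebra k (Aplus 𝒜) →ₗ[k] TensorAlgebra k (Aplus 𝒜) :=
  (TensorProduct.rid k (TensorAlgebra k (Aplus 𝒜))).toLinearMap ∘ₗ barD 𝒜 (0 : _ →ₗ[k] k →ₗ[k] k) ∘ₗ
    (TensorProduct.rid k (TensorAlgebra k (Aplus 𝒜))).symm.toLinearMap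

/-- `(x, v) ↦ v x₁ x'`, multiplication of the first letter of `x = x₁ x'` by `v`. -/
noncomputable def cobarMul :
    TensorAlgebra k (Aplus 𝒜) →ₗ[k] Aplus 𝒜 →ₗ[k] TensorAlgebra k (Aplus 𝒜) :=
  LinearMap.compRight k (TensorProduct.rid k (TensorAlgebra k (Aplus 𝒜))).toLinearMap ∘ₗ
    barMul 𝒜 (0 : _ →ₗ[k] k →ₗ[k] k) ∘ₗ
    (TensorProduct.rid k (TensorAlgebra k (Aplus 𝒜))).symm.toLinearMap

theorem cobarMul_apply (x : TensorAlgebra k (Aplus 𝒜)) (v : Aplus 𝒜) :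
    cobarMul 𝒜 x v = TensorProduct.rid k (TensorAlgebra k (Aplus 𝒜))
      (barMul 𝒜 (0 : _ →ₗ[k] k →ₗ[k] k) (x ⊗ₜ 1) v) := rfl

theorem rid_smul (x : TensorAlgebra k (Aplus 𝒜)) (y : TensorAlgebra k (Aplus 𝒜) ⊗[k] k) :
    TensorProduct.rid k (TensorAlgebra k (Aplus 𝒜)) (x • y)
      = x * TensorProduct.rid k (TensorAlgebra k (Aplus 𝒜)) y := by
  induction y with
  | zero => simp
  | add y z hy hz => simp only [smul_add, map_add, hy, hz, mul_add]
  | tmul y r => simp [TensorProduct.smul_tmul']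

theorem cobarMul_one (v : Aplus 𝒜) : cobarMul 𝒜 1 v = 0 := by
  rw [cobarMul_apply, barMul_base]
  simp

theorem cobarMul_cons (v w : Aplus 𝒜) (x : TensorAlgebra k (Aplus 𝒜)) :
    cobarMul 𝒜 (TensorAlgebra.ι k v * x) w = TensorAlgebra.ι k (mulPlus 𝒜 w v) * x := by
  rw [cobarMul_apply, ← cons_tmul, barMul_cons, rid_smul]
  simp

theorem cobar_one : cobar 𝒜 1 = 0 := by
  rw [cobar, LinearMap.comp_apply, LinearMap.comp_apply, LinearEquiv.coe_coe, LinearEquiv.coe_coe,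
    TensorProduct.rid_symm_apply, barD_base, map_zero]

theorem cobar_cons (v : Aplus 𝒜) (x : TensorAlgebra k (Aplus 𝒜)) :
    cobar 𝒜 (TensorAlgebra.ι k v * x)
      = cobarMul 𝒜 x v - TensorAlgebra.ι k v * cobar 𝒜 x := by
  simp only [cobar, LinearMap.comp_apply, LinearEquiv.coe_coe, TensorProduct.rid_symm_apply]
  rw [← cons_tmul, barD_cons, map_sub, rid_smul]
  rfl

/-- Words of homogeneous letters, of excess (total degree minus length) `e`. -/
inductive ExcessWord : ℕ → TensorAlgebra k (Aplus 𝒜) → Prop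
  | one : ExcessWord 0 1
  | cons {m e : ℕ} (v : Aplus 𝒜) {x : TensorAlgebra k (Aplus 𝒜)} :
      (v : A) ∈ 𝒜 (m + 1) → ExcessWord e x → ExcessWord (m + e) (TensorAlgebra.ι k v * x)

/-- The part of `T(A₊)` of excess `e`. -/
def excess (e : ℕ) : Submodule k (TensorAlgebra k (Aplus 𝒜)) :=
  Submodule.span k {x | ExcessWord 𝒜 e x}

variable {𝒜} in
theorem ExcessWord.mem {e : ℕ} {x : TensorAlgebra k (Aplus 𝒜)} (h : ExcessWord 𝒜 e x) :
    x ∈ excess 𝒜 e := Submodule.subset_span h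

theorem mem_Aplus {m : ℕ} {a : A} (ha : a ∈ 𝒜 (m + 1)) : a ∈ Aplus 𝒜 := by
  rw [Aplus, LinearMap.mem_ker, GradedAlgebra.proj_apply,
    DirectSum.decompose_of_mem_ne 𝒜 ha (Nat.succ_ne_zero m)]

theorem Aplus_induction {p : Aplus 𝒜 → Prop} (h0 : p 0) (hadd : ∀ v w, p v → p w → p (v + w))
    (h : ∀ (m : ℕ) (v : Aplus 𝒜), (v : A) ∈ 𝒜 (m + 1) → p v) (v : Aplus 𝒜) : p v := by
  classical
  rw [← toPlus_coe 𝒜 v, ← DirectSum.sum_support_decompose 𝒜 (v : A), map_sum]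
  refine Finset.sum_induction _ p hadd h0 fun i _ => ?_
  rcases i with _ | m
  · convert h0
    refine Subtype.ext ?_
    rw [coe_toPlus, GradedAlgebra.proj_apply, DirectSum.decompose_coe, DirectSum.of_eq_same,
      sub_self]
    rfl
  · refine h m _ ?_
    have : (DirectSum.decompose 𝒜 (v : A) (m + 1) : A) ∈ 𝒜 (m + 1) := Subtype.property _
    have h1 := toPlus_coe 𝒜 ⟨_, mem_Aplus 𝒜 this⟩
    rw [h1]
    exact this

theorem homogeneous_induction {p : TensorAlgebra k (Aplus 𝒜) → Prop}
    (h0 : p 0) (hadd : ∀ x y, p x → p y → p (x + y)) (hsmul : ∀ (r : k) x, p x → p (r • x))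
    (h : ∀ e x, ExcessWord 𝒜 e x → p x) (x : TensorAlgebra k (Aplus 𝒜)) : p x := by
  have hx : x ∈ Submodule.span k {x | ∃ e, ExcessWord 𝒜 e x} := by
    refine TensorAlgebra.cons_induction (p := fun x => x ∈ Submodule.span k
      {x | ∃ e, ExcessWord 𝒜 e x}) (Submodule.subset_span ⟨0, .one⟩)
      (fun r x hx => Submodule.smul_mem _ r hx) (fun x y hx hy => add_mem hx hy) ?_ x
    intro v x hx
    refine Aplus_induction 𝒜 (p := fun v => TensorAlgebra.ι k v * x ∈ _) ?_ ?_ ?_ v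
    · simp
    · intro v w hv hw
      rw [map_add, add_mul]
      exact add_mem hv hw
    · intro m v hv
      induction hx using Submodule.span_induction with
      | mem x hx =>
        obtain ⟨e, hx⟩ := hx
        exact Submodule.subset_span ⟨_, .cons v hv hx⟩
      | zero => simp
      | add x y _ _ hx hy => rw [mul_add]; exact add_mem hx hy
      | smul r x _ hx => rw [mul_smul_comm]; exact Submodule.smul_mem _ _ hx
  induction hx using Submodule.span_induction with
  | mem x hx =>
    obtain ⟨e, hx⟩ := hx
    exact h e x hx
  | zero => exact h0
  | add x y _ _ hx hy => exact hadd _ _ hx hy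
  | smul r x _ hx => exact hsmul _ _ hx

theorem linearMap_ext_words {M : Type*} [AddCommGroup M] [Module k M]
    {f g : TensorAlgebra k (Aplus 𝒜) →ₗ[k] M} (h : ∀ e x, ExcessWord 𝒜 e x → f x = g x) : f = g :=
  LinearMap.ext fun x => homogeneous_induction 𝒜 (p := fun x => f x = g x) (by simp)
    (fun x y hx hy => by rw [map_add, map_add, hx, hy])
    (fun r x hx => by rw [map_smul, map_smul, hx]) h x

theorem cons_mem_excess {m e : ℕ} {v : Aplus 𝒜} (hv : (v : A) ∈ 𝒜 (m + 1))
    {x : TensorAlgebra k (Aplus 𝒜)} (hx : x ∈ excess 𝒜 e) :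
    TensorAlgebra.ι k v * x ∈ excess 𝒜 (m + e) := by
  induction hx using Submodule.span_induction with
  | mem x hx => exact (ExcessWord.cons v hv hx).mem
  | zero => simp
  | add x y _ _ hx hy => rw [mul_add]; exact add_mem hx hy
  | smul r x _ hx => rw [mul_smul_comm]; exact Submodule.smul_mem _ _ hx

theorem cobarMul_mem_excess {m e : ℕ} {v : Aplus 𝒜} (hv : (v : A) ∈ 𝒜 (m + 1))
    {x : TensorAlgebra k (Aplus 𝒜)} (hx : ExcessWord 𝒜 e x) :
    cobarMul 𝒜 x v ∈ excess 𝒜 (m + e + 1) := by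
  cases hx with
  | one => rw [cobarMul_one]; exact zero_mem _
  | @cons m' e w x hw hx =>
    rw [cobarMul_cons, show m + (m' + e) + 1 = (m + m' + 1) + e by ring]
    refine cons_mem_excess 𝒜 ?_ hx.mem
    have h := SetLike.GradedMul.mul_mem (A := 𝒜) hv hw
    rwa [show m + 1 + (m' + 1) = m + m' + 1 + 1 by ring] at h

/-- Merging two letters preserves the total degree and shortens the word by one. -/
theorem cobar_mem_excess {e : ℕ} {x : TensorAlgebra k (Aplus 𝒜)} (hx : ExcessWord 𝒜 e x) :
    cobar 𝒜 x ∈ excess 𝒜 (e + 1) := by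
  induction hx with
  | one => rw [cobar_one]; exact zero_mem _
  | @cons m e v x hv hx ih =>
    rw [cobar_cons]
    have h := cons_mem_excess 𝒜 hv ih
    rw [← add_assoc] at h
    exact Submodule.sub_mem _ (cobarMul_mem_excess 𝒜 hv hx) h

/-- The map `v ↦ ∑ₘ v_{m+1} X^m` on letters. -/
noncomputable def excessMap : Aplus 𝒜 →ₗ[k] Polynomial (TensorAlgebra k (Aplus 𝒜)) :=
  DirectSum.toModule k ℕ _ (fun i : ℕ => match i with
    | 0 => 0
    | m + 1 => (Polynomial.monomial m).restrictScalars k ∘ₗ TensorAlgebra.ι k ∘ₗ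
        Submodule.inclusion fun _ ha => mem_Aplus 𝒜 (m := m) ha) ∘ₗ
    (DirectSum.decomposeLinearEquiv 𝒜).toLinearMap ∘ₗ (Aplus 𝒜).subtype

theorem excessMap_of_mem {m : ℕ} {v : Aplus 𝒜} (hv : (v : A) ∈ 𝒜 (m + 1)) :
    excessMap 𝒜 v = Polynomial.monomial m (TensorAlgebra.ι k v) := by
  have h : DirectSum.decomposeLinearEquiv 𝒜 (v : A)
      = DirectSum.lof k ℕ (fun i => 𝒜 i) (m + 1) ⟨v, hv⟩ := DirectSum.decompose_of_mem 𝒜 hv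
  rw [excessMap, LinearMap.comp_apply, LinearMap.comp_apply, Submodule.subtype_apply,
    LinearEquiv.coe_coe, h, DirectSum.toModule_lof]
  rfl

/-- The projection of `T(A₊)` to the part of excess `e`. -/
noncomputable def excessProj (e : ℕ) :
    TensorAlgebra k (Aplus 𝒜) →ₗ[k] TensorAlgebra k (Aplus 𝒜) :=
  (Polynomial.lcoeff (TensorAlgebra k (Aplus 𝒜)) e).restrictScalars k ∘ₗ
    (TensorAlgebra.lift k (excessMap 𝒜)).toLinearMap

/-- Excess is additive under concatenation, so the exponent of X records it, and taking coefficients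
separates the excess components. -/
theorem lift_excessMap {e : ℕ} {x : TensorAlgebra k (Aplus 𝒜)} (hx : ExcessWord 𝒜 e x) :
    TensorAlgebra.lift k (excessMap 𝒜) x = Polynomial.monomial e x := by
  induction hx with
  | one => rw [map_one]; rfl
  | cons v hv hx ih =>
    rw [map_mul, TensorAlgebra.lift_ι_apply, excessMap_of_mem 𝒜 hv, ih,
      Polynomial.monomial_mul_monomial]

theorem excessProj_of_word {e e' : ℕ} {x : TensorAlgebra k (Aplus 𝒜)} (hx : ExcessWord 𝒜 e x) :
    excessProj 𝒜 e' x = if e = e' then x else 0 := by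
  rw [excessProj, LinearMap.comp_apply, AlgHom.toLinearMap_apply, lift_excessMap 𝒜 hx]
  exact Polynomial.coeff_monomial

theorem excessProj_of_mem {e e' : ℕ} {x : TensorAlgebra k (Aplus 𝒜)} (hx : x ∈ excess 𝒜 e) :
    excessProj 𝒜 e' x = if e = e' then x else 0 := by
  induction hx using Submodule.span_induction with
  | mem x hx => exact excessProj_of_word 𝒜 hx
  | zero => simp
  | add x y _ _ hx hy => rw [map_add, hx, hy]; split_ifs <;> simp
  | smul r x _ hx => rw [map_smul, hx]; split_ifs <;> simp

theorem cobar_excessProj (e : ℕ) (x : TensorAlgebra k (Aplus 𝒜)) :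
    excessProj 𝒜 (e + 1) (cobar 𝒜 x) = cobar 𝒜 (excessProj 𝒜 e x) := by
  refine LinearMap.congr_fun (f := excessProj 𝒜 (e + 1) ∘ₗ cobar 𝒜)
    (g := cobar 𝒜 ∘ₗ excessProj 𝒜 e) (linearMap_ext_words 𝒜 fun e' x hx => ?_) x
  rw [LinearMap.comp_apply, LinearMap.comp_apply, excessProj_of_word 𝒜 hx,
    excessProj_of_mem 𝒜 (cobar_mem_excess 𝒜 hx)]
  by_cases h : e' = e <;> simp [h]

theorem tprod_succ {V : Type*} [AddCommGroup V] [Module k V] {i : ℕ} (a : Fin (i + 1) → V) :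
    TensorAlgebra.tprod k V (i + 1) a
      = TensorAlgebra.ι k (a 0) * TensorAlgebra.tprod k V i (fun s => a s.succ) := by
  simp only [TensorAlgebra.tprod_apply, List.ofFn_succ, List.prod_cons]

theorem linearMap_ext_tprod {V M : Type*} [AddCommGroup V] [Module k V] [AddCommGroup M]
    [Module k M] {f g : TensorAlgebra k V →ₗ[k] M}
    (h : ∀ n a, f (TensorAlgebra.tprod k V n a) = g (TensorAlgebra.tprod k V n a)) : f = g := by
  refine LinearMap.ext fun x => ?_
  have hx : x ∈ Submodule.span k {x | ∃ n a, x = TensorAlgebra.tprod k V n a} := by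
    refine TensorAlgebra.cons_induction (p := fun x => x ∈ Submodule.span k
      {x | ∃ n a, x = TensorAlgebra.tprod k V n a}) (Submodule.subset_span ⟨0, Fin.elim0, by simp⟩)
      (fun r x hx => Submodule.smul_mem _ r hx) (fun x y hx hy => add_mem hx hy) ?_ x
    intro v x hx
    induction hx using Submodule.span_induction with
    | mem x hx =>
      obtain ⟨n, a, rfl⟩ := hx
      exact Submodule.subset_span ⟨n + 1, Fin.cons v a, by rw [tprod_succ]; simp⟩
    | zero => simp
    | add x y _ _ hx hy => rw [mul_add]; exact add_mem hx hy
    | smul r x _ hx => rw [mul_smul_comm]; exact Submodule.smul_mem _ _ hx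
  induction hx using Submodule.span_induction with
  | mem x hx =>
    obtain ⟨n, a, rfl⟩ := hx
    exact h n a
  | zero => simp
  | add x y _ _ hx hy => rw [map_add, map_add, hx, hy]
  | smul r x _ hx => rw [map_smul, map_smul, hx]

/-- A functional on `T(V)` from multilinear functionals in each degree. -/
theorem exists_functional {V : Type*} [AddCommGroup V] [Module k V]
    (ψ : ∀ n, MultilinearMap k (fun _ : Fin n => V) k) :
    ∃ f : TensorAlgebra k V →ₗ[k] k, ∀ n a, f (TensorAlgebra.tprod k V n a) = ψ n a := by
  refine ⟨DirectSum.toModule k ℕ k (fun n => PiTensorProduct.lift (ψ n)) ∘ₗ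
    (TensorAlgebra.toDirectSum (R := k) (M := V)).toLinearMap, fun n a => ?_⟩
  rw [LinearMap.comp_apply, AlgHom.toLinearMap_apply, TensorAlgebra.toDirectSum_tensorPower_tprod]
  exact (DirectSum.toModule_lof k n _).trans (PiTensorProduct.lift.tprod a)

/-- This matches the recursive differential with the alternating sum over merges. Up to an overall
sign, its transpose is therefore the differential `cobarD` by which Ext is defined. -/
theorem cobar_tprod : ∀ {i : ℕ} (a : Fin (i + 1) → Aplus 𝒜),
    cobar 𝒜 (TensorAlgebra.tprod k _ (i + 1) a)
      = ∑ s : Fin i, (-1 : k) ^ (s : ℕ) • TensorAlgebra.tprod k _ i (merge 𝒜 s a)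
  | 0, a => by
    rw [tprod_succ, cobar_cons]
    simp [cobar_one, cobarMul_one]
  | i + 1, a => by
    rw [tprod_succ, cobar_cons, cobar_tprod, Fin.sum_univ_succ, tprod_succ, cobarMul_cons,
      Finset.mul_sum, sub_eq_add_neg, ← Finset.sum_neg_distrib]
    congr 1
    · rw [Fin.val_zero, pow_zero, one_smul, tprod_succ]
      rfl
    · refine Finset.sum_congr rfl fun s _ => ?_
      rw [Fin.val_succ, pow_succ, mul_neg_one, neg_smul, tprod_succ, mul_smul_comm]
      congr 4
      funext t
      simp only [merge, Fin.succ_lt_succ_iff, Fin.succ_inj]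
      rfl

theorem excessWord_tprod : ∀ {i : ℕ} (a : Fin i → Aplus 𝒜) (m : Fin i → ℕ),
    (∀ s, (a s : A) ∈ 𝒜 (m s + 1)) → ExcessWord 𝒜 (∑ s, m s) (TensorAlgebra.tprod k _ i a)
  | 0, a, m, _ => by simpa using ExcessWord.one (𝒜 := 𝒜)
  | i + 1, a, m, h => by
    rw [tprod_succ, Fin.sum_univ_succ]
    exact .cons _ (h 0) (excessWord_tprod _ _ fun s => h s.succ)

/-- The bar complex of a Koszul algebra is exact in positive excess. -/
theorem cobar_exact (hA : IsKoszul 𝒜) {e : ℕ} (he : 0 < e) {x : TensorAlgebra k (Aplus 𝒜)}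
    (hx : cobar 𝒜 x = 0) : ∃ y, cobar 𝒜 y = excessProj 𝒜 e x := by
  by_contra hne
  -- Ext speaks of cochains, so exactness is transferred by duality: a functional f separates the
  -- supposed non-boundary from all boundaries. No finiteness of dimension is needed.
  obtain ⟨f, hf, hfd⟩ := Submodule.exists_le_ker_of_notMem (K := k)
    (p := LinearMap.range (cobar 𝒜)) (v := excessProj 𝒜 e x) (fun ⟨y, hy⟩ => hne ⟨y, hy⟩)
  have hfd' : ∀ y, f (cobar 𝒜 y) = 0 := fun y => hfd ⟨y, rfl⟩
  let φ : ∀ i, MultilinearMap k (fun _ : Fin i => Aplus 𝒜) k := fun i =>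
    (f ∘ₗ excessProj 𝒜 e).compMultilinearMap (TensorAlgebra.tprod k (Aplus 𝒜) i)
  have hcochain : ∀ i, IsCochain 𝒜 i (i + e) (φ i) := by
    intro i a m hm hsum
    -- A letter of A₊ that is homogeneous of degree 0 is zero. Otherwise the word has excess equal
    -- to its total degree minus i, which differs from e.
    by_cases h0 : ∃ s, m s = 0
    · obtain ⟨s, hs⟩ := h0
      have h1 : a s = 0 := by
        refine Subtype.ext ?_
        have h2 : GradedAlgebra.proj 𝒜 0 (a s : A) = a s := by
          rw [GradedAlgebra.proj_apply, DirectSum.decompose_of_mem_same 𝒜 (hs ▸ hm s)]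
        exact h2.symm.trans (a s).2
      exact (φ i).map_coord_zero s h1
    · push Not at h0
      have hw := excessWord_tprod 𝒜 a (fun s => m s - 1) (fun s => by
        rw [Nat.sub_add_cancel (Nat.pos_of_ne_zero (h0 s))]
        exact hm s)
      change f (excessProj 𝒜 e (TensorAlgebra.tprod k (Aplus 𝒜) i a)) = 0
      rw [excessProj_of_word 𝒜 hw, if_neg, map_zero]
      intro hsum'
      apply hsum
      rw [← hsum']
      calc ∑ s, m s = ∑ s : Fin i, (1 + (m s - 1)) := Finset.sum_congr rfl fun s _ => by
            have := Nat.pos_of_ne_zero (h0 s); omega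
        _ = _ := by rw [Finset.sum_add_distrib]; simp
  have hcobar : ∀ (F : TensorAlgebra k (Aplus 𝒜) →ₗ[k] k) i (a : Fin (i + 1) → Aplus 𝒜)
      (ψ : MultilinearMap k (fun _ : Fin i => Aplus 𝒜) k),
      (∀ a, F (TensorAlgebra.tprod k (Aplus 𝒜) i a) = ψ a) →
      cobarD 𝒜 ψ a = -F (cobar 𝒜 (TensorAlgebra.tprod k (Aplus 𝒜) (i + 1) a)) := by
    intro F i a ψ h
    rw [cobar_tprod, map_sum, cobarD, ← Finset.sum_neg_distrib]
    refine Finset.sum_congr rfl fun s _ => ?_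
    rw [map_smul, h, pow_succ, smul_eq_mul]
    ring
  -- Projecting a boundary to excess e ≥ 1 gives the boundary of a component of excess e - 1, which
  -- f kills.
  have hclosed : ∀ i (a : Fin (i + 1) → Aplus 𝒜), cobarD 𝒜 (φ i) a = 0 := by
    intro i a
    rw [hcobar (f ∘ₗ excessProj 𝒜 e) i a (φ i) fun _ => rfl, LinearMap.comp_apply]
    obtain ⟨e, rfl⟩ := Nat.exists_eq_succ_of_ne_zero he.ne'
    rw [Nat.succ_eq_add_one, cobar_excessProj, hfd', neg_zero]
  -- The cocycle has bidegree (i + 1, i + 1 + e), which is off the diagonal because e > 0.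
  have hex : ∀ i, ∃ ψ : MultilinearMap k (fun _ : Fin i => Aplus 𝒜) k,
      ∀ a, φ (i + 1) a = cobarD 𝒜 ψ a := by
    intro i
    obtain ⟨ψ, _, h⟩ := hA.ext_eq_zero (i + 1) (i + 1 + e) (by omega) (φ (i + 1))
      (hcochain (i + 1)) (hclosed (i + 1))
    exact ⟨ψ, h⟩
  choose ψ hψ using hex
  obtain ⟨F, hF⟩ := exists_functional ψ
  -- The cochains ψ in the different lengths are collected into one functional F. On the empty word
  -- both sides vanish, as its excess is 0. The identity forces f to vanish on the excess component
  -- of the cycle x, a contradiction.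
  have key : f ∘ₗ excessProj 𝒜 e = -(F ∘ₗ cobar 𝒜) := by
    refine linearMap_ext_tprod fun i a => ?_
    rcases i with _ | i
    · have h1 : TensorAlgebra.tprod k (Aplus 𝒜) 0 a = 1 := by simp
      rw [h1, LinearMap.comp_apply, excessProj_of_word 𝒜 .one, if_neg he.ne, map_zero,
        LinearMap.neg_apply, LinearMap.comp_apply, cobar_one, map_zero, neg_zero]
    · rw [LinearMap.neg_apply, LinearMap.comp_apply, LinearMap.comp_apply, ← hcobar F i a (ψ i) (hF i),
        ← hψ]
      rfl
  have := LinearMap.congr_fun key x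
  rw [LinearMap.comp_apply, LinearMap.neg_apply, LinearMap.comp_apply, hx, map_zero, neg_zero] at this
  exact hf this

end ReducedBar
end Koszul


namespace Koszul

open scoped TensorProduct DirectSum
open MulOpposite AInfinity

/-! ### Generation in degree one -/

section Generation

variable {k A : Type*} [Field k] [Ring A] [Algebra k A] (𝒜 : ℕ → Submodule k A)

theorem π_eq_toA (p : ℕ) (z : ⨂[k]^p (𝒜 1)) :
    π 𝒜 p z = toA 𝒜 (TensorPower.toTensorAlgebra z) := by
  refine LinearMap.congr_fun (g := (toA 𝒜).toLinearMap ∘ₗ TensorPower.toTensorAlgebra)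
    (PiTensorProduct.ext (MultilinearMap.ext fun a => ?_)) z
  simp only [LinearMap.compMultilinearMap_apply, LinearMap.comp_apply, π,
    PiTensorProduct.lift.tprod, TensorPower.toTensorAlgebra_tprod, AlgHom.toLinearMap_apply]
  rw [TensorAlgebra.tprod_apply, map_list_prod, List.map_ofFn]
  rw [MultilinearMap.compLinearMap_apply, MultilinearMap.mkPiAlgebraFin_apply]
  congr 2
  funext i
  simp [toA]

variable [GradedAlgebra 𝒜]

theorem range_π_le (p : ℕ) : LinearMap.range (π 𝒜 p) ≤ 𝒜 p := by
  rw [LinearMap.range_eq_map, ← PiTensorProduct.span_tprod_eq_top, Submodule.map_span,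
    Submodule.span_le]
  rintro _ ⟨_, ⟨a, rfl⟩, rfl⟩
  rw [π, PiTensorProduct.lift.tprod, MultilinearMap.compLinearMap_apply,
    MultilinearMap.mkPiAlgebraFin_apply]
  have := SetLike.list_prod_ofFn_mem_graded (A := 𝒜) (fun _ : Fin p => 1)
    (fun i => (a i : A)) (fun i => (a i).2)
  simpa using this

theorem pow_le_range_π (p : ℕ) : 𝒜 1 ^ p ≤ LinearMap.range (π 𝒜 p) := by
  have h : 𝒜 1 = Submodule.map (toA 𝒜).toLinearMap (LinearMap.range (TensorAlgebra.ι k)) := by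
    rw [← LinearMap.range_comp]
    ext a
    constructor
    · intro ha
      exact ⟨⟨a, ha⟩, by simp [toA]⟩
    · rintro ⟨v, rfl⟩
      simp [toA]
  conv_lhs => rw [h]
  rw [← Submodule.map_pow]
  rintro _ ⟨x, hx, rfl⟩
  obtain ⟨z, rfl⟩ := tpow_le_range k (𝒜 1) p hx
  exact ⟨z, π_eq_toA 𝒜 p z⟩

theorem ιInv_ι_mul {k V : Type*} [Field k] [AddCommGroup V] [Module k V] (v : V)
    (x : TensorAlgebra k V) : TensorAlgebra.ιInv (TensorAlgebra.ι k v * x)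
      = TensorAlgebra.algebraMapInv x • v := by
  let _ : Module kᵐᵒᵖ V := Module.compHom _ ((RingHom.id k).fromOpposite mul_comm)
  have : IsCentralScalar k V := ⟨fun r m => rfl⟩
  have h : ∀ x : TensorAlgebra k V, (TensorAlgebra.toTrivSqZeroExt x).fst
      = TensorAlgebra.algebraMapInv (R := k) x := fun x => by
    refine AlgHom.congr_fun (φ₁ := (TrivSqZeroExt.fstHom k k V).comp TensorAlgebra.toTrivSqZeroExt)
      (TensorAlgebra.hom_ext (LinearMap.ext fun v => ?_)) x
    simp [TensorAlgebra.algebraMapInv]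
  have h1 := h x
  simp [TensorAlgebra.ιInv, h]

theorem algebraMapInv_cobarMul (v : Aplus 𝒜) (x : TensorAlgebra k (Aplus 𝒜)) :
    TensorAlgebra.algebraMapInv (R := k) (cobarMul 𝒜 x v) = 0 := by
  refine TensorAlgebra.cons_induction (p := fun x =>
    TensorAlgebra.algebraMapInv (R := k) (cobarMul 𝒜 x v) = 0) ?_ ?_ ?_ ?_ x
  · rw [cobarMul_one, map_zero]
  · intro r x hx
    rw [map_smul, LinearMap.smul_apply, map_smul, hx, smul_zero]
  · intro x y hx hy
    rw [map_add, LinearMap.add_apply, map_add, hx, hy, add_zero]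
  · intro w x _
    rw [cobarMul_cons]
    simp [TensorAlgebra.algebraMapInv]

theorem algebraMapInv_cobar (x : TensorAlgebra k (Aplus 𝒜)) :
    TensorAlgebra.algebraMapInv (R := k) (cobar 𝒜 x) = 0 := by
  refine TensorAlgebra.cons_induction (p := fun x =>
    TensorAlgebra.algebraMapInv (R := k) (cobar 𝒜 x) = 0) ?_ ?_ ?_ ?_ x
  · rw [cobar_one, map_zero]
  · intro r x hx
    rw [map_smul, map_smul, hx, smul_zero]
  · intro x y hx hy
    rw [map_add, map_add, hx, hy, add_zero]
  · intro w x _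
    rw [cobar_cons, map_sub, algebraMapInv_cobarMul]
    simp [TensorAlgebra.algebraMapInv]

theorem ιInv_cobarMul_mem (v : Aplus 𝒜) (x : TensorAlgebra k (Aplus 𝒜)) :
    ((TensorAlgebra.ιInv (cobarMul 𝒜 x v) : Aplus 𝒜) : A) ∈ Aplus 𝒜 * Aplus 𝒜 := by
  refine TensorAlgebra.cons_induction (p := fun x =>
    ((TensorAlgebra.ιInv (cobarMul 𝒜 x v) : Aplus 𝒜) : A) ∈ Aplus 𝒜 * Aplus 𝒜) ?_ ?_ ?_ ?_ x
  · rw [cobarMul_one, map_zero]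
    exact zero_mem _
  · intro r x hx
    rw [map_smul, LinearMap.smul_apply, map_smul]
    exact Submodule.smul_mem _ r hx
  · intro x y hx hy
    rw [map_add, LinearMap.add_apply, map_add]
    exact add_mem hx hy
  · intro w x _
    rw [cobarMul_cons, ιInv_ι_mul]
    exact Submodule.smul_mem _ _ (Submodule.mul_mem_mul v.2 w.2)

/-- A one-letter term of a boundary can only come from merging two letters. The other term v·d x
contributes nothing of length one, because d x has no constant term. -/
theorem ιInv_cobar_mem (x : TensorAlgebra k (Aplus 𝒜)) :
    ((TensorAlgebra.ιInv (cobar 𝒜 x) : Aplus 𝒜) : A) ∈ Aplus 𝒜 * Aplus 𝒜 := by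
  refine TensorAlgebra.cons_induction (p := fun x =>
    ((TensorAlgebra.ιInv (cobar 𝒜 x) : Aplus 𝒜) : A) ∈ Aplus 𝒜 * Aplus 𝒜) ?_ ?_ ?_ ?_ x
  · rw [cobar_one, map_zero]
    exact zero_mem _
  · intro r x hx
    rw [map_smul, map_smul]
    exact Submodule.smul_mem _ r hx
  · intro x y hx hy
    rw [map_add, map_add]
    exact add_mem hx hy
  · intro w x _
    rw [cobar_cons, map_sub, ιInv_ι_mul, algebraMapInv_cobar, zero_smul, sub_zero]
    exact ιInv_cobarMul_mem 𝒜 w x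

theorem cobar_ι (v : Aplus 𝒜) : cobar 𝒜 (TensorAlgebra.ι k v) = 0 := by
  rw [← mul_one (TensorAlgebra.ι k v), cobar_cons, cobarMul_one, cobar_one, mul_zero, sub_zero]

/-- A Koszul algebra is generated in degree one. -/
theorem le_pow (hA : IsKoszul 𝒜) (p : ℕ) : 𝒜 p ≤ 𝒜 1 ^ p := by
  induction p using Nat.strong_induction_on with
  | _ p ih =>
    rcases p with _ | _ | p
    · rw [pow_zero, hA.connected]
    · rw [zero_add, pow_one]
    · intro a ha
      have hw : ExcessWord 𝒜 (p + 1) (TensorAlgebra.ι k ⟨a, mem_Aplus 𝒜 ha⟩) := by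
        have := ExcessWord.cons (𝒜 := 𝒜) ⟨a, mem_Aplus 𝒜 ha⟩ ha .one
        rwa [mul_one, add_zero] at this
      -- A single letter is a cycle; in degree p + 2 its excess is p + 1 > 0, so it is a boundary.
      obtain ⟨y, hy⟩ := cobar_exact 𝒜 hA (Nat.succ_pos p) (cobar_ι 𝒜 ⟨a, mem_Aplus 𝒜 ha⟩)
      rw [Nat.succ_eq_add_one, excessProj_of_word 𝒜 hw, if_pos rfl] at hy
      have h1 : a ∈ Aplus 𝒜 * Aplus 𝒜 := by
        have h1 := ιInv_cobar_mem 𝒜 y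
        rwa [hy, show TensorAlgebra.ιInv (TensorAlgebra.ι k _) = _ from
          TensorAlgebra.ι_leftInverse _] at h1
      -- In degree p + 2 only products of factors of positive degrees adding up to p + 2 survive.
      -- Both degrees are smaller than p + 2, so induction applies.
      have h2 : ∀ z ∈ Aplus 𝒜 * Aplus 𝒜, GradedAlgebra.proj 𝒜 (p + 2) z ∈ 𝒜 1 ^ (p + 2) := by
        intro z hz
        induction hz using Submodule.mul_induction_on' with
        | add x _ y _ hx hy => rw [map_add]; exact add_mem hx hy
        | mem_mul_mem b hb c hc =>
          refine Aplus_induction 𝒜 (p := fun b => GradedAlgebra.proj 𝒜 (p + 2) ((b : A) * c)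
            ∈ 𝒜 1 ^ (p + 2)) ?_ ?_ ?_ ⟨b, hb⟩
          · simp
          · intro v w hv hw
            rw [Submodule.coe_add, add_mul, map_add]
            exact add_mem hv hw
          intro i b hb
          refine Aplus_induction 𝒜 (p := fun c => GradedAlgebra.proj 𝒜 (p + 2) ((b : A) * c)
            ∈ 𝒜 1 ^ (p + 2)) ?_ ?_ ?_ ⟨c, hc⟩
          · simp
          · intro v w hv hw
            rw [Submodule.coe_add, mul_add, map_add]
            exact add_mem hv hw
          intro j c hc
          have hbc := SetLike.GradedMul.mul_mem (A := 𝒜) hb hc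
          rw [GradedAlgebra.proj_apply]
          by_cases h : i + 1 + (j + 1) = p + 2
          · rw [h] at hbc
            rw [DirectSum.decompose_of_mem_same 𝒜 hbc, ← h, pow_add]
            exact Submodule.mul_mem_mul (ih _ (by omega) hb) (ih _ (by omega) hc)
          · rw [DirectSum.decompose_of_mem_ne 𝒜 hbc h]
            exact zero_mem _
      have h3 := h2 a h1
      rwa [GradedAlgebra.proj_apply, DirectSum.decompose_of_mem_same 𝒜 ha] at h3

theorem range_π (hA : IsKoszul 𝒜) (p : ℕ) : LinearMap.range (π 𝒜 p) = 𝒜 p :=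
  le_antisymm (range_π_le 𝒜 p) ((le_pow 𝒜 hA p).trans (pow_le_range_π 𝒜 p))

end Generation
end Koszul


/-! ### The Koszul coalgebra as the cycles of excess zero -/

namespace Koszul

open scoped TensorProduct DirectSum
open MulOpposite AInfinity

theorem exists_lTensor_of_eq_zero {k M N Q : Type*} [Field k] [AddCommGroup M] [Module k M]
    [AddCommGroup N] [Module k N] [AddCommGroup Q] [Module k Q] (f : N →ₗ[k] Q) {z : M ⊗[k] N}
    (h : f.lTensor M z = 0) : ∃ z', f.ker.subtype.lTensor M z' = z :=
  (Module.Flat.lTensor_exact M (LinearMap.exact_subtype_ker_map f) z).1 h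

theorem exists_rTensor_of_eq_zero {k M N Q : Type*} [Field k] [AddCommGroup M] [Module k M]
    [AddCommGroup N] [Module k N] [AddCommGroup Q] [Module k Q] (f : N →ₗ[k] Q) {z : N ⊗[k] M}
    (h : f.rTensor M z = 0) : ∃ z', f.ker.subtype.rTensor M z' = z :=
  (Module.Flat.rTensor_exact M (LinearMap.exact_subtype_ker_map f) z).1 h

section DiagonalSubcoalgebra

variable {k A : Type*} [Field k] [Ring A] [Algebra k A] (𝒜 : ℕ → Submodule k A)
  [GradedAlgebra 𝒜]

/-- `A₁ → A₊`. -/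
noncomputable def onePlus : 𝒜 1 →ₗ[k] Aplus 𝒜 :=
  Submodule.inclusion fun _ ha => mem_Aplus 𝒜 (m := 0) ha

theorem coe_onePlus (v : 𝒜 1) : (onePlus 𝒜 v : A) = v := rfl

/-- The projection `A → A₁`. -/
noncomputable def projOne : A →ₗ[k] 𝒜 1 :=
  DirectSum.component k ℕ (fun i => 𝒜 i) 1 ∘ₗ (DirectSum.decomposeLinearEquiv 𝒜).toLinearMap

theorem projOne_coe (v : 𝒜 1) : projOne 𝒜 v = v :=
  Subtype.ext (DirectSum.decompose_of_mem_same 𝒜 v.2)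

theorem projOne_of_mem_ne {i : ℕ} {a : A} (ha : a ∈ 𝒜 i) (h : i ≠ 1) : projOne 𝒜 a = 0 :=
  Subtype.ext (DirectSum.decompose_of_mem_ne 𝒜 ha h)

/-- The inclusion `T(A₁) → T(A₊)`. -/
noncomputable def words : TensorAlgebra k (𝒜 1) →ₐ[k] TensorAlgebra k (Aplus 𝒜) :=
  TensorAlgebra.lift k (TensorAlgebra.ι k ∘ₗ onePlus 𝒜)

/-- The projection `T(A₊) → T(A₁)`. -/
noncomputable def wordsProj : TensorAlgebra k (Aplus 𝒜) →ₐ[k] TensorAlgebra k (𝒜 1) :=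
  TensorAlgebra.lift k (TensorAlgebra.ι k ∘ₗ projOne 𝒜 ∘ₗ (Aplus 𝒜).subtype)

theorem words_ι (v : 𝒜 1) :
    words 𝒜 (TensorAlgebra.ι k v) = TensorAlgebra.ι k (onePlus 𝒜 v) := by simp [words]

theorem wordsProj_ι (v : Aplus 𝒜) :
    wordsProj 𝒜 (TensorAlgebra.ι k v) = TensorAlgebra.ι k (projOne 𝒜 v) := by simp [wordsProj]

theorem words_mul (v : 𝒜 1) (x : TensorAlgebra k (𝒜 1)) :
    words 𝒜 (TensorAlgebra.ι k v * x) = TensorAlgebra.ι k (onePlus 𝒜 v) * words 𝒜 x := by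
  rw [map_mul, words_ι]

theorem wordsProj_words (x : TensorAlgebra k (𝒜 1)) : wordsProj 𝒜 (words 𝒜 x) = x := by
  refine AlgHom.congr_fun (φ₁ := (wordsProj 𝒜).comp (words 𝒜)) (φ₂ := AlgHom.id k _)
    (TensorAlgebra.hom_ext (LinearMap.ext fun v => ?_)) x
  simp [words_ι, wordsProj_ι, coe_onePlus, projOne_coe]

theorem words_injective : Function.Injective (words 𝒜) :=
  Function.LeftInverse.injective (wordsProj_words 𝒜)

theorem words_wordsProj_of_word {e : ℕ} {x : TensorAlgebra k (Aplus 𝒜)} (hx : ExcessWord 𝒜 e x) :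
    words 𝒜 (wordsProj 𝒜 x) = if e = 0 then x else 0 := by
  induction hx with
  | one => simp
  | @cons m e v x hv hx ih =>
    rw [map_mul, map_mul, ih, wordsProj_ι, words_ι]
    rcases m with _ | m
    · have : onePlus 𝒜 (projOne 𝒜 v) = v := Subtype.ext
        (DirectSum.decompose_of_mem_same 𝒜 hv)
      rw [this]
      by_cases h : e = 0 <;> simp [h]
    · rw [projOne_of_mem_ne 𝒜 hv (by omega)]
      simp

theorem words_wordsProj (x : TensorAlgebra k (Aplus 𝒜)) :
    words 𝒜 (wordsProj 𝒜 x) = excessProj 𝒜 0 x :=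
  LinearMap.congr_fun (f := (words 𝒜).toLinearMap ∘ₗ (wordsProj 𝒜).toLinearMap)
    (linearMap_ext_words 𝒜 fun e x hx => by
      rw [excessProj_of_word 𝒜 hx]
      exact words_wordsProj_of_word 𝒜 hx) x

theorem words_mem_excess (x : TensorAlgebra k (𝒜 1)) : words 𝒜 x ∈ excess 𝒜 0 := by
  refine TensorAlgebra.cons_induction (p := fun x => words 𝒜 x ∈ excess 𝒜 0) ?_ ?_ ?_ ?_ x
  · rw [map_one]; exact ExcessWord.one.mem
  · intro r x hx; rw [map_smul]; exact Submodule.smul_mem _ r hx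
  · intro x y hx hy; rw [map_add]; exact add_mem hx hy
  · intro v x hx
    rw [words_mul]
    exact cons_mem_excess 𝒜 (m := 0) (e := 0) v.2 hx

/-- `v₁ v₂ x ↦ (v₁ v₂) x`. -/
noncomputable def mergeFirst : TensorAlgebra k (Aplus 𝒜) →ₗ[k] TensorAlgebra k (Aplus 𝒜) :=
  recursion 0 ((cobarMul 𝒜).flip.compl₂
    (TensorProduct.rid k (TensorAlgebra k (Aplus 𝒜))).toLinearMap) 0 ∘ₗ
    (TensorProduct.rid k (TensorAlgebra k (Aplus 𝒜))).symm.toLinearMap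

theorem mergeFirst_one : mergeFirst 𝒜 1 = 0 := by
  rw [mergeFirst, LinearMap.comp_apply, LinearEquiv.coe_coe, TensorProduct.rid_symm_apply,
    recursion_base]
  rfl

theorem mergeFirst_cons (v : Aplus 𝒜) (x : TensorAlgebra k (Aplus 𝒜)) :
    mergeFirst 𝒜 (TensorAlgebra.ι k v * x) = cobarMul 𝒜 x v := by
  rw [mergeFirst, LinearMap.comp_apply, LinearEquiv.coe_coe, TensorProduct.rid_symm_apply,
    ← cons_tmul, recursion_cons]
  simp

/-- The first letter: `v x ↦ v ⊗ x`. -/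
noncomputable def firstLetter : TensorAlgebra k (Aplus 𝒜) →ₗ[k] A ⊗[k] TensorAlgebra k (Aplus 𝒜) :=
  (TensorProduct.rid k (TensorAlgebra k (Aplus 𝒜))).toLinearMap.lTensor A ∘ₗ barFirst 𝒜 k ∘ₗ
    (TensorProduct.rid k (TensorAlgebra k (Aplus 𝒜))).symm.toLinearMap

theorem firstLetter_one : firstLetter 𝒜 1 = 0 := by
  rw [firstLetter, LinearMap.comp_apply, LinearMap.comp_apply, LinearEquiv.coe_coe,
    TensorProduct.rid_symm_apply, barFirst_base, map_zero]

theorem firstLetter_cons (v : Aplus 𝒜) (x : TensorAlgebra k (Aplus 𝒜)) :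
    firstLetter 𝒜 (TensorAlgebra.ι k v * x) = (v : A) ⊗ₜ x := by
  rw [firstLetter, LinearMap.comp_apply, LinearMap.comp_apply, LinearEquiv.coe_coe,
    TensorProduct.rid_symm_apply, ← cons_tmul, barFirst_cons]
  simp

theorem cobar_words_cons (v : 𝒜 1) (x : TensorAlgebra k (𝒜 1)) :
    cobar 𝒜 (words 𝒜 (TensorAlgebra.ι k v * x)) = mergeFirst 𝒜 (words 𝒜 (TensorAlgebra.ι k v * x))
      - TensorAlgebra.ι k (onePlus 𝒜 v) * cobar 𝒜 (words 𝒜 x) := by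
  rw [words_mul, cobar_cons, mergeFirst_cons]

theorem toA_mem_of_mem_tpow (n : ℕ) : ∀ {r : TensorAlgebra k (𝒜 1)}, r ∈ tpow k (𝒜 1) n →
    toA 𝒜 r ∈ 𝒜 n := by
  induction n with
  | zero =>
    intro r hr
    rw [tpow, pow_zero] at hr
    obtain ⟨c, rfl⟩ := Submodule.mem_one.1 hr
    rw [AlgHom.commutes]
    exact SetLike.algebraMap_mem_graded 𝒜 c
  | succ n ih =>
    intro r hr
    rw [tpow, pow_succ] at hr
    induction hr using Submodule.mul_induction_on' with
    | mem_mul_mem x hx y hy =>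
      obtain ⟨v, rfl⟩ := hy
      rw [map_mul]
      refine SetLike.GradedMul.mul_mem (A := 𝒜) (ih hx) ?_
      simp [toA]
    | add x _ y _ hx hy => rw [map_add]; exact add_mem hx hy

theorem toPlus_of_mem {m : ℕ} {a : A} (ha : a ∈ 𝒜 (m + 1)) : (toPlus 𝒜 a : A) = a :=
  congrArg Subtype.val (toPlus_coe 𝒜 ⟨a, mem_Aplus 𝒜 ha⟩)

theorem mergeFirst_words {r : TensorAlgebra k (𝒜 1)} (hr : r ∈ tpow k (𝒜 1) 2)
    (x : TensorAlgebra k (𝒜 1)) : mergeFirst 𝒜 (words 𝒜 (r * x))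
      = TensorAlgebra.ι k (toPlus 𝒜 (toA 𝒜 r)) * words 𝒜 x := by
  rw [tpow, pow_two] at hr
  induction hr using Submodule.mul_induction_on' with
  | mem_mul_mem a ha b hb =>
    obtain ⟨v, rfl⟩ := ha
    obtain ⟨w, rfl⟩ := hb
    rw [mul_assoc, words_mul, words_mul, mergeFirst_cons, cobarMul_cons]
    congr 2
    have h : toA 𝒜 (TensorAlgebra.ι k v * TensorAlgebra.ι k w)
        = mulPlus 𝒜 (onePlus 𝒜 v) (onePlus 𝒜 w) := by
      simp [toA, coe_mulPlus, coe_onePlus]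
    rw [h, toPlus_coe]
  | add a _ b _ ha hb => rw [add_mul, map_add, map_add, ha, hb, map_add, map_add, map_add, add_mul]

theorem KPrime_le_R_mul (n : ℕ) : KPrime 𝒜 (n + 2) ≤ R 𝒜 * tpow k (𝒜 1) n := by
  intro w hw
  have := (Submodule.mem_inf.1 hw).2
  simp only [Submodule.mem_iInf] at this
  have := this 0 n (by omega)
  rwa [tpow, pow_zero, one_mul] at this

theorem mergeFirst_words_R {n : ℕ} {w : TensorAlgebra k (𝒜 1)}
    (hw : w ∈ R 𝒜 * tpow k (𝒜 1) n) : mergeFirst 𝒜 (words 𝒜 w) = 0 := by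
  induction hw using Submodule.mul_induction_on' with
  | mem_mul_mem r hr x hx =>
    have : toA 𝒜 r = 0 := hr.1
    rw [mergeFirst_words 𝒜 hr.2, this, map_zero, map_zero, zero_mul]
  | add a _ b _ ha hb => rw [map_add, map_add, ha, hb, add_zero]

theorem mergeFirst_words_KPrime (n : ℕ) {w : TensorAlgebra k (𝒜 1)} (hw : w ∈ KPrime 𝒜 n) :
    mergeFirst 𝒜 (words 𝒜 w) = 0 := by
  rcases n with _ | _ | n
  · have := hw.1
    rw [SetLike.mem_coe, tpow, pow_zero] at this
    obtain ⟨c, rfl⟩ := Submodule.mem_one.1 this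
    rw [AlgHom.commutes, Algebra.algebraMap_eq_smul_one, map_smul, mergeFirst_one, smul_zero]
  · have := hw.1
    rw [SetLike.mem_coe, tpow, zero_add, pow_one] at this
    obtain ⟨v, rfl⟩ := this
    rw [← mul_one (TensorAlgebra.ι k v), words_mul, mergeFirst_cons, map_one, cobarMul_one]
  · exact mergeFirst_words_R 𝒜 (KPrime_le_R_mul 𝒜 n hw)

theorem KPrime_one_le : KPrime 𝒜 1 ≤ LinearMap.range (TensorAlgebra.ι k) :=
  (KPrime_le_tpow 𝒜 1).trans_eq (pow_one _)

/-- The Koszul coalgebra consists of cycles of the bar complex. -/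
theorem cobar_words_KPrime : ∀ (n : ℕ) {w : TensorAlgebra k (𝒜 1)}, w ∈ KPrime 𝒜 n →
    cobar 𝒜 (words 𝒜 w) = 0
  | 0, w, hw => by
    have := hw.1
    rw [SetLike.mem_coe, tpow, pow_zero] at this
    obtain ⟨c, rfl⟩ := Submodule.mem_one.1 this
    rw [AlgHom.commutes, Algebra.algebraMap_eq_smul_one, map_smul, cobar_one, smul_zero]
  | n + 1, w, hw => by
    -- After a first letter v is split off, the remainder u ∈ K'_n is a cycle by induction, and only
    -- the merge of the first two letters is left. That merge vanishes on K'_{n+1}.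
    have key : ∀ z : KPrime 𝒜 1 ⊗[k] KPrime 𝒜 n,
        cobar 𝒜 (words 𝒜 (Submodule.mulMap _ _ z))
          = mergeFirst 𝒜 (words 𝒜 (Submodule.mulMap _ _ z)) := fun z => by
      induction z with
      | zero => simp
      | add x y hx hy => simp only [map_add, hx, hy]
      | tmul v u =>
        obtain ⟨v', hv⟩ := KPrime_one_le 𝒜 v.2
        rw [Submodule.mulMap_tmul, ← hv, cobar_words_cons, cobar_words_KPrime n u.2, mul_zero,
          sub_zero]
    have := key (decon 𝒜 (add_comm 1 n) ⟨w, hw⟩)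
    rwa [mulMap_decon, mergeFirst_words_KPrime 𝒜 _ hw] at this

/-- Once merged, the first letter has degree 2. Projecting the first letter to degree 1 therefore
isolates the part of the differential that leaves it untouched. -/
theorem proj_one_smul_firstLetter (v : 𝒜 1) (x : TensorAlgebra k (𝒜 1)) :
    (GradedAlgebra.proj 𝒜 1).rTensor _ ((v : A) • firstLetter 𝒜 (words 𝒜 x)) = 0 := by
  refine TensorAlgebra.cons_induction (p := fun x =>
    (GradedAlgebra.proj 𝒜 1).rTensor _ ((v : A) • firstLetter 𝒜 (words 𝒜 x)) = 0) ?_ ?_ ?_ ?_ x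
  · rw [map_one, firstLetter_one, smul_zero, map_zero]
  · intro r x hx
    rw [map_smul (words 𝒜), map_smul (firstLetter 𝒜), smul_comm, map_smul, hx, smul_zero]
  · intro x y hx hy
    rw [map_add, map_add, smul_add, map_add, hx, hy, add_zero]
  · intro w x _
    have h := SetLike.GradedMul.mul_mem (A := 𝒜) v.2 w.2
    rw [words_mul, firstLetter_cons, TensorProduct.smul_tmul', LinearMap.rTensor_tmul, smul_eq_mul,
      coe_onePlus, GradedAlgebra.proj_apply, DirectSum.decompose_of_mem_ne 𝒜 h (by omega),
      TensorProduct.zero_tmul]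

theorem firstLetter_cobarMul (v : Aplus 𝒜) (x : TensorAlgebra k (Aplus 𝒜)) :
    firstLetter 𝒜 (cobarMul 𝒜 x v) = (v : A) • firstLetter 𝒜 x := by
  refine TensorAlgebra.cons_induction (p := fun x =>
    firstLetter 𝒜 (cobarMul 𝒜 x v) = (v : A) • firstLetter 𝒜 x) ?_ ?_ ?_ ?_ x
  · rw [cobarMul_one, firstLetter_one, smul_zero, map_zero]
  · intro r x hx
    rw [map_smul, map_smul, LinearMap.smul_apply, map_smul, hx, smul_comm]
  · intro x y hx hy
    rw [map_add, map_add, LinearMap.add_apply, map_add, hx, hy, smul_add]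
  · intro w x _
    rw [cobarMul_cons, firstLetter_cons, firstLetter_cons, coe_mulPlus, TensorProduct.smul_tmul',
      smul_eq_mul]

/-- A cycle of the bar complex lies in `A₁ ⊗` cycles. -/
theorem mem_mul_of_cobar_eq_zero {n : ℕ} {x : TensorAlgebra k (𝒜 1)}
    (hx : x ∈ tpow k (𝒜 1) (n + 1)) (h : cobar 𝒜 (words 𝒜 x) = 0) :
    x ∈ LinearMap.range (TensorAlgebra.ι k) *
      (tpow k (𝒜 1) n ⊓ (cobar 𝒜 ∘ₗ (words 𝒜).toLinearMap).ker) := by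
  rw [tpow, pow_succ', ← Submodule.mulMap_range] at hx
  obtain ⟨z, rfl⟩ := hx
  let f : tpow k (𝒜 1) n →ₗ[k] TensorAlgebra k (Aplus 𝒜) :=
    cobar 𝒜 ∘ₗ (words 𝒜).toLinearMap ∘ₗ (tpow k (𝒜 1) n).subtype
  let e : LinearMap.range (TensorAlgebra.ι k : 𝒜 1 →ₗ[k] _) →ₗ[k] A :=
    (toA 𝒜).toLinearMap ∘ₗ Submodule.subtype _
  have he : Function.Injective e := by
    rintro ⟨_, v, rfl⟩ ⟨_, w, rfl⟩ hvw
    have : (v : A) = w := by simpa [e, toA] using hvw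
    rw [Subtype.ext this]
  -- In d(vu) = μ_v u - v·du the first summand is invisible in first-letter degree 1, so what is
  -- seen is -v ⊗ du.
  have key : (GradedAlgebra.proj 𝒜 1).rTensor _ ∘ₗ firstLetter 𝒜 ∘ₗ cobar 𝒜 ∘ₗ
      (words 𝒜).toLinearMap ∘ₗ Submodule.mulMap _ (tpow k (𝒜 1) n)
      = -(e.rTensor _ ∘ₗ f.lTensor _) := by
    refine TensorProduct.ext' fun a u => ?_
    obtain ⟨_, v, rfl⟩ := a
    simp only [LinearMap.comp_apply, Submodule.mulMap_tmul, AlgHom.toLinearMap_apply,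
      LinearMap.neg_apply, LinearMap.lTensor_tmul, LinearMap.rTensor_tmul]
    rw [words_mul, cobar_cons, map_sub, map_sub, firstLetter_cobarMul, coe_onePlus,
      proj_one_smul_firstLetter, firstLetter_cons, LinearMap.rTensor_tmul, zero_sub, coe_onePlus,
      GradedAlgebra.proj_apply, DirectSum.decompose_of_mem_same 𝒜 v.2]
    simp [e, f, toA]
  have hz : e.rTensor _ (f.lTensor _ z) = 0 := by
    have := LinearMap.congr_fun key z
    simp only [LinearMap.comp_apply, AlgHom.toLinearMap_apply, LinearMap.neg_apply, h, map_zero] at this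
    exact neg_eq_zero.1 this.symm
  -- Over a field tensoring is exact: the embedding of letters can be cancelled, and the kernel of 1
  -- ⊗ f is the letters tensored with the kernel of f.
  obtain ⟨z, rfl⟩ := exists_lTensor_of_eq_zero f
    (Module.Flat.rTensor_preserves_injective_linearMap e he (hz.trans (map_zero _).symm))
  clear h hz
  induction z with
  | zero => simp
  | add x y hx hy => simp only [map_add]; exact add_mem hx hy
  | tmul a u =>
    rw [LinearMap.lTensor_tmul, Submodule.mulMap_tmul]
    exact Submodule.mul_mem_mul a.2 ⟨u.1.2, u.2⟩

/-- Write x as a sum of products vu with u a cycle. Then d(vu) is just the merge of the first two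
letters, so the merge of x is dx = 0. -/
theorem mergeFirst_words_of_cobar_eq_zero {n : ℕ} {x : TensorAlgebra k (𝒜 1)}
    (hx : x ∈ tpow k (𝒜 1) (n + 1)) (h : cobar 𝒜 (words 𝒜 x) = 0) :
    mergeFirst 𝒜 (words 𝒜 x) = 0 := by
  rw [← h]
  have hx' := mem_mul_of_cobar_eq_zero 𝒜 hx h
  clear h hx
  induction hx' using Submodule.mul_induction_on' with
  | mem_mul_mem a ha u hu =>
    obtain ⟨v, rfl⟩ := ha
    have : cobar 𝒜 (words 𝒜 u) = 0 := hu.2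
    rw [cobar_words_cons, this, mul_zero, sub_zero]
  | add a _ b _ ha hb => rw [map_add, map_add, ha, hb, map_add]

/-- On V^{⊗2} ⊗ V^{⊗n} merging the first two letters is multiplication in A tensored with an
injection. Its kernel is R ⊗ V^{⊗n} by flatness. -/
theorem mem_R_mul_of_cobar_eq_zero {n : ℕ} {x : TensorAlgebra k (𝒜 1)}
    (hx : x ∈ tpow k (𝒜 1) (n + 2)) (h : cobar 𝒜 (words 𝒜 x) = 0) :
    x ∈ R 𝒜 * tpow k (𝒜 1) n := by
  have h' := mergeFirst_words_of_cobar_eq_zero 𝒜 hx h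
  rw [tpow, add_comm, pow_add, ← Submodule.mulMap_range] at hx
  obtain ⟨z, rfl⟩ := hx
  let e : tpow k (𝒜 1) 2 →ₗ[k] A := (toA 𝒜).toLinearMap ∘ₗ Submodule.subtype _
  let f : tpow k (𝒜 1) n →ₗ[k] TensorAlgebra k (Aplus 𝒜) :=
    (words 𝒜).toLinearMap ∘ₗ (tpow k (𝒜 1) n).subtype
  have hf : Function.Injective f := (words_injective 𝒜).comp Subtype.val_injective
  have key : firstLetter 𝒜 ∘ₗ mergeFirst 𝒜 ∘ₗ (words 𝒜).toLinearMap ∘ₗ Submodule.mulMap _ _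
      = f.lTensor _ ∘ₗ e.rTensor _ := by
    refine TensorProduct.ext' fun a u => ?_
    simp only [LinearMap.comp_apply, Submodule.mulMap_tmul, AlgHom.toLinearMap_apply,
      LinearMap.lTensor_tmul, LinearMap.rTensor_tmul]
    rw [mergeFirst_words 𝒜 a.2, firstLetter_cons,
      toPlus_of_mem 𝒜 (m := 1) (toA_mem_of_mem_tpow 𝒜 2 a.2)]
    rfl
  have hz : f.lTensor _ (e.rTensor _ z) = 0 := by
    have := LinearMap.congr_fun key z
    simp only [LinearMap.comp_apply, AlgHom.toLinearMap_apply] at this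
    rw [h', map_zero] at this
    exact this.symm
  obtain ⟨z, rfl⟩ := exists_rTensor_of_eq_zero e
    (Module.Flat.lTensor_preserves_injective_linearMap f hf (hz.trans (map_zero _).symm))
  clear h hz h'
  induction z with
  | zero => simp
  | add x y hx hy => simp only [map_add]; exact add_mem hx hy
  | tmul a u =>
    rw [LinearMap.rTensor_tmul, Submodule.mulMap_tmul]
    exact Submodule.mul_mem_mul ⟨a.2, a.1.2⟩ u.2

/-- The condition at position j = 0 comes from the merge of the first two letters. For j > 0 a cycle
lies in V ⊗ cycles, and the induction hypothesis for the shorter cycles gives the condition at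
position j - 1 there. -/
theorem mem_KPrime_of_cobar_eq_zero : ∀ (n : ℕ) {x : TensorAlgebra k (𝒜 1)},
    x ∈ tpow k (𝒜 1) n → cobar 𝒜 (words 𝒜 x) = 0 → x ∈ KPrime 𝒜 n
  | 0, x, hx, _ => by
    refine Submodule.mem_inf.2 ⟨hx, ?_⟩
    simp only [Submodule.mem_iInf]
    intro j l h
    omega
  | 1, x, hx, _ => by
    refine Submodule.mem_inf.2 ⟨hx, ?_⟩
    simp only [Submodule.mem_iInf]
    intro j l h
    omega
  | n + 2, x, hx, h => by
    refine Submodule.mem_inf.2 ⟨hx, ?_⟩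
    simp only [Submodule.mem_iInf]
    intro j l hjl
    rcases j with _ | j
    · rw [tpow, pow_zero, one_mul, show l = n by omega]
      exact mem_R_mul_of_cobar_eq_zero 𝒜 hx h
    · have h1 := mem_mul_of_cobar_eq_zero 𝒜 hx h
      have h2 : tpow k (𝒜 1) (n + 1) ⊓ (cobar 𝒜 ∘ₗ (words 𝒜).toLinearMap).ker
          ≤ tpow k (𝒜 1) j * R 𝒜 * tpow k (𝒜 1) l := by
        intro u hu
        have hu' := (Submodule.mem_inf.1 (mem_KPrime_of_cobar_eq_zero (n + 1) hu.1 hu.2)).2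
        simp only [Submodule.mem_iInf] at hu'
        exact hu' j l (by omega)
      have h3 := mul_le_mul' le_rfl h2 h1
      rwa [tpow, pow_succ', mul_assoc, mul_assoc, ← mul_assoc (tpow k (𝒜 1) j)]

theorem cobarMul_mem_tpow {n : ℕ} : ∀ {x : TensorAlgebra k (Aplus 𝒜)} (v : Aplus 𝒜),
    x ∈ tpow k (Aplus 𝒜) n → cobarMul 𝒜 x v ∈ tpow k (Aplus 𝒜) n := by
  intro x v hx
  rcases n with _ | n
  · rw [tpow, pow_zero] at hx
    obtain ⟨c, rfl⟩ := Submodule.mem_one.1 hx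
    rw [Algebra.algebraMap_eq_smul_one, map_smul, LinearMap.smul_apply, cobarMul_one, smul_zero]
    exact zero_mem _
  · rw [tpow, pow_succ'] at hx ⊢
    induction hx using Submodule.mul_induction_on' with
    | mem_mul_mem a ha u hu =>
      obtain ⟨w, rfl⟩ := ha
      rw [cobarMul_cons]
      exact Submodule.mul_mem_mul ⟨_, rfl⟩ hu
    | add a _ b _ ha hb => rw [map_add, LinearMap.add_apply]; exact add_mem ha hb

theorem cobar_of_mem_tpow_zero {x : TensorAlgebra k (Aplus 𝒜)} (hx : x ∈ tpow k (Aplus 𝒜) 0) :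
    cobar 𝒜 x = 0 := by
  rw [tpow, pow_zero] at hx
  obtain ⟨c, rfl⟩ := Submodule.mem_one.1 hx
  rw [Algebra.algebraMap_eq_smul_one, map_smul, cobar_one, smul_zero]

theorem cobar_mem_tpow : ∀ {n : ℕ} {x : TensorAlgebra k (Aplus 𝒜)},
    x ∈ tpow k (Aplus 𝒜) (n + 1) → cobar 𝒜 x ∈ tpow k (Aplus 𝒜) n := by
  intro n
  induction n with
  | zero =>
    intro x hx
    rw [tpow, zero_add, pow_one] at hx
    obtain ⟨v, rfl⟩ := hx
    rw [cobar_ι]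
    exact zero_mem _
  | succ n ih =>
    intro x hx
    rw [tpow, pow_succ'] at hx
    induction hx using Submodule.mul_induction_on' with
    | mem_mul_mem a ha u hu =>
      obtain ⟨w, rfl⟩ := ha
      rw [cobar_cons]
      refine sub_mem (cobarMul_mem_tpow 𝒜 w hu) ?_
      rw [tpow, pow_succ']
      exact Submodule.mul_mem_mul ⟨_, rfl⟩ (ih hu)
    | add a _ b _ ha hb => rw [map_add]; exact add_mem ha hb

theorem words_mem_tpow {n : ℕ} {x : TensorAlgebra k (𝒜 1)} (hx : x ∈ tpow k (𝒜 1) n) :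
    words 𝒜 x ∈ tpow k (Aplus 𝒜) n := by
  have h : Submodule.map (words 𝒜).toLinearMap (LinearMap.range (TensorAlgebra.ι k))
      ≤ LinearMap.range (TensorAlgebra.ι k) := by
    rintro _ ⟨_, ⟨v, rfl⟩, rfl⟩
    exact ⟨_, (words_ι 𝒜 v).symm⟩
  have h1 : words 𝒜 x ∈ Submodule.map (words 𝒜).toLinearMap (tpow k (𝒜 1) n) := ⟨x, hx, rfl⟩
  rw [tpow, Submodule.map_pow] at h1
  exact pow_le_pow_left' h n h1

/-- The projection of `T(V)` to words of length `n`. -/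
noncomputable abbrev lengthProj (k V : Type*) [Field k] [AddCommGroup V] [Module k V] (n : ℕ) :
    TensorAlgebra k V →ₗ[k] TensorAlgebra k V := GradedAlgebra.proj (tpow k V) n

theorem lengthProj_of_mem {k V : Type*} [Field k] [AddCommGroup V] [Module k V] {n m : ℕ}
    {x : TensorAlgebra k V} (hx : x ∈ tpow k V n) : lengthProj k V m x = if n = m then x else 0 := by
  rw [GradedAlgebra.proj_apply]
  split_ifs with h
  · subst h
    exact DirectSum.decompose_of_mem_same _ hx
  · exact DirectSum.decompose_of_mem_ne _ hx h

theorem linearMap_ext_tpow {k V M : Type*} [Field k] [AddCommGroup V] [Module k V]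
    [AddCommGroup M] [Module k M] {f g : TensorAlgebra k V →ₗ[k] M}
    (h : ∀ n, ∀ x ∈ tpow k V n, f x = g x) : f = g := by
  classical
  refine LinearMap.ext fun x => ?_
  rw [← DirectSum.sum_support_decompose (tpow k V) x, map_sum, map_sum]
  exact Finset.sum_congr rfl fun i _ => h i _ (Subtype.property _)

theorem lengthProj_cobar_words (n : ℕ) (x : TensorAlgebra k (𝒜 1)) :
    lengthProj k (Aplus 𝒜) n (cobar 𝒜 (words 𝒜 x))
      = cobar 𝒜 (words 𝒜 (lengthProj k (𝒜 1) (n + 1) x)) := by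
  refine LinearMap.congr_fun (f := lengthProj k (Aplus 𝒜) n ∘ₗ cobar 𝒜 ∘ₗ (words 𝒜).toLinearMap)
    (g := cobar 𝒜 ∘ₗ (words 𝒜).toLinearMap ∘ₗ lengthProj k (𝒜 1) (n + 1))
    (linearMap_ext_tpow fun m x hx => ?_) x
  simp only [LinearMap.comp_apply, AlgHom.toLinearMap_apply]
  rw [lengthProj_of_mem hx]
  rcases m with _ | m
  · rw [cobar_of_mem_tpow_zero 𝒜 (words_mem_tpow 𝒜 hx)]
    simp
  · rw [lengthProj_of_mem (cobar_mem_tpow 𝒜 (words_mem_tpow 𝒜 hx))]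
    by_cases h : m = n <;> simp [h]

/-- The inclusion `⨁ᵢ K'_i → T(A₁)`. -/
noncomputable def sumKPrime : (⨁ i : ℕ, KPrime 𝒜 i) →ₗ[k] TensorAlgebra k (𝒜 1) :=
  DirectSum.toModule k ℕ _ fun i => (KPrime 𝒜 i).subtype

theorem sumKPrime_lof (i : ℕ) (w : KPrime 𝒜 i) :
    sumKPrime 𝒜 (DirectSum.lof k ℕ (fun i => KPrime 𝒜 i) i w) = w := by
  rw [sumKPrime, DirectSum.toModule_lof]
  rfl

theorem lengthProj_sumKPrime (n : ℕ) (w : ⨁ i : ℕ, KPrime 𝒜 i) :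
    lengthProj k (𝒜 1) n (sumKPrime 𝒜 w) = w n := by
  refine LinearMap.congr_fun (f := lengthProj k (𝒜 1) n ∘ₗ sumKPrime 𝒜)
    (g := (KPrime 𝒜 n).subtype ∘ₗ DirectSum.component k ℕ (fun i => KPrime 𝒜 i) n)
    (DirectSum.linearMap_ext _ fun i => LinearMap.ext fun w => ?_) w
  simp only [LinearMap.comp_apply, sumKPrime_lof]
  rw [lengthProj_of_mem (KPrime_le_tpow 𝒜 i w.2)]
  split_ifs with h
  · subst h
    rw [DirectSum.component.lof_self]
    rfl
  · rw [DirectSum.component.of, dif_neg h]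
    rfl

theorem sumKPrime_injective : Function.Injective (sumKPrime 𝒜) := by
  refine (injective_iff_map_eq_zero _).2 fun w hw => DFinsupp.ext fun n => Subtype.ext ?_
  have := lengthProj_sumKPrime 𝒜 n w
  rw [hw, map_zero] at this
  exact this.symm

/-- The cycles of the bar complex of excess `0` form the Koszul coalgebra. -/
theorem exists_sumKPrime {x : TensorAlgebra k (𝒜 1)} (h : cobar 𝒜 (words 𝒜 x) = 0) :
    ∃ w, sumKPrime 𝒜 w = x := by
  classical
  have hK : ∀ n, lengthProj k (𝒜 1) n x ∈ KPrime 𝒜 n := by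
    intro n
    have hn : lengthProj k (𝒜 1) n x ∈ tpow k (𝒜 1) n := by
      rw [GradedAlgebra.proj_apply]
      exact Subtype.property _
    refine mem_KPrime_of_cobar_eq_zero 𝒜 n hn ?_
    rcases n with _ | n
    · exact cobar_of_mem_tpow_zero 𝒜 (words_mem_tpow 𝒜 hn)
    · rw [← lengthProj_cobar_words, h, map_zero]
  rw [← LinearMap.mem_range, ← DirectSum.sum_support_decompose (tpow k (𝒜 1)) x]
  refine Submodule.sum_mem _ fun i _ => ?_
  have := hK i
  rw [GradedAlgebra.proj_apply] at this
  exact ⟨_, sumKPrime_lof 𝒜 i ⟨_, this⟩⟩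

end DiagonalSubcoalgebra
end Koszul


namespace Koszul

open scoped TensorProduct DirectSum
open MulOpposite AInfinity

/-! ### The Koszul complex as a subcomplex of the bar resolution -/

section Exactness

variable {k A : Type*} [Field k] [Ring A] [Algebra k A] (𝒜 : ℕ → Submodule k A)

theorem linearMap_ext_P {M : Type*} [AddCommGroup M] [Module k M] {f g : P 𝒜 →ₗ[k] M}
    (h : ∀ (a b : A) i w, f ((a ⊗ₜ[k] op b : Env k A) • gen 𝒜 i w)
      = g ((a ⊗ₜ[k] op b : Env k A) • gen 𝒜 i w)) : f = g := by
  suffices H : f ∘ₗ ((equivP 𝒜).restrictScalars k).toLinearMap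
      = g ∘ₗ ((equivP 𝒜).restrictScalars k).toLinearMap by
    refine LinearMap.ext fun x => ?_
    have := LinearMap.congr_fun H ((equivP 𝒜).symm x)
    simpa using this
  refine TensorProduct.ext (TensorProduct.ext' fun a b =>
    DirectSum.linearMap_ext _ fun i => LinearMap.ext fun w => ?_)
  have := h a b.unop i w
  rw [op_unop, gen, LinearMap.comp_apply, LinearMap.comp_apply, LinearMap.restrictScalars_apply,
    LinearEquiv.coe_coe, ← map_smul, TensorProduct.mk_apply, TensorProduct.smul_tmul', smul_eq_mul,
    mul_one] at this
  exact this

theorem neg_one_pow_succ_smul {M : Type*} [AddCommGroup M] [Module k M] (n : ℕ) (x : M) :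
    (-1 : k) ^ (n + 1) • x = -((-1 : k) ^ n • x) := by
  rw [pow_succ, mul_neg_one, neg_smul]

/-- `A ⊗ X ⊗ A`, functorially in `X`. -/
noncomputable def onMiddle (A : Type*) [Ring A] [Algebra k A] {X Y : Type*} [AddCommMonoid X]
    [Module k X] [AddCommMonoid Y] [Module k Y] (f : X →ₗ[k] Y) :
    A ⊗[k] (X ⊗[k] A) →ₗ[k] A ⊗[k] (Y ⊗[k] A) := (f.rTensor A).lTensor A

section OnMiddle

variable {X Y Z : Type*} [AddCommMonoid X] [Module k X] [AddCommMonoid Y] [Module k Y]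
  [AddCommMonoid Z] [Module k Z]

theorem onMiddle_tmul (f : X →ₗ[k] Y) (a b : A) (x : X) :
    onMiddle A f (a ⊗ₜ (x ⊗ₜ b)) = a ⊗ₜ (f x ⊗ₜ b) := rfl

theorem linearMap_ext_middle {f g : A ⊗[k] (X ⊗[k] A) →ₗ[k] Y}
    (h : ∀ a b x, f (a ⊗ₜ (x ⊗ₜ b)) = g (a ⊗ₜ (x ⊗ₜ b))) : f = g :=
  TensorProduct.ext (LinearMap.ext fun a => TensorProduct.ext' fun x b => h a b x)

theorem onMiddle_onMiddle (g : Y →ₗ[k] Z) (f : X →ₗ[k] Y) (z : A ⊗[k] (X ⊗[k] A)) :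
    onMiddle A g (onMiddle A f z) = onMiddle A (g ∘ₗ f) z :=
  LinearMap.congr_fun (f := onMiddle A g ∘ₗ onMiddle A f) (g := onMiddle A (g ∘ₗ f))
    (linearMap_ext_middle fun _ _ _ => rfl) z

theorem onMiddle_zero (z : A ⊗[k] (X ⊗[k] A)) : onMiddle A (0 : X →ₗ[k] Y) z = 0 := by
  simp [onMiddle]

theorem onMiddle_injective {f : X →ₗ[k] Y} (hf : Function.Injective f) :
    Function.Injective (onMiddle A f) :=
  Module.Flat.lTensor_preserves_injective_linearMap _
    (Module.Flat.rTensor_preserves_injective_linearMap _ hf)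

theorem exists_onMiddle_of_eq_zero {X Y : Type*} [AddCommGroup X] [Module k X]
    [AddCommGroup Y] [Module k Y] (f : X →ₗ[k] Y) {z : A ⊗[k] (X ⊗[k] A)}
    (h : onMiddle A f z = 0) : ∃ z', onMiddle A f.ker.subtype z' = z :=
  (Module.Flat.lTensor_exact A (Module.Flat.rTensor_exact A (LinearMap.exact_subtype_ker_map f))
    z).1 h

end OnMiddle

/-- `P = A ⊗ ⨁ᵢ K'_i ⊗ A`. -/
noncomputable def middleP : P 𝒜 ≃ₗ[k] A ⊗[k] ((⨁ i : ℕ, KPrime 𝒜 i) ⊗[k] A) :=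
  (equivP 𝒜).symm.restrictScalars k ≪≫ₗ TensorProduct.assoc k A Aᵐᵒᵖ (⨁ i : ℕ, KPrime 𝒜 i) ≪≫ₗ
    TensorProduct.congr (LinearEquiv.refl k A) (TensorProduct.comm k Aᵐᵒᵖ (⨁ i : ℕ, KPrime 𝒜 i) ≪≫ₗ
      TensorProduct.congr (LinearEquiv.refl k _) (opLinearEquiv k).symm)

theorem middleP_smul_gen (a b : A) (i : ℕ) (w : KPrime 𝒜 i) :
    middleP 𝒜 ((a ⊗ₜ[k] op b : Env k A) • gen 𝒜 i w)
      = a ⊗ₜ (DirectSum.lof k ℕ (fun i => KPrime 𝒜 i) i w ⊗ₜ b) := by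
  rw [gen, LinearMap.comp_apply, LinearMap.comp_apply, LinearMap.restrictScalars_apply,
    LinearEquiv.coe_coe, ← map_smul, TensorProduct.mk_apply, TensorProduct.smul_tmul', smul_eq_mul,
    mul_one]
  rfl

variable [GradedAlgebra 𝒜]

/-- Left multiplication of `A₊` on `A`. -/
noncomputable def leftAct : Aplus 𝒜 →ₗ[k] A →ₗ[k] A := LinearMap.mul k A ∘ₗ (Aplus 𝒜).subtype

theorem leftAct_apply (v : Aplus 𝒜) (b : A) : leftAct 𝒜 v b = v * b := rfl

theorem leftAct_mulPlus (a b : Aplus 𝒜) (n : A) :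
    leftAct 𝒜 (mulPlus 𝒜 a b) n = leftAct 𝒜 a (leftAct 𝒜 b n) := mul_assoc (a : A) b n

/-- The inclusion of the Koszul resolution into the bar resolution. -/
noncomputable def toRes : P 𝒜 →ₗ[k] A ⊗[k] Bar 𝒜 A :=
  onMiddle A ((words 𝒜).toLinearMap ∘ₗ sumKPrime 𝒜) ∘ₗ (middleP 𝒜).toLinearMap

theorem toRes_smul_gen (a b : A) (i : ℕ) (w : KPrime 𝒜 i) :
    toRes 𝒜 ((a ⊗ₜ[k] op b : Env k A) • gen 𝒜 i w) = a ⊗ₜ (words 𝒜 w ⊗ₜ b) := by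
  rw [toRes, LinearMap.comp_apply, LinearEquiv.coe_coe, middleP_smul_gen, onMiddle_tmul,
    LinearMap.comp_apply, sumKPrime_lof]
  rfl

theorem toRes_injective : Function.Injective (toRes 𝒜) :=
  (onMiddle_injective ((words_injective 𝒜).comp (sumKPrime_injective 𝒜))).comp
    (middleP 𝒜).injective

theorem barFirst_words (a b : A) (i : ℕ) (z : KPrime 𝒜 1 ⊗[k] KPrime 𝒜 i) :
    a • barFirst 𝒜 A (words 𝒜 (Submodule.mulMap _ _ z) ⊗ₜ b)
      = toRes 𝒜 ((a ⊗ₜ[k] op b : Env k A) • leftMul 𝒜 i z) := by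
  induction z with
  | zero => simp
  | add x y hx hy => simp only [map_add, TensorProduct.add_tmul, smul_add, hx, hy]
  | tmul v u =>
    obtain ⟨v', hv⟩ := KPrime_one_le 𝒜 v.2
    have h : val 𝒜 v = v' := by
      change toA 𝒜 v = v'
      rw [← hv]
      simp [toA]
    rw [Submodule.mulMap_tmul, ← hv, words_mul, ← cons_tmul, barFirst_cons, leftMul,
      TensorProduct.lift.tmul, LinearMap.mk₂_apply, ← mul_smul,
      Algebra.TensorProduct.tmul_mul_tmul, mul_one, toRes_smul_gen, h, TensorProduct.smul_tmul',
      smul_eq_mul, coe_onePlus]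

theorem barMul_words_mul (v w : 𝒜 1) (u : TensorAlgebra k (𝒜 1)) (b : A) :
    barMul 𝒜 (leftAct 𝒜) (words 𝒜 (TensorAlgebra.ι k w * u) ⊗ₜ b) (onePlus 𝒜 v)
      = cobarMul 𝒜 (words 𝒜 (TensorAlgebra.ι k w * u)) (onePlus 𝒜 v) ⊗ₜ b := by
  rw [words_mul, ← cons_tmul, barMul_cons, cobarMul_cons, cons_tmul]

/-- Coefficients add one face to the reduced differential, the last letter acting on b; its sign
comes from passing the n letters before it. -/
theorem barD_words (b : A) (v : 𝒜 1) : ∀ {n : ℕ} {u : TensorAlgebra k (𝒜 1)},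
    u ∈ tpow k (𝒜 1) n → barD 𝒜 (leftAct 𝒜) (words 𝒜 (u * TensorAlgebra.ι k v) ⊗ₜ b)
      = cobar 𝒜 (words 𝒜 (u * TensorAlgebra.ι k v)) ⊗ₜ b
        + (-1 : k) ^ n • words 𝒜 u ⊗ₜ ((v : A) * b)
  | 0, u, hu => by
    rw [tpow, pow_zero] at hu
    obtain ⟨c, rfl⟩ := Submodule.mem_one.1 hu
    rw [Algebra.algebraMap_eq_smul_one, smul_mul_assoc, one_mul, map_smul, map_smul, words_ι,
      cobar_ι, smul_zero, TensorProduct.zero_tmul, zero_add, ← TensorProduct.smul_tmul', map_smul,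
      pow_zero, one_smul, map_smul, map_one, ← TensorProduct.smul_tmul']
    congr 1
    have := barD_cons 𝒜 (leftAct 𝒜) (onePlus 𝒜 v) (1 ⊗ₜ b)
    rw [barD_base, barMul_base, smul_zero, sub_zero, cons_tmul, mul_one] at this
    exact this
  | n + 1, u, hu => by
    rw [tpow, pow_succ'] at hu
    induction hu using Submodule.mul_induction_on' with
    | mem_mul_mem a ha u hu =>
      obtain ⟨w, rfl⟩ := ha
      have h1 : barMul 𝒜 (leftAct 𝒜) (words 𝒜 (u * TensorAlgebra.ι k v) ⊗ₜ b) (onePlus 𝒜 w)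
          = cobarMul 𝒜 (words 𝒜 (u * TensorAlgebra.ι k v)) (onePlus 𝒜 w) ⊗ₜ b := by
        rcases n with _ | n
        · rw [pow_zero] at hu
          obtain ⟨c, rfl⟩ := Submodule.mem_one.1 hu
          have := barMul_words_mul 𝒜 w v 1 b
          rw [mul_one] at this
          rw [Algebra.algebraMap_eq_smul_one, smul_mul_assoc, one_mul, map_smul,
            ← TensorProduct.smul_tmul', map_smul, map_smul, LinearMap.smul_apply,
            LinearMap.smul_apply, this, TensorProduct.smul_tmul']
        · rw [pow_succ'] at hu
          induction hu using Submodule.mul_induction_on' with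
          | mem_mul_mem a ha u hu =>
            obtain ⟨w', rfl⟩ := ha
            rw [mul_assoc, barMul_words_mul]
          | add a _ b _ ha hb =>
            simp only [add_mul, map_add, TensorProduct.add_tmul, LinearMap.add_apply, ha, hb]
      have h2 : ∀ x : Bar 𝒜 A, (-1 : k) ^ (n + 1) • x = -((-1 : k) ^ n • x) :=
        fun x => by rw [pow_succ, mul_neg_one]; exact neg_smul _ x
      rw [mul_assoc, words_mul, ← cons_tmul, barD_cons, h1, barD_words b v hu, cobar_cons,
        TensorProduct.sub_tmul, smul_add, cons_tmul, words_mul, ← cons_tmul,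
        h2, smul_comm]
      abel
    | add x _ y _ hx hy =>
      simp only [add_mul, map_add, TensorProduct.add_tmul, hx, hy, smul_add]
      abel

theorem barD_words_KPrime (a b : A) (i : ℕ) (z : KPrime 𝒜 i ⊗[k] KPrime 𝒜 1)
    (hz : cobar 𝒜 (words 𝒜 (Submodule.mulMap _ _ z)) = 0) :
    a ⊗ₜ barD 𝒜 (leftAct 𝒜) (words 𝒜 (Submodule.mulMap _ _ z) ⊗ₜ b)
      = (-1 : k) ^ i • toRes 𝒜 ((a ⊗ₜ[k] op b : Env k A) • rightMul 𝒜 i z) := by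
  have key : ∀ z : KPrime 𝒜 i ⊗[k] KPrime 𝒜 1,
      a ⊗ₜ barD 𝒜 (leftAct 𝒜) (words 𝒜 (Submodule.mulMap _ _ z) ⊗ₜ b)
      = a ⊗ₜ (cobar 𝒜 (words 𝒜 (Submodule.mulMap _ _ z)) ⊗ₜ b)
        + (-1 : k) ^ i • toRes 𝒜 ((a ⊗ₜ[k] op b : Env k A) • rightMul 𝒜 i z) := by
    intro z
    induction z with
    | zero => simp
    | add x y hx hy =>
      simp only [map_add, TensorProduct.add_tmul, TensorProduct.tmul_add, smul_add, hx, hy]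
      abel
    | tmul u v =>
      obtain ⟨v', hv⟩ := KPrime_one_le 𝒜 v.2
      have h : val 𝒜 v = v' := by
        change toA 𝒜 v = v'
        rw [← hv]
        simp [toA]
      rw [Submodule.mulMap_tmul, ← hv, barD_words 𝒜 b v' (KPrime_le_tpow 𝒜 i u.2), rightMul,
        TensorProduct.lift.tmul, LinearMap.mk₂_apply, ← mul_smul,
        Algebra.TensorProduct.tmul_mul_tmul, mul_one, ← op_mul, toRes_smul_gen, h,
        TensorProduct.tmul_add, TensorProduct.tmul_smul]
  rw [key, hz, TensorProduct.zero_tmul, TensorProduct.tmul_zero, zero_add]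

/-- The inner faces of the bar differential cancel on K'_{i+1}, which consists of cycles. The two
outer faces are the two terms of d, the right one with sign -(-1)^i = (-1)^{i+1}. -/
theorem resD_toRes (z : P 𝒜) : resD 𝒜 (leftAct 𝒜) (toRes 𝒜 z) = toRes 𝒜 (d 𝒜 z) := by
  refine LinearMap.congr_fun (f := resD 𝒜 (leftAct 𝒜) ∘ₗ toRes 𝒜)
    (g := toRes 𝒜 ∘ₗ (d 𝒜).restrictScalars k) (linearMap_ext_P 𝒜 fun a b i w => ?_) z
  rw [LinearMap.comp_apply, LinearMap.comp_apply, LinearMap.restrictScalars_apply,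
    map_smul (d 𝒜), toRes_smul_gen, resD_tmul]
  rcases i with _ | i
  · have := KPrime_le_tpow 𝒜 0 w.2
    rw [tpow, pow_zero] at this
    obtain ⟨c, hc⟩ := Submodule.mem_one.1 this
    rw [← hc, d_gen_zero, smul_zero, map_zero, AlgHom.commutes, Algebra.algebraMap_eq_smul_one,
      ← TensorProduct.smul_tmul', map_smul, map_smul, barFirst_base, barD_base, smul_zero,
      smul_zero, smul_zero, TensorProduct.tmul_zero, sub_zero]
  · have h1 := barFirst_words 𝒜 a b i (decon 𝒜 (add_comm 1 i) w)
    have h2 := barD_words_KPrime 𝒜 a b i (decon 𝒜 rfl w)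
    rw [mulMap_decon] at h1 h2
    rw [h1, h2 (cobar_words_KPrime 𝒜 _ w.2), d_gen_succ, smul_add, map_add,
      smul_comm _ ((-1 : k) ^ (i + 1)), (toRes 𝒜).map_smul, neg_one_pow_succ_smul]
    abel

end Exactness
end Koszul


namespace Koszul

open scoped TensorProduct DirectSum
open MulOpposite AInfinity

/-! ### Exactness of the Koszul resolution by the excess filtration -/

section Exactness

variable {k A : Type*} [Field k] [Ring A] [Algebra k A] (𝒜 : ℕ → Submodule k A)

instance : IsScalarTower k (Env k A) A where
  smul_assoc r e x := by
    induction e using TensorProduct.induction_on with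
    | zero =>
      have h0 : (0 : Env k A) • x = 0 := zero_smul (Env k A) x
      exact (congrArg (· • x) (smul_zero r)).trans
        (h0.trans ((smul_zero r).symm.trans (congrArg (r • ·) h0.symm)))
    | add e e' he he' => rw [smul_add, add_smul, he, he', add_smul, smul_add]
    | tmul a b =>
      rw [TensorProduct.smul_tmul', env_smul_self, env_smul_self, smul_mul_assoc, smul_mul_assoc]

/-- The augmentation `P → A`. -/
noncomputable def aug : P 𝒜 →ₗ[Env k A] A :=
  liftP 𝒜 fun
    | 0 => (toA 𝒜).toLinearMap ∘ₗ (KPrime 𝒜 0).subtype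
    | _ + 1 => 0

theorem aug_gen_zero (w : KPrime 𝒜 0) : aug 𝒜 (gen 𝒜 0 w) = toA 𝒜 w := liftP_gen 𝒜 _ 0 w

theorem aug_gen_succ (i : ℕ) (w : KPrime 𝒜 (i + 1)) : aug 𝒜 (gen 𝒜 (i + 1) w) = 0 :=
  liftP_gen 𝒜 _ (i + 1) w

variable [GradedAlgebra 𝒜]

/-- The augmentation of the bar resolution. -/
noncomputable def resAug : A ⊗[k] Bar 𝒜 A →ₗ[k] A :=
  LinearMap.mul' k A ∘ₗ (barZero 𝒜 A).lTensor A

theorem resAug_tmul (a : A) (x : Bar 𝒜 A) : resAug 𝒜 (a ⊗ₜ x) = a * barZero 𝒜 A x := rfl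

theorem resAug_toRes (z : P 𝒜) : resAug 𝒜 (toRes 𝒜 z) = aug 𝒜 z := by
  refine LinearMap.congr_fun (f := resAug 𝒜 ∘ₗ toRes 𝒜)
    (g := (aug 𝒜).restrictScalars k) (linearMap_ext_P 𝒜 fun a b i w => ?_) z
  rw [LinearMap.comp_apply, LinearMap.restrictScalars_apply, map_smul (aug 𝒜), toRes_smul_gen,
    resAug_tmul]
  rcases i with _ | i
  · have := KPrime_le_tpow 𝒜 0 w.2
    rw [tpow, pow_zero] at this
    obtain ⟨c, hc⟩ := Submodule.mem_one.1 this
    rw [aug_gen_zero, ← hc, AlgHom.commutes, AlgHom.commutes, env_smul_self, unop_op,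
      Algebra.algebraMap_eq_smul_one, Algebra.algebraMap_eq_smul_one, ← TensorProduct.smul_tmul',
      map_smul, barZero_base, mul_smul_comm, mul_smul_comm, mul_one, smul_mul_assoc]
  · have h : ∀ z : KPrime 𝒜 1 ⊗[k] KPrime 𝒜 i,
        barZero 𝒜 A (words 𝒜 (Submodule.mulMap _ _ z) ⊗ₜ b) = 0 := by
      intro z
      induction z with
      | zero => simp
      | add x y hx hy => rw [map_add, map_add, TensorProduct.add_tmul, map_add, hx, hy, add_zero]
      | tmul v u =>
        obtain ⟨v', hv⟩ := KPrime_one_le 𝒜 v.2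
        rw [Submodule.mulMap_tmul, ← hv, words_mul, ← cons_tmul, barZero_cons]
    have := h (decon 𝒜 (add_comm 1 i) w)
    rw [mulMap_decon] at this
    rw [this, aug_gen_succ, mul_zero, smul_zero]

/-- With coefficients in A itself the scalar correction and the A₊-correction add up to the
augmentation. -/
theorem resD_resH_add (h : 𝒜 0 = 1) (q : A ⊗[k] Bar 𝒜 A) :
    resD 𝒜 (leftAct 𝒜) (resH 𝒜 A q) + resH 𝒜 A (resD 𝒜 (leftAct 𝒜) q)
      = q - 1 ⊗ₜ (1 ⊗ₜ resAug 𝒜 q) := by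
  induction q with
  | zero => simp
  | add x y hx hy =>
    simp only [map_add, TensorProduct.tmul_add]
    rw [add_add_add_comm, hx, hy]
    abel
  | tmul a x =>
    rw [resD_resH 𝒜 _ h, resAug_tmul, leftAct_apply]
    have hr := Classical.choose_spec (exists_algebraMap_add 𝒜 h a)
    generalize Classical.choose (exists_algebraMap_add 𝒜 h a) = r at hr ⊢
    nth_rewrite 4 [hr]
    rw [add_mul, TensorProduct.tmul_add, TensorProduct.tmul_add, ← Algebra.smul_def,
      TensorProduct.tmul_smul, TensorProduct.tmul_smul, Algebra.algebraMap_eq_smul_one,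
      TensorProduct.smul_tmul']
    abel

/-- The part of `T(A₊) ⊗ A` of excess at most `e`. -/
def barExcess (e : ℕ) : Submodule k (Bar 𝒜 A) :=
  Submodule.span k {y | ∃ e' ≤ e, ∃ x, ExcessWord 𝒜 e' x ∧ ∃ b : A, y = x ⊗ₜ b}

theorem tmul_mem_barExcess {e e' : ℕ} (h : e' ≤ e) {x : TensorAlgebra k (Aplus 𝒜)}
    (hx : ExcessWord 𝒜 e' x) (b : A) : x ⊗ₜ b ∈ barExcess 𝒜 e :=
  Submodule.subset_span ⟨e', h, x, hx, b, rfl⟩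

theorem cons_mem_barExcess {m e : ℕ} {v : Aplus 𝒜} (hv : (v : A) ∈ 𝒜 (m + 1)) {y : Bar 𝒜 A}
    (hy : y ∈ barExcess 𝒜 e) : TensorAlgebra.ι k v • y ∈ barExcess 𝒜 (m + e) := by
  induction hy using Submodule.span_induction with
  | mem y hy =>
    obtain ⟨e', h, x, hx, b, rfl⟩ := hy
    exact tmul_mem_barExcess 𝒜 (by omega) (.cons v hv hx) b
  | zero => rw [smul_zero]; exact zero_mem _
  | add x y _ _ hx hy => rw [smul_add]; exact add_mem hx hy
  | smul r x _ hx => rw [smul_comm]; exact Submodule.smul_mem _ _ hx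

theorem excessProj_barExcess {e e' : ℕ} (h : e < e') {y : Bar 𝒜 A} (hy : y ∈ barExcess 𝒜 e) :
    (excessProj 𝒜 e').rTensor A y = 0 := by
  induction hy using Submodule.span_induction with
  | mem y hy =>
    obtain ⟨e'', h', x, hx, b, rfl⟩ := hy
    rw [LinearMap.rTensor_tmul, excessProj_of_word 𝒜 hx, if_neg (by omega), TensorProduct.zero_tmul]
  | zero => rw [map_zero]
  | add x y _ _ hx hy => rw [map_add, hx, hy, add_zero]
  | smul r x _ hx => rw [map_smul, hx, smul_zero]

/-- The bar differential is `cobar ⊗ 1` up to terms which do not increase the excess. -/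
theorem barD_sub_mem {e : ℕ} {x : TensorAlgebra k (Aplus 𝒜)} (hx : ExcessWord 𝒜 e x) (b : A) :
    barD 𝒜 (leftAct 𝒜) (x ⊗ₜ b) - cobar 𝒜 x ⊗ₜ b ∈ barExcess 𝒜 e := by
  induction hx with
  | one =>
    rw [barD_base, cobar_one, TensorProduct.zero_tmul, sub_zero]
    exact zero_mem _
  | @cons m e v x hv hx ih =>
    -- The two merges differ only when no letter follows v. Then v acts on b, and the remaining
    -- empty word has excess 0.
    have h1 : barMul 𝒜 (leftAct 𝒜) (x ⊗ₜ b) v - cobarMul 𝒜 x v ⊗ₜ b ∈ barExcess 𝒜 (m + e) := by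
      cases hx with
      | one =>
        rw [barMul_base, cobarMul_one, TensorProduct.zero_tmul, sub_zero]
        exact tmul_mem_barExcess 𝒜 (Nat.zero_le _) .one _
      | cons w hw hx =>
        rw [← cons_tmul, barMul_cons, cobarMul_cons, cons_tmul, sub_self]
        exact zero_mem _
    have h2 := sub_mem h1 (cons_mem_barExcess 𝒜 hv ih)
    rw [← cons_tmul, barD_cons, cobar_cons, TensorProduct.sub_tmul, ← cons_tmul]
    convert h2 using 1
    rw [smul_sub]
    abel

theorem resD_add_cobar_of_word {e e' : ℕ} (h : e < e') (a b : A) {x : TensorAlgebra k (Aplus 𝒜)}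
    (hx : ExcessWord 𝒜 e x) :
    onMiddle A (excessProj 𝒜 e') (resD 𝒜 (leftAct 𝒜) (a ⊗ₜ (x ⊗ₜ b))
      + onMiddle A (cobar 𝒜) (a ⊗ₜ (x ⊗ₜ b))) = 0 := by
  have h1 : onMiddle A (excessProj 𝒜 e') (a • barFirst 𝒜 A (x ⊗ₜ b)) = 0 := by
    cases hx with
    | one => rw [barFirst_base, smul_zero, map_zero]
    | @cons m e v x hv hx =>
      rw [← cons_tmul, barFirst_cons, TensorProduct.smul_tmul', onMiddle_tmul,
        excessProj_of_word 𝒜 hx, if_neg (by omega), TensorProduct.zero_tmul, TensorProduct.tmul_zero]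
  have h2 : onMiddle A (excessProj 𝒜 e')
      (a ⊗ₜ (barD 𝒜 (leftAct 𝒜) (x ⊗ₜ b) - cobar 𝒜 x ⊗ₜ b)) = 0 := by
    rw [onMiddle, LinearMap.lTensor_tmul, excessProj_barExcess 𝒜 h (barD_sub_mem 𝒜 hx b),
      TensorProduct.tmul_zero]
  rw [resD_tmul, onMiddle_tmul, sub_add, ← TensorProduct.tmul_sub, map_sub, h1, h2, sub_zero]

theorem excessProj_excessProj (e e' : ℕ) (x : TensorAlgebra k (Aplus 𝒜)) :
    excessProj 𝒜 e' (excessProj 𝒜 e x) = if e = e' then excessProj 𝒜 e x else 0 := by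
  refine LinearMap.congr_fun (f := excessProj 𝒜 e' ∘ₗ excessProj 𝒜 e)
    (g := if e = e' then excessProj 𝒜 e else 0) (linearMap_ext_words 𝒜 fun e'' x hx => ?_) x |>.trans ?_
  · rw [LinearMap.comp_apply, excessProj_of_word 𝒜 hx]
    by_cases h1 : e'' = e
    · subst h1
      by_cases h2 : e'' = e' <;> simp [h2, excessProj_of_word 𝒜 hx]
    · rw [if_neg h1, map_zero]
      split_ifs
      · rw [excessProj_of_word 𝒜 hx, if_neg h1]
      · rfl
  · split_ifs <;> rfl

theorem resD_add_cobar_excessProj {e e' : ℕ} (h : e < e') (q : A ⊗[k] Bar 𝒜 A) :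
    onMiddle A (excessProj 𝒜 e') (resD 𝒜 (leftAct 𝒜) (onMiddle A (excessProj 𝒜 e) q)
      + onMiddle A (cobar 𝒜) (onMiddle A (excessProj 𝒜 e) q)) = 0 := by
  refine LinearMap.congr_fun (f := onMiddle A (excessProj 𝒜 e') ∘ₗ
    (resD 𝒜 (leftAct 𝒜) + onMiddle A (cobar 𝒜)) ∘ₗ onMiddle A (excessProj 𝒜 e)) (g := 0)
    (linearMap_ext_middle fun a b x => ?_) q
  refine homogeneous_induction 𝒜 (p := fun x => (onMiddle A (excessProj 𝒜 e') ∘ₗ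
    (resD 𝒜 (leftAct 𝒜) + onMiddle A (cobar 𝒜)) ∘ₗ onMiddle A (excessProj 𝒜 e)) (a ⊗ₜ (x ⊗ₜ b))
    = (0 : _ →ₗ[k] _) (a ⊗ₜ (x ⊗ₜ b))) ?_ ?_ ?_ ?_ x
  · rw [TensorProduct.zero_tmul, TensorProduct.tmul_zero, map_zero, map_zero]
  · intro x y hx hy
    rw [TensorProduct.add_tmul, TensorProduct.tmul_add, map_add, hx, hy, map_add]
  · intro r x hx
    rw [← TensorProduct.smul_tmul', TensorProduct.tmul_smul, map_smul, hx, map_smul]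
  · intro e'' x hx
    rw [LinearMap.comp_apply, LinearMap.comp_apply, onMiddle_tmul, excessProj_of_word 𝒜 hx]
    split_ifs with he
    · subst he
      exact resD_add_cobar_of_word 𝒜 h a b hx
    · rw [TensorProduct.zero_tmul, TensorProduct.tmul_zero, map_zero, map_zero]
      rfl

theorem exists_sum_excessProj (q : A ⊗[k] Bar 𝒜 A) :
    ∃ n, ∀ m ≥ n, ∑ e ∈ Finset.range m, onMiddle A (excessProj 𝒜 e) q = q := by
  have hadd : ∀ q q' : A ⊗[k] Bar 𝒜 A,
      (∃ n, ∀ m ≥ n, ∑ e ∈ Finset.range m, onMiddle A (excessProj 𝒜 e) q = q) →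
      (∃ n, ∀ m ≥ n, ∑ e ∈ Finset.range m, onMiddle A (excessProj 𝒜 e) q' = q') →
      ∃ n, ∀ m ≥ n, ∑ e ∈ Finset.range m, onMiddle A (excessProj 𝒜 e) (q + q') = q + q' := by
    rintro q q' ⟨n, hn⟩ ⟨n', hn'⟩
    refine ⟨max n n', fun m hm => ?_⟩
    simp only [map_add, Finset.sum_add_distrib]
    rw [hn m (le_trans (le_max_left _ _) hm), hn' m (le_trans (le_max_right _ _) hm)]
  induction q with
  | zero => exact ⟨0, fun m _ => by simp⟩
  | add q q' hq hq' => exact hadd q q' hq hq'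
  | tmul a y =>
    induction y using TensorProduct.induction_on with
    | zero => exact ⟨0, fun m _ => by simp⟩
    | add y y' hy hy' => rw [TensorProduct.tmul_add]; exact hadd _ _ hy hy'
    | tmul x b =>
      refine homogeneous_induction 𝒜 (p := fun x => ∃ n, ∀ m ≥ n, ∑ e ∈ Finset.range m,
        onMiddle A (excessProj 𝒜 e) (a ⊗ₜ (x ⊗ₜ b)) = a ⊗ₜ (x ⊗ₜ b)) ?_ ?_ ?_ ?_ x
      · exact ⟨0, fun m _ => by simp⟩
      · intro x y hx hy
        rw [TensorProduct.add_tmul, TensorProduct.tmul_add]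
        exact hadd _ _ hx hy
      · rintro r x ⟨n, hn⟩
        refine ⟨n, fun m hm => ?_⟩
        rw [← TensorProduct.smul_tmul', TensorProduct.tmul_smul]
        simp only [map_smul]
        rw [← Finset.smul_sum, hn m hm]
      · intro e x hx
        refine ⟨e + 1, fun m hm => ?_⟩
        rw [Finset.sum_eq_single e]
        · rw [onMiddle_tmul, excessProj_of_word 𝒜 hx, if_pos rfl]
        · intro e' _ he
          rw [onMiddle_tmul, excessProj_of_word 𝒜 hx, if_neg he.symm, TensorProduct.zero_tmul,
            TensorProduct.tmul_zero]
        · intro h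
          exact absurd (Finset.mem_range.2 (by omega)) h

theorem eq_sum_excessProj {e : ℕ} {q : A ⊗[k] Bar 𝒜 A}
    (h : ∀ e' > e, onMiddle A (excessProj 𝒜 e') q = 0) :
    ∑ e' ∈ Finset.range (e + 1), onMiddle A (excessProj 𝒜 e') q = q := by
  obtain ⟨n, hn⟩ := exists_sum_excessProj 𝒜 q
  nth_rewrite 2 [← hn (n + (e + 1)) (by omega)]
  refine Finset.sum_subset (Finset.range_mono (by omega)) fun e' _ he' => h e' ?_
  rw [Finset.mem_range] at he'
  omega

/-- For the excess filtration the leading part of the bar resolution's differential is minus the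
reduced differential: the outer faces remove a letter and cannot raise the excess. -/
theorem excessProj_resD {e e' : ℕ} (he : e < e') {q : A ⊗[k] Bar 𝒜 A}
    (h : ∀ e'' > e, onMiddle A (excessProj 𝒜 e'') q = 0) :
    onMiddle A (excessProj 𝒜 e') (resD 𝒜 (leftAct 𝒜) q)
      = -onMiddle A (excessProj 𝒜 e') (onMiddle A (cobar 𝒜) q) := by
  rw [eq_neg_iff_add_eq_zero, ← map_add, ← eq_sum_excessProj 𝒜 h, map_sum, map_sum,
    ← Finset.sum_add_distrib, map_sum]
  refine Finset.sum_eq_zero fun i hi => resD_add_cobar_excessProj 𝒜 ?_ q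
  rw [Finset.mem_range] at hi
  omega

theorem onMiddle_excessProj_cobar (e : ℕ) (q : A ⊗[k] Bar 𝒜 A) :
    onMiddle A (excessProj 𝒜 (e + 1)) (onMiddle A (cobar 𝒜) q)
      = onMiddle A (cobar 𝒜) (onMiddle A (excessProj 𝒜 e) q) := by
  rw [onMiddle_onMiddle, onMiddle_onMiddle]
  congr 2
  exact LinearMap.ext fun x => cobar_excessProj 𝒜 e x

theorem onMiddle_excessProj_excessProj (e e' : ℕ) (q : A ⊗[k] Bar 𝒜 A) :
    onMiddle A (excessProj 𝒜 e') (onMiddle A (excessProj 𝒜 e) q)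
      = if e = e' then onMiddle A (excessProj 𝒜 e) q else 0 := by
  rw [onMiddle_onMiddle]
  split_ifs with h
  · congr 2
    exact LinearMap.ext fun x => by
      rw [LinearMap.comp_apply, excessProj_excessProj, if_pos h]
  · rw [show excessProj 𝒜 e' ∘ₗ excessProj 𝒜 e = 0 from LinearMap.ext fun x => by
      rw [LinearMap.comp_apply, excessProj_excessProj, if_neg h]; rfl, onMiddle_zero]

/-- Exactness of the bar complex in positive excess, with coefficients. -/
theorem exists_cobar_eq (hA : IsKoszul 𝒜) {e : ℕ} (he : 0 < e) {q : A ⊗[k] Bar 𝒜 A}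
    (hq : onMiddle A (cobar 𝒜) q = 0) :
    ∃ t : A ⊗[k] Bar 𝒜 A, onMiddle A (cobar 𝒜) t = onMiddle A (excessProj 𝒜 e) q := by
  obtain ⟨q, rfl⟩ := exists_onMiddle_of_eq_zero _ hq
  let f : (cobar 𝒜).ker →ₗ[k] LinearMap.range (cobar 𝒜) :=
    LinearMap.codRestrict _ (excessProj 𝒜 e ∘ₗ (cobar 𝒜).ker.subtype)
      fun x => cobar_exact 𝒜 hA he x.2
  -- A linear choice of primitives is needed in order to tensor it with the coefficients on both
  -- sides.
  obtain ⟨s, hs⟩ := (cobar 𝒜).rangeRestrict.exists_rightInverse_of_surjective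
    (LinearMap.range_rangeRestrict _)
  refine ⟨onMiddle A (s ∘ₗ f) q, ?_⟩
  rw [onMiddle_onMiddle, onMiddle_onMiddle]
  congr 2
  refine LinearMap.ext fun x => ?_
  exact congrArg Subtype.val (LinearMap.congr_fun hs (f x))

/-- The top component of a primitive of an element of excess 0 can be removed by adding a boundary,
as long as its excess is positive. Repeat downwards. -/
theorem exists_excess_zero (hA : IsKoszul 𝒜) {z : A ⊗[k] Bar 𝒜 A}
    (hz : ∀ e > 0, onMiddle A (excessProj 𝒜 e) z = 0) (e : ℕ) : ∀ u : A ⊗[k] Bar 𝒜 A,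
    resD 𝒜 (leftAct 𝒜) u = z → (∀ e' > e, onMiddle A (excessProj 𝒜 e') u = 0) →
    ∃ u, resD 𝒜 (leftAct 𝒜) u = z ∧ ∀ e' > 0, onMiddle A (excessProj 𝒜 e') u = 0 := by
  induction e with
  | zero => exact fun u h1 h2 => ⟨u, h1, h2⟩
  | succ e ih =>
    intro u h1 h2
    -- Up to sign this is the component of excess e + 2 of the full boundary z of u, which has only
    -- excess 0.
    have h3 : onMiddle A (cobar 𝒜) (onMiddle A (excessProj 𝒜 (e + 1)) u) = 0 := by
      rw [← onMiddle_excessProj_cobar, ← neg_eq_zero,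
        ← excessProj_resD 𝒜 (Nat.lt_succ_self (e + 1)) h2, h1]
      exact hz _ (Nat.succ_pos _)
    obtain ⟨t, ht⟩ := exists_cobar_eq 𝒜 hA (Nat.succ_pos e) h3
    rw [Nat.succ_eq_add_one, onMiddle_excessProj_excessProj, if_pos rfl] at ht
    have h4 : ∀ e'' > e, onMiddle A (excessProj 𝒜 e'') (onMiddle A (excessProj 𝒜 e) t) = 0 :=
      fun e'' he => by rw [onMiddle_excessProj_excessProj, if_neg (by omega)]
    -- The leading part of the added boundary is minus the reduced boundary of the excess-e
    -- component of t. It cancels the excess-(e + 1) component of u and raises no higher one.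
    refine ih (u + resD 𝒜 (leftAct 𝒜) (onMiddle A (excessProj 𝒜 e) t)) ?_ ?_
    · rw [map_add, h1, resD_resD 𝒜 _ (leftAct_mulPlus 𝒜), add_zero]
    · intro e' he'
      obtain ⟨e', rfl⟩ : ∃ m, e' = m + 1 := ⟨e' - 1, by omega⟩
      rw [map_add, excessProj_resD 𝒜 he' h4, onMiddle_excessProj_cobar,
        onMiddle_excessProj_excessProj]
      split_ifs with h
      · subst h
        rw [← onMiddle_excessProj_cobar, ht, onMiddle_excessProj_excessProj, if_pos rfl,
          add_neg_cancel]
      · rw [h2 _ (by omega), map_zero, neg_zero, add_zero]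

/-- Exactness of the Koszul resolution. -/
theorem exists_d_eq (hA : IsKoszul 𝒜) {z : P 𝒜} (hd : d 𝒜 z = 0) (hz : aug 𝒜 z = 0) :
    ∃ u, d 𝒜 u = z := by
  -- The bar resolution is contractible for any connected A, so a primitive exists there; it need
  -- not come from P.
  have h0 : resD 𝒜 (leftAct 𝒜) (resH 𝒜 A (toRes 𝒜 z)) = toRes 𝒜 z := by
    have := resD_resH_add 𝒜 hA.connected (toRes 𝒜 z)
    rwa [resD_toRes, hd, map_zero, map_zero, add_zero, resAug_toRes, hz, TensorProduct.tmul_zero,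
      TensorProduct.tmul_zero, sub_zero] at this
  have h1 : ∀ e > 0, onMiddle A (excessProj 𝒜 e) (toRes 𝒜 z) = 0 := by
    intro e he
    rw [toRes, LinearMap.comp_apply, onMiddle_onMiddle,
      show excessProj 𝒜 e ∘ₗ (words 𝒜).toLinearMap ∘ₗ sumKPrime 𝒜 = 0 from LinearMap.ext fun x => by
        rw [LinearMap.comp_apply, LinearMap.comp_apply, AlgHom.toLinearMap_apply,
          excessProj_of_mem 𝒜 (words_mem_excess 𝒜 _), if_neg (by omega)]; rfl, onMiddle_zero]
  obtain ⟨n, hn⟩ := exists_sum_excessProj 𝒜 (resH 𝒜 A (toRes 𝒜 z))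
  have hn' : ∀ e > n, onMiddle A (excessProj 𝒜 e) (resH 𝒜 A (toRes 𝒜 z)) = 0 := by
    intro e he
    rw [← hn n le_rfl, map_sum]
    refine Finset.sum_eq_zero fun i hi => ?_
    rw [onMiddle_excessProj_excessProj, if_neg]
    rw [Finset.mem_range] at hi
    omega
  obtain ⟨u, hu, hu'⟩ := exists_excess_zero 𝒜 hA h1 n _ h0 hn'
  have h2 : onMiddle A (excessProj 𝒜 0) u = u := by
    have := eq_sum_excessProj 𝒜 hu'
    rwa [zero_add, Finset.sum_range_one] at this
  -- The primitive u now has excess 0, and the excess-1 part of its boundary is minus its reduced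
  -- boundary. As z has no excess-1 part, u is a reduced cycle.
  have h3 : onMiddle A (cobar 𝒜) u = 0 := by
    have := excessProj_resD 𝒜 Nat.zero_lt_one hu'
    rw [hu, h1 1 Nat.one_pos] at this
    have h4 := onMiddle_excessProj_cobar 𝒜 0 u
    rw [h2, zero_add] at h4
    rw [← h4, ← neg_eq_zero, ← this]
  -- Excess 0 means that all letters have degree 1, so u comes from A ⊗ T(V) ⊗ A.
  have h5 : u = onMiddle A (words 𝒜).toLinearMap (onMiddle A (wordsProj 𝒜).toLinearMap u) := by
    rw [onMiddle_onMiddle, show (words 𝒜).toLinearMap ∘ₗ (wordsProj 𝒜).toLinearMap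
      = excessProj 𝒜 0 from LinearMap.ext fun x => words_wordsProj 𝒜 x, h2]
  generalize onMiddle A (wordsProj 𝒜).toLinearMap u = u' at h5
  have h6 : onMiddle A (cobar 𝒜 ∘ₗ (words 𝒜).toLinearMap) u' = 0 := by
    rw [← onMiddle_onMiddle, ← h5, h3]
  obtain ⟨w, rfl⟩ := exists_onMiddle_of_eq_zero _ h6
  -- Cycles in words of degree-1 letters are exactly ⨁ K'_i, so u lies in the image of P, where
  -- injectivity of `toRes` finishes the argument.
  have h7 : ∃ w', onMiddle A (sumKPrime 𝒜) w' = onMiddle A (Submodule.subtype _) w := by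
    let f : (⨁ i : ℕ, KPrime 𝒜 i) →ₗ[k] (cobar 𝒜 ∘ₗ (words 𝒜).toLinearMap).ker :=
      LinearMap.codRestrict _ (sumKPrime 𝒜) fun w => by
        induction w using DirectSum.induction_on with
        | zero => rw [map_zero]; exact zero_mem _
        | add x y hx hy => rw [map_add]; exact add_mem hx hy
        | of i w =>
          have : sumKPrime 𝒜 (DirectSum.of (fun i => KPrime 𝒜 i) i w) = w := sumKPrime_lof 𝒜 i w
          rw [this]
          exact cobar_words_KPrime 𝒜 i w.2
    have hf : Function.Surjective f := fun x => by
      obtain ⟨y, hy⟩ := exists_sumKPrime 𝒜 x.2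
      exact ⟨y, Subtype.ext hy⟩
    obtain ⟨w', rfl⟩ := LinearMap.lTensor_surjective A (LinearMap.rTensor_surjective A hf) w
    exact ⟨w', (onMiddle_onMiddle (Submodule.subtype _) f w').symm⟩
  obtain ⟨w', hw'⟩ := h7
  refine ⟨(middleP 𝒜).symm w', toRes_injective 𝒜 ?_⟩
  rw [← resD_toRes, toRes, LinearMap.comp_apply, LinearEquiv.coe_coe, LinearEquiv.apply_symm_apply,
    ← onMiddle_onMiddle, hw', ← h5, hu]
  rfl

end Exactness
end Koszul


namespace Koszul

open scoped TensorProduct DirectSum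
open MulOpposite AInfinity

/-! ### A contracting homotopy of right modules -/

section Homotopy

variable {k A : Type*} [Field k] [Ring A] [Algebra k A] (𝒜 : ℕ → Submodule k A)

/-- The generator of `K'_0 = k`. -/
noncomputable def oneKPrime : KPrime 𝒜 0 :=
  ⟨1, by
    refine Submodule.mem_inf.2 ⟨by rw [tpow, pow_zero]; exact Submodule.one_le.1 le_rfl, ?_⟩
    simp only [Submodule.mem_iInf]
    intro j l h
    omega⟩

theorem coe_oneKPrime : (oneKPrime 𝒜 : TensorAlgebra k (𝒜 1)) = 1 := rfl

/-- The generator `1 ⊗ 1 ⊗ 1` of `P_1`. -/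
noncomputable def genOne : P 𝒜 := gen 𝒜 0 (oneKPrime 𝒜)

theorem genOne_mem : genOne 𝒜 ∈ grP 𝒜 1 := by
  have := gen_mem 𝒜 0 (oneKPrime 𝒜)
  rwa [Nat.cast_zero, sub_zero] at this

theorem aug_genOne : aug 𝒜 (genOne 𝒜) = 1 := by
  rw [genOne, aug_gen_zero, coe_oneKPrime, map_one]

theorem d_genOne : d 𝒜 (genOne 𝒜) = 0 := d_gen_zero 𝒜 _

theorem aug_of_mem {j : ℤ} (hj : j ≠ 1) {z : P 𝒜} (hz : z ∈ grP 𝒜 j) : aug 𝒜 z = 0 := by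
  refine grP_induction 𝒜 (p := fun z => aug 𝒜 z = 0) (map_zero _)
    (fun x y hx hy => by rw [map_add, hx, hy, add_zero])
    (fun e x hx => by rw [map_smul, hx, smul_zero]) (fun i w h => ?_) hz
  rcases i with _ | i
  · exact absurd (by rw [← h]; simp) hj
  · exact aug_gen_succ 𝒜 i w

theorem aug_d (z : P 𝒜) : aug 𝒜 (d 𝒜 z) = 0 := by
  refine LinearMap.congr_fun (f := aug 𝒜 ∘ₗ d 𝒜) (g := 0) (hom_ext fun i w => ?_) z
  rw [LinearMap.comp_apply, LinearMap.zero_apply]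
  rcases i with _ | _ | i
  · rw [d_gen_zero, map_zero]
  · have h1 : ∀ z : KPrime 𝒜 1 ⊗[k] KPrime 𝒜 0,
        aug 𝒜 (leftMul 𝒜 0 z) = toA 𝒜 (Submodule.mulMap _ _ z) := fun z => by
      induction z with
      | zero => simp
      | add x y hx hy => simp only [map_add, hx, hy]
      | tmul v u =>
        rw [leftMul, TensorProduct.lift.tmul, LinearMap.mk₂_apply, map_smul, aug_gen_zero,
          env_smul_self, Submodule.mulMap_tmul, map_mul, unop_one, mul_one]
        rfl
    have h2 : ∀ z : KPrime 𝒜 0 ⊗[k] KPrime 𝒜 1,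
        aug 𝒜 (rightMul 𝒜 0 z) = toA 𝒜 (Submodule.mulMap _ _ z) := fun z => by
      induction z with
      | zero => simp
      | add x y hx hy => simp only [map_add, hx, hy]
      | tmul v u =>
        rw [rightMul, TensorProduct.lift.tmul, LinearMap.mk₂_apply, map_smul, aug_gen_zero,
          env_smul_self, Submodule.mulMap_tmul, map_mul, unop_op, one_mul]
        rfl
    rw [d_gen_succ, map_add, LinearMap.map_smul_of_tower, h1, h2, mulMap_decon, mulMap_decon, neg_one_pow_succ_smul,
      pow_zero, one_smul, add_neg_cancel]
  · refine aug_of_mem 𝒜 ?_ (d_gen_mem 𝒜 (i + 2) w)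
    push_cast
    omega

/-- The projection of `P` to its part of degree `j`. -/
noncomputable def projP (j : ℤ) : P 𝒜 →ₗ[Env k A] P 𝒜 :=
  (grP 𝒜 j).subtype ∘ₗ DirectSum.component (Env k A) ℤ (fun j => grP 𝒜 j) j ∘ₗ
    (DirectSum.decomposeLinearEquiv (grP 𝒜)).toLinearMap

theorem projP_mem (j : ℤ) (z : P 𝒜) : projP 𝒜 j z ∈ grP 𝒜 j := Subtype.property _

theorem projP_of_mem {i j : ℤ} {z : P 𝒜} (hz : z ∈ grP 𝒜 i) :
    projP 𝒜 j z = if i = j then z else 0 := by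
  split_ifs with h
  · subst h
    exact DirectSum.decompose_of_mem_same (grP 𝒜) hz
  · exact DirectSum.decompose_of_mem_ne (grP 𝒜) hz h

theorem mem_grP_induction {p : P 𝒜 → Prop} (h0 : p 0) (hadd : ∀ x y, p x → p y → p (x + y))
    (h : ∀ j, ∀ x ∈ grP 𝒜 j, p x) (x : P 𝒜) : p x := by
  classical
  rw [← DirectSum.sum_support_decompose (grP 𝒜) x]
  exact Finset.sum_induction _ p hadd h0 fun j _ => h j _ (Subtype.property _)

theorem grP_induction_smul {j : ℤ} {p : P 𝒜 → Prop} (h0 : p 0)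
    (hadd : ∀ x y, p x → p y → p (x + y))
    (hgen : ∀ (a b : A) (i : ℕ) (w : KPrime 𝒜 i), 1 - (i : ℤ) = j →
      p ((a ⊗ₜ[k] op b : Env k A) • gen 𝒜 i w)) {x : P 𝒜} (hx : x ∈ grP 𝒜 j) : p x := by
  have : ∀ e : Env k A, p (e • x) := by
    refine grP_induction 𝒜 (p := fun x => ∀ e : Env k A, p (e • x)) ?_ ?_ ?_ ?_ hx
    · intro e
      rwa [smul_zero]
    · intro x y hx hy e
      rw [smul_add]
      exact hadd _ _ (hx e) (hy e)
    · intro e' x hx e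
      rw [← mul_smul]
      exact hx _
    · intro i w hi e
      induction e using TensorProduct.induction_on with
      | zero =>
        have h1 : (0 : Env k A) • gen 𝒜 i w = 0 := zero_smul (Env k A) (gen 𝒜 i w)
        exact h1.symm ▸ h0
      | add e e' he he' => rw [add_smul]; exact hadd _ _ he he'
      | tmul a b => exact hgen a b.unop i w hi
  have h1 := this 1
  rwa [one_smul] at h1

theorem d_projP (j : ℤ) (z : P 𝒜) : d 𝒜 (projP 𝒜 j z) = projP 𝒜 (j + 1) (d 𝒜 z) := by
  refine mem_grP_induction 𝒜 (p := fun z => d 𝒜 (projP 𝒜 j z) = projP 𝒜 (j + 1) (d 𝒜 z))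
    (by simp) (fun x y hx hy => by simp only [map_add, hx, hy]) (fun i z hz => ?_) z
  rw [projP_of_mem 𝒜 hz, projP_of_mem 𝒜 (d_mem 𝒜 hz)]
  by_cases h : i = j <;> simp [h]

/-- `z ⊗ b ↦ z b`. -/
noncomputable def rightSMul : P 𝒜 →ₗ[k] A →ₗ[k] P 𝒜 :=
  LinearMap.mk₂ k (fun z b => ((1 : A) ⊗ₜ[k] op b : Env k A) • z)
    (fun z z' b => smul_add _ z z')
    (fun r z b => smul_comm _ r z)
    (fun z b b' => by rw [op_add, TensorProduct.tmul_add, add_smul])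
    (fun r z b => by rw [op_smul, TensorProduct.tmul_smul, smul_assoc])

/-- The right `A`-linear map `P → P` with prescribed values on `a ⊗ w ⊗ 1`. -/
noncomputable def rightLift (φ : ∀ i, KPrime 𝒜 i →ₗ[k] A →ₗ[k] P 𝒜) : P 𝒜 →ₗ[k] P 𝒜 :=
  TensorProduct.lift (rightSMul 𝒜) ∘ₗ
    (TensorProduct.lift (DirectSum.toModule k ℕ (A →ₗ[k] P 𝒜) φ).flip).rTensor A ∘ₗ
    (TensorProduct.assoc k A (⨁ i : ℕ, KPrime 𝒜 i) A).symm.toLinearMap ∘ₗ (middleP 𝒜).toLinearMap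

theorem rightLift_smul_gen (φ : ∀ i, KPrime 𝒜 i →ₗ[k] A →ₗ[k] P 𝒜) (a b : A) (i : ℕ)
    (w : KPrime 𝒜 i) : rightLift 𝒜 φ ((a ⊗ₜ[k] op b : Env k A) • gen 𝒜 i w)
      = ((1 : A) ⊗ₜ[k] op b : Env k A) • φ i w a := by
  simp only [rightLift, LinearMap.comp_apply, LinearEquiv.coe_coe]
  rw [middleP_smul_gen, TensorProduct.assoc_symm_tmul, LinearMap.rTensor_tmul,
    TensorProduct.lift.tmul, TensorProduct.lift.tmul, LinearMap.flip_apply,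
    DirectSum.toModule_lof]
  rfl

theorem rightLift_smul (φ : ∀ i, KPrime 𝒜 i →ₗ[k] A →ₗ[k] P 𝒜) (b : A) (z : P 𝒜) :
    rightLift 𝒜 φ (((1 : A) ⊗ₜ[k] op b : Env k A) • z)
      = ((1 : A) ⊗ₜ[k] op b : Env k A) • rightLift 𝒜 φ z := by
  refine LinearMap.congr_fun
    (f := rightLift 𝒜 φ ∘ₗ DistribSMul.toLinearMap k (P 𝒜) ((1 : A) ⊗ₜ[k] op b : Env k A))
    (g := DistribSMul.toLinearMap k (P 𝒜) ((1 : A) ⊗ₜ[k] op b : Env k A) ∘ₗ rightLift 𝒜 φ)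
    (linearMap_ext_P 𝒜 fun a b' i w => ?_) z
  simp only [LinearMap.comp_apply, DistribSMul.toLinearMap_apply, ← mul_smul,
    Algebra.TensorProduct.tmul_mul_tmul, one_mul, ← op_mul, rightLift_smul_gen]

/-- The projection of `P` to the right submodule generated by `1 ⊗ 1 ⊗ 1`. -/
noncomputable def augProj : P 𝒜 →ₗ[k] P 𝒜 where
  toFun z := ((1 : A) ⊗ₜ[k] op (aug 𝒜 z) : Env k A) • genOne 𝒜
  map_add' z z' := by rw [map_add, op_add, TensorProduct.tmul_add, add_smul]
  map_smul' r z := by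
    rw [LinearMap.map_smul_of_tower, op_smul, TensorProduct.tmul_smul, smul_assoc, RingHom.id_apply]

theorem augProj_apply (z : P 𝒜) :
    augProj 𝒜 z = ((1 : A) ⊗ₜ[k] op (aug 𝒜 z) : Env k A) • genOne 𝒜 := rfl

theorem aug_augProj (z : P 𝒜) : aug 𝒜 (augProj 𝒜 z) = aug 𝒜 z := by
  rw [augProj_apply, map_smul, aug_genOne, env_smul_self, one_mul, one_mul, unop_op]

theorem d_augProj (z : P 𝒜) : d 𝒜 (augProj 𝒜 z) = 0 := by
  rw [augProj_apply, map_smul, d_genOne, smul_zero]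

theorem augProj_smul (b : A) (z : P 𝒜) : augProj 𝒜 (((1 : A) ⊗ₜ[k] op b : Env k A) • z)
    = ((1 : A) ⊗ₜ[k] op b : Env k A) • augProj 𝒜 z := by
  rw [augProj_apply, augProj_apply, map_smul, env_smul_self, ← mul_smul,
    Algebra.TensorProduct.tmul_mul_tmul, one_mul, one_mul, unop_op, op_mul]

theorem augProj_of_mem {j : ℤ} (hj : j ≠ 1) {z : P 𝒜} (hz : z ∈ grP 𝒜 j) : augProj 𝒜 z = 0 := by
  rw [augProj_apply, aug_of_mem 𝒜 hj hz, op_zero, TensorProduct.tmul_zero]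
  exact zero_smul (Env k A) (genOne 𝒜)

theorem augProj_mem (z : P 𝒜) : augProj 𝒜 z ∈ grP 𝒜 1 := Submodule.smul_mem _ _ (genOne_mem 𝒜)

/-- `a ⊗ w ↦ a ⊗ w ⊗ 1`. -/
noncomputable def leftGen (i : ℕ) : KPrime 𝒜 i →ₗ[k] A →ₗ[k] P 𝒜 :=
  LinearMap.mk₂ k (fun w a => (a ⊗ₜ[k] (1 : Aᵐᵒᵖ) : Env k A) • gen 𝒜 i w)
    (fun w w' a => by rw [map_add, smul_add])
    (fun r w a => by rw [map_smul, smul_comm])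
    (fun w a a' => by rw [TensorProduct.add_tmul, add_smul])
    (fun r w a => by rw [← TensorProduct.smul_tmul', smul_assoc])

/-- The components of a contracting homotopy built from a section `s` of `d`. -/
noncomputable def homotopyAux (s : P 𝒜 →ₗ[k] P 𝒜) : ∀ i, KPrime 𝒜 i →ₗ[k] A →ₗ[k] P 𝒜
  | 0 => (leftGen 𝒜 0).compr₂ ((projP 𝒜 0).restrictScalars k ∘ₗ s ∘ₗ (LinearMap.id - augProj 𝒜))
  | i + 1 => (leftGen 𝒜 (i + 1)).compr₂ ((projP 𝒜 (1 - ((i + 2 : ℕ) : ℤ))).restrictScalars k ∘ₗ s ∘ₗ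
      -- The differential maps the part of index i + 1 into the part of index i, so only the
      -- component built one step earlier is needed.
      (LinearMap.id - rightLift 𝒜 (Pi.single i (homotopyAux s i)) ∘ₗ (d 𝒜).restrictScalars k))

variable [GradedAlgebra 𝒜]

/-- The Koszul resolution is contractible over `A`, as a complex of right modules. -/
theorem exists_homotopy (hA : IsKoszul 𝒜) : ∃ h : P 𝒜 →ₗ[k] P 𝒜,
    (∀ b z, h (((1 : A) ⊗ₜ[k] op b : Env k A) • z) = ((1 : A) ⊗ₜ[k] op b : Env k A) • h z) ∧
    (∀ j, ∀ z ∈ grP 𝒜 j, h z ∈ grP 𝒜 (j - 1)) ∧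
    ∀ z, d 𝒜 (h z) + h (d 𝒜 z) = z - augProj 𝒜 z := by
  obtain ⟨s', hs'⟩ := ((d 𝒜).restrictScalars k).rangeRestrict.exists_rightInverse_of_surjective
    (LinearMap.range_rangeRestrict _)
  obtain ⟨s, hs⟩ := LinearMap.exists_extend s'
  -- A merely k-linear section of d suffices: it is applied only to elements a ⊗ w ⊗ 1, and the rest
  -- is right linear extension, P being free on the right over A ⊗ ⨁ K'_i.
  have hsd : ∀ z, d 𝒜 z = 0 → aug 𝒜 z = 0 → d 𝒜 (s z) = z := by
    intro z h1 h2
    obtain ⟨u, rfl⟩ := exists_d_eq 𝒜 hA h1 h2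
    have h3 := LinearMap.congr_fun hs ⟨d 𝒜 u, u, rfl⟩
    rw [LinearMap.comp_apply, Submodule.subtype_apply] at h3
    have h4 := LinearMap.congr_fun hs' ⟨d 𝒜 u, u, rfl⟩
    rw [h3]
    exact congrArg Subtype.val h4
  let h := rightLift 𝒜 (homotopyAux 𝒜 s)
  have hone : ∀ (a : A) (i : ℕ) (w : KPrime 𝒜 i),
      h ((a ⊗ₜ[k] op 1 : Env k A) • gen 𝒜 i w) = homotopyAux 𝒜 s i w a := fun a i w => by
    rw [rightLift_smul_gen]
    exact one_smul (Env k A) _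
  have hmem : ∀ j, ∀ z ∈ grP 𝒜 j, h z ∈ grP 𝒜 (j - 1) := by
    intro j z hz
    refine grP_induction_smul 𝒜 (p := fun z => h z ∈ grP 𝒜 (j - 1))
      (by rw [map_zero]; exact zero_mem _) (fun x y hx hy => by rw [map_add]; exact add_mem hx hy)
      (fun a b i w hi => ?_) hz
    rw [rightLift_smul_gen]
    refine Submodule.smul_mem _ _ ?_
    rcases i with _ | i
    · rw [show j - 1 = 0 by rw [← hi]; simp]
      exact projP_mem 𝒜 0 _
    · rw [show j - 1 = 1 - ((i + 2 : ℕ) : ℤ) by rw [← hi]; push_cast; ring]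
      exact projP_mem 𝒜 _ _
  have hloc : ∀ i : ℕ, ∀ z ∈ grP 𝒜 (1 - (i : ℤ)),
      rightLift 𝒜 (Pi.single i (homotopyAux 𝒜 s i)) z = h z := by
    intro i z hz
    refine grP_induction_smul 𝒜
      (p := fun z => rightLift 𝒜 (Pi.single i (homotopyAux 𝒜 s i)) z = h z)
      (by rw [map_zero, map_zero]) (fun x y hx hy => by rw [map_add, map_add, hx, hy])
      (fun a b i' w hi => ?_) hz
    obtain rfl : i' = i := by omega
    rw [rightLift_smul_gen, rightLift_smul_gen, Pi.single_eq_same]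
  -- Both sides of the homotopy equation are right linear, so it may be checked on a ⊗ w ⊗ 1.
  have hred : ∀ i : ℕ, (∀ a w, d 𝒜 (h ((a ⊗ₜ[k] op 1 : Env k A) • gen 𝒜 i w))
      + h (d 𝒜 ((a ⊗ₜ[k] op 1 : Env k A) • gen 𝒜 i w)) = (a ⊗ₜ[k] op 1 : Env k A) • gen 𝒜 i w
        - augProj 𝒜 ((a ⊗ₜ[k] op 1 : Env k A) • gen 𝒜 i w)) →
      ∀ z ∈ grP 𝒜 (1 - (i : ℤ)), d 𝒜 (h z) + h (d 𝒜 z) = z - augProj 𝒜 z := by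
    intro i H z hz
    refine grP_induction_smul 𝒜 (p := fun z => d 𝒜 (h z) + h (d 𝒜 z) = z - augProj 𝒜 z)
      (by simp) (fun x y hx hy => ?_) (fun a b i' w hi => ?_) hz
    · simp only [map_add]
      rw [add_add_add_comm, hx, hy]
      abel
    · obtain rfl : i' = i := by omega
      have h1 : (a ⊗ₜ[k] op b : Env k A) • gen 𝒜 i' w = ((1 : A) ⊗ₜ[k] op b : Env k A) •
          (a ⊗ₜ[k] op 1 : Env k A) • gen 𝒜 i' w := by
        rw [← mul_smul, Algebra.TensorProduct.tmul_mul_tmul, one_mul, op_one, mul_one]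
      rw [h1, rightLift_smul, map_smul (d 𝒜), map_smul (d 𝒜), rightLift_smul, augProj_smul,
        ← smul_add, H, smul_sub]
  have key : ∀ i : ℕ, ∀ z ∈ grP 𝒜 (1 - (i : ℤ)), d 𝒜 (h z) + h (d 𝒜 z) = z - augProj 𝒜 z := by
    intro i
    induction i with
    | zero =>
      refine hred _ fun a w => ?_
      have hd : d 𝒜 ((a ⊗ₜ[k] op 1 : Env k A) • gen 𝒜 0 w) = 0 := by
        rw [map_smul, d_gen_zero, smul_zero]
      have hx : (a ⊗ₜ[k] op 1 : Env k A) • gen 𝒜 0 w ∈ grP 𝒜 1 := by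
        have := Submodule.smul_mem _ (a ⊗ₜ[k] op 1 : Env k A) (gen_mem 𝒜 0 w)
        rwa [Nat.cast_zero, sub_zero] at this
      rw [hd, map_zero, add_zero, hone]
      change d 𝒜 (projP 𝒜 0 (s ((a ⊗ₜ[k] op 1 : Env k A) • gen 𝒜 0 w
        - augProj 𝒜 ((a ⊗ₜ[k] op 1 : Env k A) • gen 𝒜 0 w)))) = _
      generalize (a ⊗ₜ[k] op 1 : Env k A) • gen 𝒜 0 w = x at hd hx
      rw [d_projP, hsd _ (by rw [map_sub, hd, d_augProj, sub_zero])
        (by rw [map_sub, aug_augProj, sub_self]), zero_add,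
        projP_of_mem 𝒜 (sub_mem hx (augProj_mem 𝒜 x)), if_pos rfl]
    | succ i ih =>
      refine hred _ fun a w => ?_
      have hx := Submodule.smul_mem _ (a ⊗ₜ[k] op 1 : Env k A) (gen_mem 𝒜 (i + 1) w)
      have hdx := d_mem 𝒜 hx
      rw [show 1 - ((i + 1 : ℕ) : ℤ) + 1 = 1 - (i : ℤ) by push_cast; ring] at hdx
      have hstep : h ((a ⊗ₜ[k] op 1 : Env k A) • gen 𝒜 (i + 1) w)
          = projP 𝒜 (1 - ((i + 2 : ℕ) : ℤ)) (s ((a ⊗ₜ[k] op 1 : Env k A) • gen 𝒜 (i + 1) w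
            - h (d 𝒜 ((a ⊗ₜ[k] op 1 : Env k A) • gen 𝒜 (i + 1) w)))) := by
        rw [hone, ← hloc i _ hdx]
        rfl
      rw [hstep]
      generalize (a ⊗ₜ[k] op 1 : Env k A) • gen 𝒜 (i + 1) w = x at hx hdx
      have hne : 1 - ((i + 1 : ℕ) : ℤ) ≠ 1 := by push_cast; omega
      have hhx := hmem _ _ hdx
      rw [show 1 - (i : ℤ) - 1 = 1 - ((i + 1 : ℕ) : ℤ) by push_cast; ring] at hhx
      -- The homotopy equation for dx, together with d² = 0 and ε d = 0, gives d h(dx) = dx. Hence x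
      -- - h(dx) is a cycle to which the section applies.
      have hd : d 𝒜 (x - h (d 𝒜 x)) = 0 := by
        have h1 := ih _ hdx
        rw [d_d, map_zero, add_zero] at h1
        rw [map_sub, h1, augProj_apply, aug_d, op_zero, TensorProduct.tmul_zero, sub_sub_cancel]
        exact zero_smul (Env k A) (genOne 𝒜)
      rw [d_projP, hsd _ hd (by rw [map_sub, aug_of_mem 𝒜 hne hx, aug_of_mem 𝒜 hne hhx, sub_zero]),
        show 1 - ((i + 2 : ℕ) : ℤ) + 1 = 1 - ((i + 1 : ℕ) : ℤ) by push_cast; ring,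
        projP_of_mem 𝒜 (sub_mem hx hhx), if_pos rfl, augProj_of_mem 𝒜 hne hx, sub_zero,
        sub_add_cancel]
  refine ⟨h, rightLift_smul 𝒜 _, hmem, fun z => ?_⟩
  refine LinearMap.congr_fun (f := (d 𝒜).restrictScalars k ∘ₗ h + h ∘ₗ (d 𝒜).restrictScalars k)
    (g := LinearMap.id - augProj 𝒜) (linearMap_ext_P 𝒜 fun a b i w => ?_) z
  exact key i _ (Submodule.smul_mem _ _ (gen_mem 𝒜 i w))

end Homotopy
end Koszul


namespace Koszul

open scoped TensorProduct DirectSum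
open MulOpposite AInfinity

/-! ### Cycles of low degree in the tensor powers of P are boundaries -/

section Primitive

variable {k A : Type*} [Field k] [Ring A] [Algebra k A] (𝒜 : ℕ → Submodule k A)

/-- The operator `c x ↦ ε(c) x` on `T(P)`. -/
noncomputable def augT : T k A (P 𝒜) →ₗ[k] T k A (P 𝒜) :=
  contraction ((T.inl k A (P 𝒜)).toLinearMap ∘ₗ (aug 𝒜).restrictScalars k) fun c b => by
    simp only [LinearMap.comp_apply, LinearMap.restrictScalars_apply, map_smul, env_smul_self,
      one_mul, unop_op, AlgHom.toLinearMap_apply, map_mul]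

theorem augT_ι_mul (c : P 𝒜) (x : T k A (P 𝒜)) :
    augT 𝒜 (T.ι k A (P 𝒜) c * x) = T.inl k A (P 𝒜) (aug 𝒜 c) * x :=
  contraction_ι_mul _ _ c x

variable [GradedAlgebra 𝒜]

theorem dT_ι_mul {j : ℤ} {c : P 𝒜} (hc : c ∈ grP 𝒜 j) (x : T k A (P 𝒜)) :
    dT 𝒜 (T.ι k A (P 𝒜) c * x) = T.ι k A (P 𝒜) (d 𝒜 c) * x
      + (j.negOnePow : ℤ) • (T.ι k A (P 𝒜) c * dT 𝒜 x) := by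
  rw [dT, derivation_mul (grP 𝒜) 1 _ (ι_mem_tensorPow hc), derivation_ι, one_mul]
  rfl

theorem dT_inl_mul (a : A) (x : T k A (P 𝒜)) :
    dT 𝒜 (T.inl k A (P 𝒜) a * x) = T.inl k A (P 𝒜) a * dT 𝒜 x := by
  rw [dT, derivation_mul (grP 𝒜) 1 _ (inl_mem_tensorPow (grP 𝒜) a), derivation_inl]
  simp

theorem dT_genOne_mul (x : T k A (P 𝒜)) :
    dT 𝒜 (T.ι k A (P 𝒜) (genOne 𝒜) * x) = -(T.ι k A (P 𝒜) (genOne 𝒜) * dT 𝒜 x) := by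
  rw [dT_ι_mul 𝒜 (genOne_mem 𝒜), d_genOne, map_zero, zero_mul, zero_add]
  simp

/-- The augmentation kills boundaries and is supported in degree 1, where the Koszul sign of moving
the differential past the first factor is -1. -/
theorem dT_augT {n : ℕ} {m : ℤ} {y : T k A (P 𝒜)} (hy : y ∈ tensorPow (grP 𝒜) (n + 1) m) :
    dT 𝒜 (augT 𝒜 y) = -augT 𝒜 (dT 𝒜 y) := by
  refine tensorPow_succ_induction_left (p := fun y => dT 𝒜 (augT 𝒜 y) = -augT 𝒜 (dT 𝒜 y))
    (by simp) (fun x y hx hy => by rw [map_add, map_add, hx, hy, map_add, map_add, neg_add])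
    (fun j x c _ hc => ?_) hy
  rw [dT_ι_mul 𝒜 hc, map_add, map_zsmul, augT_ι_mul, augT_ι_mul, augT_ι_mul, aug_d, map_zero,
    zero_mul, zero_add, dT_inl_mul]
  by_cases hj : j = 1
  · subst hj
    simp
  · rw [aug_of_mem 𝒜 hj hc, map_zero, zero_mul, smul_zero, neg_zero]

theorem augT_mem {n : ℕ} {m : ℤ} {y : T k A (P 𝒜)} (hy : y ∈ tensorPow (grP 𝒜) (n + 1) m) :
    augT 𝒜 y ∈ tensorPow (grP 𝒜) n (m - 1) := by
  refine tensorPow_succ_induction_left (p := fun y => augT 𝒜 y ∈ tensorPow (grP 𝒜) n (m - 1))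
    (by simp) (fun x y hx hy => by rw [map_add]; exact add_mem hx hy)
    (fun j x c hx hc => ?_) hy
  rw [augT_ι_mul]
  by_cases hj : j = 1
  · subst hj
    exact mul_mem_tensorPow' (inl_mem_tensorPow (grP 𝒜) _) hx (zero_add _) (zero_add _)
  · rw [aug_of_mem 𝒜 hj hc, map_zero, zero_mul]
    exact zero_mem _

/-- Cycles of `P^{⊗_A N}` of degree less than `N` are boundaries. -/
theorem exists_primitive (hA : IsKoszul 𝒜) : ∃ S : ℕ → T k A (P 𝒜) →ₗ[k] T k A (P 𝒜),
    ∀ N m, ∀ y ∈ tensorPow (grP 𝒜) N m, m < N → dT 𝒜 y = 0 →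
      dT 𝒜 (S N y) = y ∧ S N y ∈ tensorPow (grP 𝒜) N (m - 1) := by
  obtain ⟨h, hsmul, hmem, hh⟩ := exists_homotopy 𝒜 hA
  let H : T k A (P 𝒜) →ₗ[k] T k A (P 𝒜) :=
    contraction ((T.ι k A (P 𝒜)).restrictScalars k ∘ₗ h) fun c b => by
      rw [LinearMap.comp_apply, hsmul, LinearMap.comp_apply, LinearMap.restrictScalars_apply,
        LinearMap.restrictScalars_apply, ι_mul_inl]
  have hH : ∀ c x, H (T.ι k A (P 𝒜) c * x) = T.ι k A (P 𝒜) (h c) * x := fun c x =>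
    contraction_ι_mul _ _ c x
  let g := T.ι k A (P 𝒜) (genOne 𝒜)
  -- The homotopy acts on the first factor. The terms in which the differential hits the other
  -- factors cancel, because h shifts the degree by one and so flips their sign.
  have hHd : ∀ n m, ∀ y ∈ tensorPow (grP 𝒜) (n + 1) m,
      dT 𝒜 (H y) + H (dT 𝒜 y) = y - g * augT 𝒜 y := by
    intro n m y hy
    refine tensorPow_succ_induction_left
      (p := fun y => dT 𝒜 (H y) + H (dT 𝒜 y) = y - g * augT 𝒜 y)
      (by simp) (fun x y hx hy => ?_) (fun j x c _ hc => ?_) hy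
    · simp only [map_add, mul_add]
      rw [add_add_add_comm, hx, hy]
      abel
    · have h1 : T.ι k A (P 𝒜) (augProj 𝒜 c) = g * T.inl k A (P 𝒜) (aug 𝒜 c) := by
        rw [augProj_apply, ← ι_mul_inl]
      rw [hH, dT_ι_mul 𝒜 (hmem j c hc), dT_ι_mul 𝒜 hc, map_add, map_zsmul, hH, hH, augT_ι_mul,
        ← mul_assoc, ← h1, ← sub_mul, ← map_sub, ← hh, map_add, add_mul, Int.negOnePow_sub,
        Int.negOnePow_one]
      simp only [Units.val_neg, mul_neg, mul_one, neg_smul]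
      abel
  have hHmem : ∀ n m, ∀ y ∈ tensorPow (grP 𝒜) (n + 1) m,
      H y ∈ tensorPow (grP 𝒜) (n + 1) (m - 1) := by
    intro n m y hy
    refine tensorPow_succ_induction_left (p := fun y => H y ∈ tensorPow (grP 𝒜) (n + 1) (m - 1))
      (by simp) (fun x y hx hy => by rw [map_add]; exact add_mem hx hy)
      (fun j x c hx hc => ?_) hy
    rw [hH]
    exact mul_mem_tensorPow' (ι_mem_tensorPow (hmem j c hc)) hx (add_comm 1 n) (by ring)
  -- The homotopy on the first factor misses y by g·ε(y). The element ε(y) has one factor less and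
  -- is again a cycle; since g is a cycle of degree 1, subtracting g times a primitive of ε(y)
  -- repairs this. S is linear and can therefore be used to define maps on generators.
  let S : ℕ → T k A (P 𝒜) →ₗ[k] T k A (P 𝒜) := fun N => Nat.rec 0
    (fun _ S => H - LinearMap.mulLeft k g ∘ₗ S ∘ₗ augT 𝒜) N
  have hS : ∀ N y, S (N + 1) y = H y - g * S N (augT 𝒜 y) := fun N y => rfl
  refine ⟨S, fun N => ?_⟩
  induction N with
  | zero =>
    intro m y hy hm _
    -- With no factors left everything sits in degree 0, so the bound m < 0 leaves only y = 0.
    rw [tensorPow, if_neg (by omega), Submodule.mem_bot] at hy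
    subst hy
    simp
  | succ N ih =>
    intro m y hy hm hd
    have h1 := hHd N m y hy
    rw [hd, map_zero, add_zero] at h1
    -- The augmentation lowers the degree and the number of factors by one each, which preserves the
    -- strict inequality between them.
    obtain ⟨h2, h3⟩ := ih (m - 1) (augT 𝒜 y) (augT_mem 𝒜 hy) (by push_cast at hm; omega)
      (by rw [dT_augT 𝒜 hy, hd, map_zero, neg_zero])
    refine ⟨?_, ?_⟩
    · rw [hS, map_sub, h1, dT_genOne_mul, h2]
      abel
    · rw [hS]
      exact sub_mem (hHmem N m y hy) (mul_mem_tensorPow' (ι_mem_tensorPow (genOne_mem 𝒜)) h3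
        (add_comm 1 N) (by ring))

end Primitive
end Koszul


namespace Koszul

open scoped TensorProduct DirectSum
open MulOpposite AInfinity

/-! ### The obstruction to the next component of a coderivation -/

section Obstruction

variable {k A : Type*} [Field k] [Ring A] [Algebra k A] (𝒜 : ℕ → Submodule k A)
  [GradedAlgebra 𝒜]

theorem derivation_neg (l : ℤ) (f : P 𝒜 →ₗ[Env k A] T k A (P 𝒜)) (x : T k A (P 𝒜)) :
    derivation (grP 𝒜) l (-f) x = -derivation (grP 𝒜) l f x := by
  have h := isDerivation_derivation (𝒞 := grP 𝒜) l f
  have hn : IsDerivation (grP 𝒜) l (-derivation (grP 𝒜) l f) :=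
    ⟨fun a => by rw [LinearMap.neg_apply, h.inl, neg_zero], fun x y => by
      simp only [LinearMap.neg_apply, h.mul, neg_add, neg_mul, mul_neg]⟩
  exact LinearMap.congr_fun ((isDerivation_derivation l (-f)).ext hn fun c => by
    rw [LinearMap.neg_apply, derivation_ι, derivation_ι, LinearMap.neg_apply]) x

/-- If `β` is the component of degree `N` of a coderivation `α` of degree `l`, the next component
`α'` has to satisfy `∂ α' - (-1)^l α' d = obstruction l β`. -/
noncomputable def obstruction (l : ℤ) (β : P 𝒜 →ₗ[Env k A] T k A (P 𝒜)) :
    P 𝒜 →ₗ[Env k A] T k A (P 𝒜) :=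
  (l.negOnePow : ℤ) • (IsDerivation.toEnvLinear 𝒜 (isDerivation_derivation l β) ∘ₗ diag 𝒜)
    - IsDerivation.toEnvLinear 𝒜 (isDerivation_derivation 1 (δ 𝒜 2)) ∘ₗ β

theorem obstruction_apply (l : ℤ) (β : P 𝒜 →ₗ[Env k A] T k A (P 𝒜)) (c : P 𝒜) :
    obstruction 𝒜 l β c
      = (l.negOnePow : ℤ) • derivation (grP 𝒜) l β (diag 𝒜 c) - diagT 𝒜 (β c) := rfl

variable {𝒜} in
theorem obstruction_mem {l : ℤ} {N : ℕ} {β : P 𝒜 →ₗ[Env k A] T k A (P 𝒜)}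
    (hβ : ∀ j, ∀ c ∈ grP 𝒜 j, β c ∈ tensorPow (grP 𝒜) N (j + l)) {j : ℤ} {c : P 𝒜}
    (hc : c ∈ grP 𝒜 j) : obstruction 𝒜 l β c ∈ tensorPow (grP 𝒜) (N + 1) (j + l + 1) := by
  rw [obstruction_apply]
  refine sub_mem (zsmul_mem ?_ _) ?_
  · have := derivation_mem_tensorPow hβ (n := 1) (δ_mem 𝒜 2 j c hc)
    rwa [add_comm 1 N, add_right_comm] at this
  · rcases N with _ | N
    · have h := hβ j c hc
      rw [tensorPow] at h
      split_ifs at h with h0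
      · obtain ⟨a, ha⟩ := h
        rw [← ha, AlgHom.toLinearMap_apply, derivation_inl]
        exact zero_mem _
      · rw [Submodule.mem_bot] at h
        rw [h, map_zero]
        exact zero_mem _
    · exact derivation_mem_tensorPow (δ_mem 𝒜 2) (hβ j c hc)

variable {𝒜} in
/-- The obstruction is a cocycle. -/
theorem obstruction_cocycle {l : ℤ} {N N' : ℕ} {β β' : P 𝒜 →ₗ[Env k A] T k A (P 𝒜)}
    (hβ : ∀ j, ∀ c ∈ grP 𝒜 j, β c ∈ tensorPow (grP 𝒜) N (j + l))
    (hβ' : ∀ j, ∀ c ∈ grP 𝒜 j, β' c ∈ tensorPow (grP 𝒜) N' (j + l))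
    (h : ∀ c, dT 𝒜 (β c) = (l.negOnePow : ℤ) • β (d 𝒜 c) + obstruction 𝒜 l β' c) (c : P 𝒜) :
    dT 𝒜 (obstruction 𝒜 l β c) = -((l.negOnePow : ℤ) • obstruction 𝒜 l β (d 𝒜 c)) := by
  -- By hypothesis the commutator of D₁ with the derivation of β is the derivation extending the
  -- previous obstruction. Evaluate it at δ₂c.
  have h1 := derivation_commutator (δ_mem 𝒜 1) hβ (obstruction 𝒜 l β')
    (fun c => by
      rw [h, one_mul, show δ 𝒜 1 c = T.ι k A (P 𝒜) (d 𝒜 c) from rfl, derivation_ι,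
        add_sub_cancel_left]) (diag 𝒜 c)
  -- The commutator of D₂ with the derivation of β' is, by the definition of the obstruction, the
  -- negative of the same derivation. The two contributions at δ₂c therefore cancel; the remaining
  -- terms are handled by the coalgebra identities.
  have h2 := derivation_commutator (δ_mem 𝒜 2) hβ' (-obstruction 𝒜 l β')
    (fun c => by rw [LinearMap.neg_apply, obstruction_apply, one_mul, neg_sub]; rfl) (diag 𝒜 c)
  have h3 : diagT 𝒜 (diag 𝒜 c) = 0 := diagT_δ₂ 𝒜 c
  have h4 : dT 𝒜 (diag 𝒜 c) = -diag 𝒜 (d 𝒜 c) := by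
    rw [eq_neg_iff_add_eq_zero]
    have := dT_δ₂ 𝒜 c
    rwa [show δ 𝒜 1 c = T.ι k A (P 𝒜) (d 𝒜 c) from rfl, derivation_ι] at this
  have h5 : dT 𝒜 (diagT 𝒜 (β c)) = -diagT 𝒜 (dT 𝒜 (β c)) :=
    eq_neg_of_add_eq_zero_left (dT_diagT 𝒜 _)
  have h6 := diagT_diagT 𝒜 (β' c)
  have h7 : diagT 𝒜 (obstruction 𝒜 l β' c) = (l.negOnePow : ℤ) •
      diagT 𝒜 (derivation (grP 𝒜) l β' (diag 𝒜 c)) := by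
    rw [obstruction_apply, map_sub, h6, sub_zero, map_zsmul]
  rw [h3, map_zero, smul_zero, sub_zero, derivation_neg] at h2
  rw [h4, map_neg, one_mul] at h1
  rw [obstruction_apply, obstruction_apply, map_sub, map_zsmul, h5, h, map_add, map_zsmul, h7, h2]
  rw [sub_eq_iff_eq_add] at h1
  rw [h1]
  rcases Int.units_eq_one_or l.negOnePow with e | e <;> rw [e]
  · simp only [Units.val_one, one_smul]
    abel
  · simp only [Units.val_neg, Units.val_one, neg_smul, one_smul]
    abel

/-- The values of a family of maps on the generators, under a derivation. -/
theorem comp_Γ_derivation (l : ℤ) (β : P 𝒜 →ₗ[Env k A] T k A (P 𝒜)) (i : ℕ) :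
    comp (Γ 𝒜) (derivation (grP 𝒜) l β) i = β.restrictScalars k ∘ₗ gen 𝒜 i :=
  LinearMap.ext fun w => derivation_ι (grP 𝒜) l β (gen 𝒜 i w)

theorem derivation_diag_gen (l : ℤ) (β : P 𝒜 →ₗ[Env k A] T k A (P 𝒜)) (i : ℕ) (w : KPrime 𝒜 i) :
    derivation (grP 𝒜) l β (diag 𝒜 (gen 𝒜 i w))
      = conv (bar (comp (Γ 𝒜) (derivation (grP 𝒜) l β))) (Γ 𝒜) i w
        + conv (bar (comp (Γ 𝒜) (sgn (grP 𝒜) l).toLinearMap))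
          (comp (Γ 𝒜) (derivation (grP 𝒜) l β)) i w := by
  have := LinearMap.congr_fun (congrFun (comp_conv (bar (Γ 𝒜)) (Γ 𝒜)
    (s := (sgn (grP 𝒜) l).toLinearMap)
    (isDerivation_derivation (𝒞 := grP 𝒜) l β).mul) i) w
  rw [comp_bar, comp_bar] at this
  rw [diag_gen]
  exact this

theorem convAt_Γ_zero (n : ℕ) (f : KPrime 𝒜 n →ₗ[k] T k A (P 𝒜)) (w : KPrime 𝒜 n) :
    convAt n 0 n f (Γ 𝒜 0) w = f w * T.ι k A (P 𝒜) (genOne 𝒜) := by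
  rw [convAt, dif_pos (add_zero n), LinearMap.comp_apply, LinearMap.comp_apply,
    decon_eq 𝒜 (add_zero n) (z := w ⊗ₜ oneKPrime 𝒜)
      (by rw [Submodule.mulMap_tmul, coe_oneKPrime, mul_one])]
  rfl

theorem convAt_zero_n (n : ℕ) (e : KPrime 𝒜 0 →ₗ[k] T k A (P 𝒜))
    (f : KPrime 𝒜 n →ₗ[k] T k A (P 𝒜)) (w : KPrime 𝒜 n) :
    convAt 0 n n e f w = e (oneKPrime 𝒜) * f w := by
  rw [convAt, dif_pos (zero_add n), LinearMap.comp_apply, LinearMap.comp_apply,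
    decon_eq 𝒜 (zero_add n) (z := oneKPrime 𝒜 ⊗ₜ w)
      (by rw [Submodule.mulMap_tmul, coe_oneKPrime, one_mul])]
  rfl

variable {𝒜} in
-- In every term of the coproduct of K'_i the map β meets a factor of index at most i, where it
-- vanishes.
theorem obstruction_eq_zero {l : ℤ} {n : ℕ} {β : P 𝒜 →ₗ[Env k A] T k A (P 𝒜)}
    (hβ : ∀ i < n, ∀ w, β (gen 𝒜 i w) = 0) {i : ℕ} (hi : i < n) (w : KPrime 𝒜 i) :
    obstruction 𝒜 l β (gen 𝒜 i w) = 0 := by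
  have h : ∀ i < n, comp (Γ 𝒜) (derivation (grP 𝒜) l β) i = 0 := fun i hi => by
    rw [comp_Γ_derivation]
    exact LinearMap.ext fun w => hβ i hi w
  rw [obstruction_apply, hβ i hi, map_zero, sub_zero, derivation_diag_gen, conv, conv,
    Finset.sum_eq_zero fun p hp => ?_, Finset.sum_eq_zero fun p hp => ?_]
  · simp
  all_goals rw [Finset.HasAntidiagonal.mem_antidiagonal] at hp
  · rw [h _ (by omega), convAt_zero_right]
  · rw [bar, h _ (by omega), smul_zero, convAt_zero_left]

variable {𝒜} in
-- Of the coproduct of K'_n only the two outermost terms, w with 1 ∈ K'_0 on either side, contain a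
-- factor of index n. The signs (-1)^n and (-1)^{n-1} combine so that a commutator with 1 ⊗ 1 ⊗ 1
-- remains.
theorem obstruction_gen {n : ℕ} {β : P 𝒜 →ₗ[Env k A] T k A (P 𝒜)}
    (hβ : ∀ i < n, ∀ w, β (gen 𝒜 i w) = 0) (w : KPrime 𝒜 n) :
    obstruction 𝒜 ((n : ℤ) - 1) β (gen 𝒜 n w)
      = T.ι k A (P 𝒜) (genOne 𝒜) * β (gen 𝒜 n w)
        - β (gen 𝒜 n w) * T.ι k A (P 𝒜) (genOne 𝒜) - diagT 𝒜 (β (gen 𝒜 n w)) := by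
  have h : ∀ i < n, comp (Γ 𝒜) (derivation (grP 𝒜) ((n : ℤ) - 1) β) i = 0 := fun i hi => by
    rw [comp_Γ_derivation]
    exact LinearMap.ext fun w => hβ i hi w
  rw [obstruction_apply, derivation_diag_gen, conv, conv, LinearMap.sum_apply,
    LinearMap.sum_apply, Finset.sum_eq_single (n, 0), Finset.sum_eq_single (0, n)]
  · rw [convAt_Γ_zero, convAt_zero_n, bar, bar, comp_Γ_derivation, pow_zero, one_smul]
    simp only [comp, LinearMap.comp_apply, LinearMap.smul_apply, LinearMap.restrictScalars_apply,
      AlgHom.toLinearMap_apply]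
    rw [sgn_comp_Γ, Nat.cast_zero, sub_zero, mul_one,
      show Γ 𝒜 0 (oneKPrime 𝒜) = T.ι k A (P 𝒜) (genOne 𝒜) from rfl, Int.negOnePow_sub,
      Int.negOnePow_one]
    rcases Nat.even_or_odd n with e | e
    · rw [e.neg_one_pow, Int.negOnePow_even _ ((Int.even_coe_nat n).2 e)]
      simp
      abel
    · rw [e.neg_one_pow, Int.negOnePow_odd _ ((Int.odd_coe_nat n).2 e)]
      simp
      abel
  · intro p hp hne
    rw [Finset.HasAntidiagonal.mem_antidiagonal] at hp
    rw [h p.2 (lt_of_le_of_ne (by omega) fun e => hne (Prod.ext (by simp only; omega) e)),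
      convAt_zero_right, LinearMap.zero_apply]
  · exact fun hn => absurd (Finset.HasAntidiagonal.mem_antidiagonal.2 (zero_add n)) hn
  · intro p hp hne
    rw [Finset.HasAntidiagonal.mem_antidiagonal] at hp
    rw [bar, h p.1 (lt_of_le_of_ne (by omega) fun e => hne (Prod.ext e (by simp only; omega))),
      smul_zero, convAt_zero_left, LinearMap.zero_apply]
  · exact fun hn => absurd (Finset.HasAntidiagonal.mem_antidiagonal.2 (add_zero n)) hn

end Obstruction
end Koszul


namespace Koszul

open scoped TensorProduct DirectSum
open MulOpposite AInfinity

/-! ### Extending a component from K'_n to all of P -/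

section Extension

variable {k A : Type*} [Field k] [Ring A] [Algebra k A] (𝒜 : ℕ → Submodule k A)
  [GradedAlgebra 𝒜]

theorem dT_env_smul (e : Env k A) (x : T k A (P 𝒜)) : dT 𝒜 (e • x) = e • dT 𝒜 x :=
  IsDerivation.map_env_smul 𝒜 (isDerivation_derivation 1 (δ 𝒜 1)) e x

/-- The recursive construction, by means of `S`, of an extension of the map `b : K'_n → T(P)`; its
`m`-th term is the extension on `K'_{n+m}`. -/
noncomputable def extensionAux (S : T k A (P 𝒜) →ₗ[k] T k A (P 𝒜)) (r : ℤ)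
    (F : P 𝒜 →ₗ[Env k A] T k A (P 𝒜)) {n : ℕ} (b : KPrime 𝒜 n →ₗ[k] T k A (P 𝒜)) :
    ℕ → P 𝒜 →ₗ[Env k A] T k A (P 𝒜)
  | 0 => liftP 𝒜 (Pi.single n b)
  | m + 1 => liftP 𝒜 fun i =>
      S ∘ₗ (r • (extensionAux S r F b m ∘ₗ d 𝒜) + F).restrictScalars k ∘ₗ gen 𝒜 i

/-- The extension of `b : K'_n → T(P)` to `P`. -/
noncomputable def extension (S : T k A (P 𝒜) →ₗ[k] T k A (P 𝒜)) (r : ℤ)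
    (F : P 𝒜 →ₗ[Env k A] T k A (P 𝒜)) {n : ℕ} (b : KPrime 𝒜 n →ₗ[k] T k A (P 𝒜)) :
    P 𝒜 →ₗ[Env k A] T k A (P 𝒜) :=
  liftP 𝒜 fun i => if i < n then 0 else
    (extensionAux 𝒜 S r F b (i - n)).restrictScalars k ∘ₗ gen 𝒜 i

section Values

variable (S : T k A (P 𝒜) →ₗ[k] T k A (P 𝒜)) (r : ℤ) (F : P 𝒜 →ₗ[Env k A] T k A (P 𝒜)) {n : ℕ}
  (b : KPrime 𝒜 n →ₗ[k] T k A (P 𝒜))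

theorem extension_gen_of_lt {i : ℕ} (hi : i < n) (w : KPrime 𝒜 i) :
    extension 𝒜 S r F b (gen 𝒜 i w) = 0 := by
  rw [extension, liftP_gen, if_pos hi]
  rfl

theorem extension_gen_add (m : ℕ) (w : KPrime 𝒜 (n + m)) :
    extension 𝒜 S r F b (gen 𝒜 (n + m) w) = extensionAux 𝒜 S r F b m (gen 𝒜 (n + m) w) := by
  rw [extension, liftP_gen, if_neg (by omega), Nat.add_sub_cancel_left]
  rfl

theorem extension_gen (w : KPrime 𝒜 n) : extension 𝒜 S r F b (gen 𝒜 n w) = b w := by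
  refine (extension_gen_add 𝒜 S r F b 0 w).trans ?_
  change liftP 𝒜 (Pi.single n b) (gen 𝒜 n w) = b w
  rw [liftP_gen, Pi.single_eq_same]

theorem extension_of_mem_lt {j : ℤ} (hj : 1 - (n : ℤ) < j) {c : P 𝒜} (hc : c ∈ grP 𝒜 j) :
    extension 𝒜 S r F b c = 0 := by
  refine grP_induction 𝒜 (p := fun c => extension 𝒜 S r F b c = 0) (map_zero _)
    (fun x y hx hy => by rw [map_add, hx, hy, add_zero])
    (fun e x hx => by rw [map_smul, hx, smul_zero]) (fun i w hi => ?_) hc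
  exact extension_gen_of_lt 𝒜 S r F b (by omega) w

theorem extension_of_mem (m : ℕ) {c : P 𝒜} (hc : c ∈ grP 𝒜 (1 - ((n + m : ℕ) : ℤ))) :
    extension 𝒜 S r F b c = extensionAux 𝒜 S r F b m c := by
  refine grP_induction 𝒜 (p := fun c => extension 𝒜 S r F b c = extensionAux 𝒜 S r F b m c)
    (by rw [map_zero, map_zero])
    (fun x y hx hy => by rw [map_add, hx, hy, map_add])
    (fun e x hx => by rw [map_smul, hx, map_smul]) (fun i w hi => ?_) hc
  obtain rfl : i = n + m := by omega
  exact extension_gen_add 𝒜 S r F b m w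

theorem extension_gen_succ (m : ℕ) (w : KPrime 𝒜 (n + (m + 1))) :
    extension 𝒜 S r F b (gen 𝒜 (n + (m + 1)) w)
      = S (r • extension 𝒜 S r F b (d 𝒜 (gen 𝒜 (n + (m + 1)) w)) + F (gen 𝒜 (n + (m + 1)) w)) := by
  have h := d_gen_mem 𝒜 (n + (m + 1)) w
  rw [show 1 - ((n + (m + 1) : ℕ) : ℤ) + 1 = 1 - ((n + m : ℕ) : ℤ) by push_cast; ring] at h
  rw [extension_gen_add, extension_of_mem 𝒜 S r F b m h]
  change liftP 𝒜 _ _ = _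
  rw [liftP_gen]
  rfl

end Values

/-- The extension solves the equation `∂ α - (-1)^l α d = F`. -/
theorem extension_spec {N n : ℕ} (hN : 0 < N) {l : ℤ} (hl : l = n - 1)
    {S : T k A (P 𝒜) →ₗ[k] T k A (P 𝒜)}
    (hS : ∀ m, ∀ y ∈ tensorPow (grP 𝒜) N m, m < N → dT 𝒜 y = 0 →
      dT 𝒜 (S y) = y ∧ S y ∈ tensorPow (grP 𝒜) N (m - 1))
    {F : P 𝒜 →ₗ[Env k A] T k A (P 𝒜)}
    (hF : ∀ j, ∀ c ∈ grP 𝒜 j, F c ∈ tensorPow (grP 𝒜) N (j + l + 1))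
    (hF0 : ∀ i < n, ∀ w, F (gen 𝒜 i w) = 0)
    (hFd : ∀ c, dT 𝒜 (F c) = -((l.negOnePow : ℤ) • F (d 𝒜 c)))
    {b : KPrime 𝒜 n →ₗ[k] T k A (P 𝒜)} (hb : ∀ w, b w ∈ tensorPow (grP 𝒜) N 0)
    (hbd : ∀ w, dT 𝒜 (b w) = F (gen 𝒜 n w)) :
    (∀ j, ∀ c ∈ grP 𝒜 j,
      extension 𝒜 S l.negOnePow F b c ∈ tensorPow (grP 𝒜) N (j + l)) ∧
    ∀ c, dT 𝒜 (extension 𝒜 S l.negOnePow F b c)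
      = (l.negOnePow : ℤ) • extension 𝒜 S l.negOnePow F b (d 𝒜 c) + F c := by
  set α := extension 𝒜 S (l.negOnePow : ℤ) F b with hα
  have hgr : ∀ i : ℕ, (∀ w, α (gen 𝒜 i w) ∈ tensorPow (grP 𝒜) N (1 - (i : ℤ) + l) ∧
      dT 𝒜 (α (gen 𝒜 i w)) = (l.negOnePow : ℤ) • α (d 𝒜 (gen 𝒜 i w)) + F (gen 𝒜 i w)) →
      ∀ c ∈ grP 𝒜 (1 - (i : ℤ)), α c ∈ tensorPow (grP 𝒜) N (1 - (i : ℤ) + l) ∧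
        dT 𝒜 (α c) = (l.negOnePow : ℤ) • α (d 𝒜 c) + F c := by
    intro i H c hc
    refine grP_induction 𝒜 (p := fun c => α c ∈ tensorPow (grP 𝒜) N (1 - (i : ℤ) + l) ∧
        dT 𝒜 (α c) = (l.negOnePow : ℤ) • α (d 𝒜 c) + F c) ?_ ?_ ?_ ?_ hc
    · simp
    · rintro x y ⟨hx, hx'⟩ ⟨hy, hy'⟩
      refine ⟨by rw [map_add]; exact add_mem hx hy, ?_⟩
      simp only [map_add, hx', hy', smul_add]
      abel
    · rintro e x ⟨hx, hx'⟩
      refine ⟨by rw [map_smul]; exact smul_mem_tensorPow hx e, ?_⟩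
      rw [map_smul α, dT_env_smul, hx', map_smul (d 𝒜), map_smul α, map_smul F, smul_add,
        smul_comm e]
    · intro i' w hi
      obtain rfl : i' = i := by omega
      exact H w
  have key : ∀ m : ℕ, ∀ c ∈ grP 𝒜 (1 - ((n + m : ℕ) : ℤ)),
      α c ∈ tensorPow (grP 𝒜) N (1 - ((n + m : ℕ) : ℤ) + l) ∧
        dT 𝒜 (α c) = (l.negOnePow : ℤ) • α (d 𝒜 c) + F c := by
    intro m
    induction m with
    | zero =>
      refine hgr _ fun w => ?_
      have h1 : α (gen 𝒜 (n + 0) w) = b w := extension_gen 𝒜 S _ F b w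
      rw [h1]
      refine ⟨?_, ?_⟩
      · rw [show 1 - ((n + 0 : ℕ) : ℤ) + l = 0 by rw [hl]; push_cast; ring]
        exact hb w
      -- On K'_n the differential lands where the extension is 0, so the equation reduces to the
      -- assumption on b.
      · rw [hbd, hα, extension_of_mem_lt 𝒜 S _ F b (by push_cast; omega) (d_gen_mem 𝒜 _ w),
          smul_zero, zero_add]
        rfl
    | succ m ih =>
      refine hgr _ fun w => ?_
      have hd := d_gen_mem 𝒜 (n + (m + 1)) w
      rw [show 1 - ((n + (m + 1) : ℕ) : ℤ) + 1 = 1 - ((n + m : ℕ) : ℤ) by push_cast; ring] at hd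
      obtain ⟨h1, h2⟩ := ih _ hd
      have h3 := hF _ _ (gen_mem 𝒜 (n + (m + 1)) w)
      rw [show 1 - ((n + (m + 1) : ℕ) : ℤ) + l + 1 = 1 - ((n + m : ℕ) : ℤ) + l by
        push_cast; ring] at h3
      -- Since l = n - 1, the degree here is -m, which is less than N because N > 0; this is the
      -- range in which cycles have primitives. The element is a cycle by the equation one step
      -- earlier, d² = 0 and the cocycle property of F.
      have h4 := hS _ _ (add_mem (zsmul_mem h1 (l.negOnePow : ℤ)) h3) (by rw [hl]; push_cast; omega)
        (by
          rw [map_add, map_zsmul, h2, d_d, map_zero, smul_zero, zero_add, hFd, add_neg_cancel])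
      rw [hα, extension_gen_succ, ← hα]
      refine ⟨?_, h4.1⟩
      rw [show 1 - ((n + (m + 1) : ℕ) : ℤ) + l = 1 - ((n + m : ℕ) : ℤ) + l - 1 by push_cast; ring]
      exact h4.2
  have all : ∀ j, ∀ c ∈ grP 𝒜 j, α c ∈ tensorPow (grP 𝒜) N (j + l) ∧
      dT 𝒜 (α c) = (l.negOnePow : ℤ) • α (d 𝒜 c) + F c := by
    intro j c hc
    by_cases hj : 1 - (n : ℤ) < j
    · have h0 : F c = 0 := by
        refine grP_induction 𝒜 (p := fun c => F c = 0) (map_zero _)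
          (fun x y hx hy => by rw [map_add, hx, hy, add_zero])
          (fun e x hx => by rw [map_smul, hx, smul_zero]) (fun i w hi => ?_) hc
        exact hF0 i (by omega) w
      rw [h0, hα, extension_of_mem_lt 𝒜 S _ F b hj hc,
        extension_of_mem_lt 𝒜 S _ F b (by omega : 1 - (n : ℤ) < j + 1) (d_mem 𝒜 hc)]
      simp
    · obtain ⟨m, hm⟩ := Int.eq_ofNat_of_zero_le (show 0 ≤ 1 - (n : ℤ) - j by omega)
      obtain rfl : j = 1 - ((n + m : ℕ) : ℤ) := by push_cast; omega
      exact key m c hc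
  refine ⟨fun j c hc => (all j c hc).1, fun c => ?_⟩
  refine mem_grP_induction 𝒜
    (p := fun c => dT 𝒜 (α c) = (l.negOnePow : ℤ) • α (d 𝒜 c) + F c) (by simp)
    (fun x y hx hy => ?_) (fun j c hc => (all j c hc).2) c
  simp only [map_add, hx, hy, smul_add]
  abel

end Extension
end Koszul


namespace Koszul

open scoped TensorProduct DirectSum
open MulOpposite AInfinity

/-! ### The explicit leading values and their boundary -/

section Split

variable {k A : Type*} [Field k] [Ring A] [Algebra k A] (𝒜 : ℕ → Submodule k A)

theorem d_τ (v : 𝒜 1) : T.ι k A (P 𝒜) (d 𝒜 (τ 𝒜 v))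
    = T.inl k A (P 𝒜) v * T.ι k A (P 𝒜) (genOne 𝒜)
      - T.ι k A (P 𝒜) (genOne 𝒜) * T.inl k A (P 𝒜) v := by
  have hval : val 𝒜 ⟨TensorAlgebra.ι k v, ι_mem 𝒜 v⟩ = v := by
    change toA 𝒜 (TensorAlgebra.ι k v) = v
    simp [toA]
  change T.ι k A (P 𝒜) (d 𝒜 (gen 𝒜 (0 + 1) ⟨TensorAlgebra.ι k v, ι_mem 𝒜 v⟩)) = _
  rw [d_gen_succ,
    decon_eq 𝒜 (add_comm 1 0) (z := ⟨TensorAlgebra.ι k v, ι_mem 𝒜 v⟩ ⊗ₜ oneKPrime 𝒜)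
      (by rw [Submodule.mulMap_tmul, coe_oneKPrime, mul_one]),
    decon_eq 𝒜 rfl (z := oneKPrime 𝒜 ⊗ₜ ⟨TensorAlgebra.ι k v, ι_mem 𝒜 v⟩)
      (by rw [Submodule.mulMap_tmul, coe_oneKPrime, one_mul]), neg_one_pow_succ_smul, pow_zero,
    one_smul, map_add, map_neg, ι_leftMul, ι_rightMul, sub_eq_add_neg]
  rw [← hval]
  rfl

theorem τ_mem (v : 𝒜 1) : τ 𝒜 v ∈ grP 𝒜 0 := gen_mem 𝒜 1 ⟨TensorAlgebra.ι k v, ι_mem 𝒜 v⟩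

theorem split_tprod (p m : ℕ) (v : Fin p → 𝒜 1) :
    split 𝒜 p m (PiTensorProduct.tprod k v)
      = ∑ S ∈ Finset.powersetCard m (Finset.univ : Finset (Fin p)),
        (List.ofFn fun j => if j ∈ S then T.ι k A (P 𝒜) (τ 𝒜 (v j))
          else T.inl k A (P 𝒜) (v j)).prod := by
  rw [split, LinearMap.sum_apply]
  refine Finset.sum_congr rfl fun S _ => ?_
  rw [PiTensorProduct.lift.tprod, MultilinearMap.compLinearMap_apply,
    MultilinearMap.mkPiAlgebraFin_apply]
  refine congrArg (fun f => (List.ofFn f).prod) (funext fun j => ?_)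
  split_ifs <;> rfl

theorem split_zero (p : ℕ) (z : ⨂[k]^p (𝒜 1)) :
    split 𝒜 p 0 z = T.inl k A (P 𝒜) (π 𝒜 p z) := by
  refine LinearMap.congr_fun (f := split 𝒜 p 0)
    (g := (T.inl k A (P 𝒜)).toLinearMap ∘ₗ π 𝒜 p) (PiTensorProduct.ext
      (MultilinearMap.ext fun v => ?_)) z
  simp only [LinearMap.compMultilinearMap_apply, LinearMap.comp_apply, AlgHom.toLinearMap_apply]
  rw [split_tprod, Finset.powersetCard_zero, Finset.sum_singleton, π,
    PiTensorProduct.lift.tprod, MultilinearMap.compLinearMap_apply,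
    MultilinearMap.mkPiAlgebraFin_apply, map_list_prod, List.map_ofFn]
  refine congrArg (fun f => (List.ofFn f).prod) (funext fun j => ?_)
  rw [if_neg (Finset.notMem_empty j)]
  rfl

theorem sum_ofFn_map_succ (p m : ℕ) (v : Fin (p + 1) → 𝒜 1) :
    ∑ S ∈ Finset.powersetCard m ((Finset.univ : Finset (Fin p)).map (Fin.succEmb p)),
      (List.ofFn fun j => if j ∈ S then T.ι k A (P 𝒜) (τ 𝒜 (v j))
        else T.inl k A (P 𝒜) (v j)).prod
      = T.inl k A (P 𝒜) (v 0) * split 𝒜 p m (PiTensorProduct.tprod k (Fin.tail v)) := by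
  rw [split_tprod, Finset.powersetCard_map, Finset.sum_map, Finset.mul_sum]
  refine Finset.sum_congr rfl fun S _ => ?_
  rw [List.ofFn_succ, List.prod_cons, if_neg (by simp [Fin.succ_ne_zero])]
  congr 2
  refine congrArg List.ofFn (funext fun j => ?_)
  simp [Fin.tail]

/-- The sets of chosen positions are sorted according to whether they contain the first one. -/
theorem split_succ (p m : ℕ) (v : Fin (p + 1) → 𝒜 1) :
    split 𝒜 (p + 1) (m + 1) (PiTensorProduct.tprod k v)
      = T.inl k A (P 𝒜) (v 0) * split 𝒜 p (m + 1) (PiTensorProduct.tprod k (Fin.tail v))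
        + T.ι k A (P 𝒜) (τ 𝒜 (v 0)) * split 𝒜 p m (PiTensorProduct.tprod k (Fin.tail v)) := by
  have h0 : (0 : Fin (p + 1)) ∉ (Finset.univ : Finset (Fin p)).map (Fin.succEmb p) := by
    simp [Fin.succ_ne_zero]
  have hm : ∀ S ∈ Finset.powersetCard m ((Finset.univ : Finset (Fin p)).map (Fin.succEmb p)),
      (0 : Fin (p + 1)) ∉ S := fun S hS h => h0 ((Finset.mem_powersetCard.1 hS).1 h)
  rw [split_tprod, Fin.univ_succ, Finset.cons_eq_insert]
  have : (Finset.univ : Finset (Fin p)).map ⟨Fin.succ, Fin.succ_injective p⟩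
    = (Finset.univ : Finset (Fin p)).map (Fin.succEmb p) := rfl
  rw [this, Finset.powersetCard_succ_insert h0, Finset.sum_union, sum_ofFn_map_succ,
    Finset.sum_image]
  · congr 1
    rw [split_tprod, Finset.powersetCard_map, Finset.sum_map, Finset.mul_sum]
    refine Finset.sum_congr rfl fun S _ => ?_
    rw [List.ofFn_succ, List.prod_cons, if_pos (Finset.mem_insert_self _ _)]
    congr 2
    refine congrArg List.ofFn (funext fun j => ?_)
    simp [Fin.tail, Fin.succ_ne_zero]
  · intro S hS S' hS' h
    rw [← Finset.erase_insert (hm S hS), ← Finset.erase_insert (hm S' hS'), h]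
  · rw [Finset.disjoint_left]
    intro S hS hS'
    obtain ⟨S', _, rfl⟩ := Finset.mem_image.1 hS'
    exact h0 ((Finset.mem_powersetCard.1 hS).1 (Finset.mem_insert_self _ _))

theorem split_zero_succ (p : ℕ) (v : Fin (p + 1) → 𝒜 1) :
    split 𝒜 (p + 1) 0 (PiTensorProduct.tprod k v)
      = T.inl k A (P 𝒜) (v 0) * split 𝒜 p 0 (PiTensorProduct.tprod k (Fin.tail v)) := by
  rw [← sum_ofFn_map_succ, split_tprod, Finset.powersetCard_zero, Finset.powersetCard_zero]

theorem split_none (m : ℕ) (z : ⨂[k]^0 (𝒜 1)) : split 𝒜 0 (m + 1) z = 0 := by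
  rw [split, Finset.powersetCard_eq_empty.2 (by simp)]
  rfl

theorem split_mem (p m : ℕ) (z : ⨂[k]^p (𝒜 1)) :
    split 𝒜 p m z ∈ tensorPow (grP 𝒜) m 0 := by
  have key : ∀ (p m : ℕ) (v : Fin p → 𝒜 1),
      split 𝒜 p m (PiTensorProduct.tprod k v) ∈ tensorPow (grP 𝒜) m 0 := by
    intro p
    induction p with
    | zero =>
      intro m v
      rcases m with _ | m
      · rw [split_zero]
        exact inl_mem_tensorPow _ _
      · rw [split_none]
        exact zero_mem _
    | succ p ih =>
      intro m v
      rcases m with _ | m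
      · rw [split_zero]
        exact inl_mem_tensorPow _ _
      · rw [split_succ]
        exact add_mem
          (mul_mem_tensorPow' (inl_mem_tensorPow _ _) (ih _ _) (zero_add _) (zero_add _))
          (mul_mem_tensorPow' (ι_mem_tensorPow (τ_mem 𝒜 _)) (ih _ _) (add_comm _ _) (zero_add _))
  have : LinearMap.range (split 𝒜 p m) ≤ tensorPow (grP 𝒜) m 0 := by
    rw [LinearMap.range_eq_map, ← PiTensorProduct.span_tprod_eq_top, Submodule.map_span,
      Submodule.span_le]
    rintro _ ⟨_, ⟨v, rfl⟩, rfl⟩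
    exact key p m v
  exact this ⟨z, rfl⟩

variable [GradedAlgebra 𝒜]

theorem diag_τ (v : 𝒜 1) : diag 𝒜 (τ 𝒜 v)
    = T.ι k A (P 𝒜) (genOne 𝒜) * T.ι k A (P 𝒜) (τ 𝒜 v)
      - T.ι k A (P 𝒜) (τ 𝒜 v) * T.ι k A (P 𝒜) (genOne 𝒜) := by
  change diag 𝒜 (gen 𝒜 1 ⟨TensorAlgebra.ι k v, ι_mem 𝒜 v⟩) = _
  rw [diag_gen, conv, Finset.Nat.antidiagonal_succ]
  simp [bar, convAt_Γ_zero, convAt_zero_n, convAt_smul_left, sub_eq_add_neg]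
  rfl

theorem dT_τ_mul (v : 𝒜 1) (x : T k A (P 𝒜)) : dT 𝒜 (T.ι k A (P 𝒜) (τ 𝒜 v) * x)
    = (T.inl k A (P 𝒜) v * T.ι k A (P 𝒜) (genOne 𝒜)
      - T.ι k A (P 𝒜) (genOne 𝒜) * T.inl k A (P 𝒜) v) * x
      + T.ι k A (P 𝒜) (τ 𝒜 v) * dT 𝒜 x := by
  rw [dT_ι_mul 𝒜 (τ_mem 𝒜 v), d_τ, Int.negOnePow_zero, Units.val_one, one_smul]

theorem diagT_τ_mul (v : 𝒜 1) (x : T k A (P 𝒜)) : diagT 𝒜 (T.ι k A (P 𝒜) (τ 𝒜 v) * x)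
    = (T.ι k A (P 𝒜) (genOne 𝒜) * T.ι k A (P 𝒜) (τ 𝒜 v)
      - T.ι k A (P 𝒜) (τ 𝒜 v) * T.ι k A (P 𝒜) (genOne 𝒜)) * x
      + T.ι k A (P 𝒜) (τ 𝒜 v) * diagT 𝒜 x := by
  rw [diagT, derivation_mul (grP 𝒜) 1 _ (ι_mem_tensorPow (τ_mem 𝒜 v)), derivation_ι, mul_zero,
    Int.negOnePow_zero, Units.val_one, one_smul, ← diag_τ]
  rfl

theorem diagT_inl_mul (a : A) (x : T k A (P 𝒜)) :
    diagT 𝒜 (T.inl k A (P 𝒜) a * x) = T.inl k A (P 𝒜) a * diagT 𝒜 x := by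
  rw [diagT, derivation_mul (grP 𝒜) 1 _ (inl_mem_tensorPow (grP 𝒜) a), derivation_inl]
  simp

theorem dT_split_zero (p : ℕ) (z : ⨂[k]^p (𝒜 1)) : dT 𝒜 (split 𝒜 p 0 z) = 0 := by
  rw [split_zero, derivation_inl]

theorem diagT_split_zero (p : ℕ) (z : ⨂[k]^p (𝒜 1)) : diagT 𝒜 (split 𝒜 p 0 z) = 0 := by
  rw [split_zero, derivation_inl]

/-- Write g = 1 ⊗ 1 ⊗ 1 and move it through a word from right to left. Past a letter v in A it
leaves vg - gv = d τ(v), the boundary of the word with one more τ. Past a letter τ(v) it leaves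
τ(v)g - gτ(v) = -δ₂τ(v). Summing over all words with m letters τ, the commutator of the word sum
with g telescopes into these two kinds of terms. No further signs appear, as τ(v) has degree 0. -/
theorem dT_split_tprod (p : ℕ) : ∀ (m : ℕ) (v : Fin p → 𝒜 1),
    dT 𝒜 (split 𝒜 p (m + 1) (PiTensorProduct.tprod k v))
      = diagT 𝒜 (split 𝒜 p m (PiTensorProduct.tprod k v))
        + split 𝒜 p m (PiTensorProduct.tprod k v) * T.ι k A (P 𝒜) (genOne 𝒜)
        - T.ι k A (P 𝒜) (genOne 𝒜) * split 𝒜 p m (PiTensorProduct.tprod k v) := by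
  induction p with
  | zero =>
    intro m v
    rw [split_none]
    rcases m with _ | m
    · rw [diagT_split_zero, split_tprod]
      simp
    · rw [split_none]
      simp
  | succ p ih =>
    intro m v
    rw [split_succ, map_add, dT_inl_mul, ih, dT_τ_mul]
    rcases m with _ | m
    · rw [dT_split_zero, diagT_split_zero, diagT_split_zero, split_zero_succ]
      noncomm_ring
    · rw [ih, split_succ, map_add, diagT_inl_mul, diagT_τ_mul]
      noncomm_ring

theorem dT_splitSum (m : ℕ) (y : ⨁ p : ℕ, ⨂[k]^p (𝒜 1)) :
    dT 𝒜 (splitSum 𝒜 (m + 1) y) = diagT 𝒜 (splitSum 𝒜 m y)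
      + splitSum 𝒜 m y * T.ι k A (P 𝒜) (genOne 𝒜)
      - T.ι k A (P 𝒜) (genOne 𝒜) * splitSum 𝒜 m y := by
  refine LinearMap.congr_fun (f := dT 𝒜 ∘ₗ splitSum 𝒜 (m + 1))
    (g := diagT 𝒜 ∘ₗ splitSum 𝒜 m
      + LinearMap.mulRight k (T.ι k A (P 𝒜) (genOne 𝒜)) ∘ₗ splitSum 𝒜 m
      - LinearMap.mulLeft k (T.ι k A (P 𝒜) (genOne 𝒜)) ∘ₗ splitSum 𝒜 m)
    (DirectSum.linearMap_ext _ fun p => PiTensorProduct.ext (MultilinearMap.ext fun v => ?_)) y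
  simp only [LinearMap.compMultilinearMap_apply, LinearMap.comp_apply, LinearMap.sub_apply,
    LinearMap.add_apply, splitSum, DirectSum.toModule_lof]
  exact dT_split_tprod 𝒜 p m v

theorem splitSum_zero (y : ⨁ p : ℕ, ⨂[k]^p (𝒜 1)) :
    splitSum 𝒜 0 y = T.inl k A (P 𝒜) (πSum 𝒜 y) := by
  refine LinearMap.congr_fun (f := splitSum 𝒜 0)
    (g := (T.inl k A (P 𝒜)).toLinearMap ∘ₗ πSum 𝒜)
    (DirectSum.linearMap_ext _ fun p => LinearMap.ext fun z => ?_) y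
  simp only [LinearMap.comp_apply, splitSum, πSum, DirectSum.toModule_lof]
  exact split_zero 𝒜 p z

theorem splitSum_mem (m : ℕ) (y : ⨁ p : ℕ, ⨂[k]^p (𝒜 1)) :
    splitSum 𝒜 m y ∈ tensorPow (grP 𝒜) m 0 := by
  have h : ∀ p z, splitSum 𝒜 m (DirectSum.lof k ℕ (fun p => ⨂[k]^p (𝒜 1)) p z)
      = split 𝒜 p m z := fun p z => by rw [splitSum, DirectSum.toModule_lof]
  induction y using DirectSum.induction_on with
  | zero => rw [map_zero]; exact zero_mem _
  | add x y hx hy => rw [map_add]; exact add_mem hx hy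
  | of p z =>
    have := split_mem 𝒜 p m z
    rwa [← h] at this

end Split
end Koszul


namespace Koszul

open scoped TensorProduct DirectSum
open MulOpposite AInfinity

/-! ### Construction of the coderivation -/

section Coderivation

variable {k A : Type*} [Field k] [Ring A] [Algebra k A] (𝒜 : ℕ → Submodule k A)

/-- The inclusion `A → T(P)` as a map of bimodules. -/
noncomputable def inlEnv : A →ₗ[Env k A] T k A (P 𝒜) where
  toFun := T.inl k A (P 𝒜)
  map_add' := map_add _
  map_smul' e a := by
    induction e using TensorProduct.induction_on with
    | zero =>
      have h1 : (0 : Env k A) • a = 0 := zero_smul (Env k A) a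
      have h2 : (0 : Env k A) • T.inl k A (P 𝒜) a = 0 :=
        zero_smul (Env k A) (T.inl k A (P 𝒜) a)
      rw [RingHom.id_apply, h1, h2, map_zero]
    | add e e' he he' =>
      rw [RingHom.id_apply] at *
      rw [add_smul, map_add, he, he', add_smul]
    | tmul a' b =>
      rw [RingHom.id_apply, env_smul_self, T.env_smul, map_mul, map_mul]

variable [GradedAlgebra 𝒜]

/-- The conditions on the component of degree `N` of the coderivation under which the next
component can be constructed. -/
structure IsComponent (n N : ℕ) (Y : KPrime 𝒜 n →ₗ[k] ⨁ p : ℕ, ⨂[k]^p (𝒜 1))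
    (β : P 𝒜 →ₗ[Env k A] T k A (P 𝒜)) : Prop where
  degree : ∀ j, ∀ c ∈ grP 𝒜 j, β c ∈ tensorPow (grP 𝒜) N (j + ((n : ℤ) - 1))
  support : ∀ i < n, ∀ w, β (gen 𝒜 i w) = 0
  value : ∀ w, β (gen 𝒜 n w) = (-1 : k) ^ N • splitSum 𝒜 N (Y w)
  cocycle : ∀ c, dT 𝒜 (obstruction 𝒜 ((n : ℤ) - 1) β c)
    = -((((n : ℤ) - 1).negOnePow : ℤ) • obstruction 𝒜 ((n : ℤ) - 1) β (d 𝒜 c))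

variable {𝒜} in
-- The component α₀ fits the inductive scheme with previous component 0: its values lie in A, where
-- `dT` vanishes, and α₀ d = 0 is the required equation.
theorem isComponent_zero {n : ℕ} {α₀ : P 𝒜 →ₗ[Env k A] A} (hα : IsCocycle 𝒜 n α₀)
    {Y : KPrime 𝒜 n →ₗ[k] ⨁ p : ℕ, ⨂[k]^p (𝒜 1)}
    (hY : ∀ w, πSum 𝒜 (Y w) = α₀ (gen 𝒜 n w)) : IsComponent 𝒜 n 0 Y (inlEnv 𝒜 ∘ₗ α₀) := by
  have hd : ∀ c, α₀ (d 𝒜 c) = 0 := LinearMap.congr_fun hα.comp_d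
  have hdeg : ∀ j, ∀ c ∈ grP 𝒜 j,
      (inlEnv 𝒜 ∘ₗ α₀) c ∈ tensorPow (grP 𝒜) 0 (j + ((n : ℤ) - 1)) := by
    intro j c hc
    by_cases hj : j = 1 - (n : ℤ)
    · rw [show j + ((n : ℤ) - 1) = 0 by omega]
      exact inl_mem_tensorPow (grP 𝒜) _
    · rw [LinearMap.comp_apply, hα.support j hj c hc, map_zero]
      exact zero_mem _
  refine ⟨hdeg, fun i hi w => ?_, fun w => ?_, ?_⟩
  · rw [LinearMap.comp_apply, hα.support _ (by omega) _ (gen_mem 𝒜 i w), map_zero]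
  · rw [pow_zero, one_smul, splitSum_zero, hY]
    rfl
  · refine obstruction_cocycle (N' := 0) (β' := 0) hdeg (fun _ _ _ => zero_mem _) fun c => ?_
    rw [LinearMap.comp_apply, LinearMap.comp_apply, hd, map_zero, smul_zero, obstruction_apply,
      derivation_zero, LinearMap.zero_apply, map_zero, smul_zero, sub_zero, add_zero]
    exact derivation_inl _ _ _ _

variable {𝒜} in
-- The obstruction is a cocycle vanishing below index n, and the prescribed value cobounds it on
-- K'_n, so it can be solved on all of P. The new component satisfies the same conditions, so the
-- step can be iterated.
theorem IsComponent.exists_succ (hA : IsKoszul 𝒜) {n N : ℕ}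
    {Y : KPrime 𝒜 n →ₗ[k] ⨁ p : ℕ, ⨂[k]^p (𝒜 1)} {β : P 𝒜 →ₗ[Env k A] T k A (P 𝒜)}
    (hβ : IsComponent 𝒜 n N Y β) : ∃ β', IsComponent 𝒜 n (N + 1) Y β' ∧
      ∀ c, dT 𝒜 (β' c) = (((n : ℤ) - 1).negOnePow : ℤ) • β' (d 𝒜 c)
        + obstruction 𝒜 ((n : ℤ) - 1) β c := by
  obtain ⟨S, hS⟩ := exists_primitive 𝒜 hA
  let b : KPrime 𝒜 n →ₗ[k] T k A (P 𝒜) := (-1 : k) ^ (N + 1) • splitSum 𝒜 (N + 1) ∘ₗ Y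
  -- The obstruction on K'_n is gβ - βg - D₂β, the negative of the telescoping formula. This is the
  -- origin of the alternating sign (-1)^N in the values.
  have hbd : ∀ w, dT 𝒜 (b w) = obstruction 𝒜 ((n : ℤ) - 1) β (gen 𝒜 n w) := by
    intro w
    rw [obstruction_gen hβ.support, hβ.value]
    change dT 𝒜 ((-1 : k) ^ (N + 1) • splitSum 𝒜 (N + 1) (Y w)) = _
    rw [map_smul, map_smul, dT_splitSum, neg_one_pow_succ_smul, mul_smul_comm, smul_mul_assoc,
      smul_sub, smul_add]
    abel
  obtain ⟨h1, h2⟩ := extension_spec 𝒜 (Nat.succ_pos N) rfl (hS (N + 1))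
    (fun j c hc => obstruction_mem hβ.degree hc)
    (fun i hi w => obstruction_eq_zero hβ.support hi w) hβ.cocycle (b := b)
    (fun w => Submodule.smul_mem _ _ (splitSum_mem 𝒜 (N + 1) (Y w))) hbd
  exact ⟨_, ⟨h1, fun i hi w => extension_gen_of_lt 𝒜 _ _ _ b hi w,
    fun w => extension_gen 𝒜 _ _ _ b w, obstruction_cocycle h1 hβ.degree h2⟩, h2⟩

/-- The components of the coderivation. -/
theorem exists_components (hA : IsKoszul 𝒜) {n : ℕ} {α₀ : P 𝒜 →ₗ[Env k A] A}
    (hα : IsCocycle 𝒜 n α₀) {Y : KPrime 𝒜 n →ₗ[k] ⨁ p : ℕ, ⨂[k]^p (𝒜 1)}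
    (hY : ∀ w, πSum 𝒜 (Y w) = α₀ (gen 𝒜 n w)) :
    ∃ α : ℕ → P 𝒜 →ₗ[Env k A] T k A (P 𝒜), α 0 = inlEnv 𝒜 ∘ₗ α₀ ∧
      (∀ N, IsComponent 𝒜 n N Y (α N)) ∧
      ∀ N c, dT 𝒜 (α (N + 1) c) = (((n : ℤ) - 1).negOnePow : ℤ) • α (N + 1) (d 𝒜 c)
        + obstruction 𝒜 ((n : ℤ) - 1) (α N) c := by
  choose next h using fun (N : ℕ) (β : {β // IsComponent 𝒜 n N Y β}) => β.2.exists_succ hA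
  let α : ∀ N, {β // IsComponent 𝒜 n N Y β} := fun N =>
    Nat.rec ⟨_, isComponent_zero hα hY⟩ (fun N β => ⟨next N β, (h N β).1⟩) N
  exact ⟨fun N => (α N).1, rfl, fun N => (α N).2, fun N => (h N (α N)).2⟩

/-- Since only δ₁ and δ₂ are nonzero, the equation with index N + 1 contains just α_{N+1} and α_N,
and it is the obstruction equation rearranged. The equation with index 0 is α₀ d = 0. -/
theorem isCoderivation_of_components {l : ℤ} {α : ℕ → P 𝒜 →ₗ[Env k A] T k A (P 𝒜)}
    (hdeg : ∀ N j, ∀ c ∈ grP 𝒜 j, α N c ∈ tensorPow (grP 𝒜) N (j + l))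
    (h0 : ∀ c, ∃ a, α 0 c = T.inl k A (P 𝒜) a) (h0d : ∀ c, α 0 (d 𝒜 c) = 0)
    (h : ∀ N c, dT 𝒜 (α (N + 1) c) = (l.negOnePow : ℤ) • α (N + 1) (d 𝒜 c)
      + obstruction 𝒜 l (α N) c) :
    IsCoderivation (grP 𝒜) (δ 𝒜) l α where
  degree := hdeg
  eq N c := by
    have h1 : ∀ s, derivation (grP 𝒜) l (α s) (δ 𝒜 1 c) = α s (d 𝒜 c) := fun s =>
      derivation_ι _ _ _ _
    rcases N with _ | N
    · rw [zero_add, Finset.sum_range_one, Finset.sum_range_one, δ_of_ne 𝒜 (n := 0) (by omega)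
        (by omega), derivation_zero, h1, h0d, smul_zero]
    · rw [sum_derivation_δ 𝒜 N fun m => α m c, h, Finset.sum_range_succ, Finset.sum_range_succ,
        Finset.sum_eq_zero fun s hs => by
          rw [Finset.mem_range] at hs
          rw [δ_of_ne 𝒜 (by omega) (by omega), LinearMap.zero_apply, map_zero],
        zero_add, Nat.sub_self, zero_add, h1, show N + 1 - N + 1 = 2 by omega, smul_add,
        obstruction_apply]
      -- For N = 0 the term with δ₂ is absent from the sum, which agrees with D₂ vanishing on A.
      have h2 : (if N = 0 then 0 else diagT 𝒜 (α N c)) = diagT 𝒜 (α N c) := by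
        split_ifs with hN
        · obtain ⟨a, ha⟩ := h0 c
          rw [hN, ha, derivation_inl]
        · rfl
      rw [h2, show δ 𝒜 2 = diag 𝒜 from rfl]
      abel

end Coderivation
end Koszul

/-! ### The theorem -/

theorem mainTheorem9 {k A : Type*} [Field k] [Ring A] [Algebra k A]
    (𝒜 : ℕ → Submodule k A) [GradedAlgebra 𝒜] (hA : Koszul.IsKoszul 𝒜) :
    AInfinity.IsCoalgebra (Koszul.grP 𝒜) (Koszul.δ 𝒜) ∧
    (∀ p : ℕ, LinearMap.range (Koszul.π 𝒜 p) = 𝒜 p) ∧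
    ∀ (n : ℕ) (α₀ : Koszul.P 𝒜 →ₗ[AInfinity.Env k A] A), Koszul.IsCocycle 𝒜 n α₀ →
      ∀ (I : Type*) (x : Module.Basis I k (Koszul.KPrime 𝒜 n))
        (y : I → ⨁ p : ℕ, ⨂[k]^p (𝒜 1)),
        (∀ t, Koszul.πSum 𝒜 (y t) = α₀ (Koszul.gen 𝒜 n (x t))) →
        ∃ α : ℕ → Koszul.P 𝒜 →ₗ[AInfinity.Env k A] AInfinity.T k A (Koszul.P 𝒜),
          AInfinity.IsCoderivation (Koszul.grP 𝒜) (Koszul.δ 𝒜) ((n : ℤ) - 1) α ∧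
          (∀ z, α 0 z = AInfinity.T.inl k A (Koszul.P 𝒜) (α₀ z)) ∧
          (∀ m, 1 ≤ m → ∀ j : ℤ, 1 - (n : ℤ) < j → ∀ z ∈ Koszul.grP 𝒜 j, α m z = 0) ∧
          (∀ m, 1 ≤ m → ∀ t,
            α m (Koszul.gen 𝒜 n (x t)) = (-1 : k) ^ m • Koszul.splitSum 𝒜 m (y t)) := by
  refine ⟨Koszul.isCoalgebra_δ 𝒜, Koszul.range_π 𝒜 hA, fun n α₀ hα I x y hy => ?_⟩
  -- The chosen lifts on the basis are extended linearly to K'_n; no further compatibility between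
  -- them is required.
  have hY : ∀ w, Koszul.πSum 𝒜 (x.constr k y w) = α₀ (Koszul.gen 𝒜 n w) := fun w =>
    LinearMap.congr_fun (f := Koszul.πSum 𝒜 ∘ₗ x.constr k y)
      (g := α₀.restrictScalars k ∘ₗ Koszul.gen 𝒜 n) (x.ext fun t => by
        rw [LinearMap.comp_apply, Module.Basis.constr_basis, hy]
        rfl) w
  obtain ⟨α, h0, hc, h⟩ := Koszul.exists_components 𝒜 hA hα hY
  have h0' : ∀ z, α 0 z = AInfinity.T.inl k A (Koszul.P 𝒜) (α₀ z) := LinearMap.congr_fun h0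
  refine ⟨α, Koszul.isCoderivation_of_components 𝒜 (fun N => (hc N).degree)
    (fun c => ⟨_, h0' c⟩) (fun c => ?_) h, h0', fun m _ j hj z hz => ?_, fun m _ t => ?_⟩
  · have hd : α₀ (Koszul.d 𝒜 c) = 0 := LinearMap.congr_fun hα.comp_d c
    rw [h0', hd, map_zero]
  · refine Koszul.grP_induction 𝒜 (p := fun z => α m z = 0) (map_zero _)
      (fun x y hx hy => by rw [map_add, hx, hy, add_zero])
      (fun e x hx => by rw [map_smul, hx, smul_zero]) (fun i w hi => ?_) hz
    exact (hc m).support i (by omega) w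
  · rw [(hc m).value, Module.Basis.constr_basis]
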